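/- **Theorem (Regret of UCB-MNL).** *Setting.* Let $1\le K\le N$, $d\ge 1$, $\theta^*\in\mathbb R^d$, and let $\mathcal S$ be the family of all $S\subseteq[N]$ with $|S|\le K$. In round $t=1,\dots,T$ the agent observes feature vectors $x_{ti}\in\mathbb R^d$ and revenues $r_{ti}\in[-1,1]$ ($i\in[N]$), offers $S_t\in\mathcal S$, and observes a choice $c_t\in S_t\cup\{0\}$ which, given everything that precedes it, has the multinomial logit law $p_t(\cdot\mid S_t,\theta^*)$, where $$p_t(i\mid S,\theta)=\frac{e^{x_{ti}^\top\theta}}{1+\sum_{j\in S}e^{x_{tj}^\top\theta}}\ (i\in S),\qquad p_t(0\mid S,\theta)=\frac{1}{1+\sum_{j\in S}e^{x_{tj}^\top\theta}} .$$ Put $y_{ti}=\mathbb 1(c_t=i)$, $R_t(S,\theta)=\sum_{i\in S}r_{ti}\,p_t(i\mid S,\theta)$, and $$\mathcal R_T=\mathbb E\Big[\sum_{t=1}^T\big(\max_{S\in\mathcal S}R_t(S,\theta^*)-R_t(S_t,\theta^*)\big)\Big].$$ *Assumptions.* (1) The vectors $x_{ti}$ are i.i.d. (those of round $t$ being independent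 of the past of the interaction) with $\|x_{ti}\|\le 1$ and $\mathbb E[x_{ti}x_{ti}^\top]\succeq\sigma_0 I$ for some $\sigma_0>0$. (2) For some $\kappa>0$, almost surely $p_t(i\mid S,\theta)\,p_t(0\mid S,\theta)\ge\kappa$ for all $t\le T$, $S\in\mathcal S$, $i\in S$ and all $\theta$ with $\|\theta-\theta^*\|\le 1$. *Algorithm UCB-MNL.* In rounds $t\le T_0$, $S_t$ is uniformly random among the sets of exactly $K$ items, given everything known at that time. Let $V_t=\sum_{s\le t}\sum_{i\in S_s}x_{si}x_{si}^\top$, and let $\hat\theta_t$ be a maximum likelihood estimate, i.e. a solution of $\sum_{s\le t}\sum_{i\in S_s}(p_s(i\mid S_s,\hat\theta_t)-y_{si})x_{si}=0$ (arbitrary if there is no solution). In rounds $t>T_0$, put $z_{ti}=x_{ti}^\top\hat\theta_{t-1}+\alpha_t\sqrt{x_{ti}^\top V_{t-1}^{-1}x_{ti}}$ (with an arbitrary fixed convention if $V_{t-1}$ is singular, here $V_{t-1}^{-1}:=0$), where $$\alpha_t=\frac1{2\kappa}\sqrt{2d\log\left(1+\tfrac td\right)+2\log t},$$ and let $S_t$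 be any maximizer over $S\in\mathcal S$ of $\tilde R_t(S)=\dfrac{\sum_{i\in S}r_{ti}e^{z_{ti}}}{1+\sum_{j\in S}e^{z_{tj}}}$. *Claim.* There are universal constants $C_0,C>0$ such that the following hold. (a) For all $d$, $K\le N$, $\kappa$, $\sigma_0$, all $T\ge d$, every such bandit problem, and every initialization length $$T_0\ \ge\ C_0\max\left\{\frac{d\log(T/d)+4\log T}{K\sigma_0\kappa^2},\ \frac{d+\log T}{\sigma_0^2}\right\},\tag{$*$}$$ $$\mathcal R_T\ \le\ 2T_0+\frac C\kappa\, d\sqrt{T\log(1+T/d)\log(T/d)} .$$ (b) In particular, if $T_0$ satisfies $(*)$ and $T_0\le C_1\max\{\kappa^{-2}(d\log(T/d)+4\log T),\,K/\sigma_0^2\}$, then $$\mathcal R_T\ \le\ \frac C\kappa\, d\sqrt{T\log(1+T/d)\log(T/d)}=\mathcal O\!\left(d\sqrt{T\log(1+T/d)\log(T/d)}\right)$$ for all $T\ge T_{\min}$, where $T_{\min}$ depends only on $d,K,\kappa,\sigma_0,C_1$. The bounds do not depend on $N$, on the law of the features, on the revenues or on $\theta^*$. -/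

import Mathlib

universe u

open MeasureTheory ProbabilityTheory

noncomputable section

namespace MNLBandit

/-- Feature and parameter space `ℝ^d` with the Euclidean norm. -/
abbrev Feature (d : ℕ) := EuclideanSpace ℝ (Fin d)

/-! ### The multinomial logit model in one round -/

/-- MNL revenue of the assortment `A` when item `i` has utility `u i` and revenue `r i`:
`(∑ i ∈ A, r i * exp (u i)) / (1 + ∑ j ∈ A, exp (u j))`. -/
def utilityRevenue {N : ℕ} (r u : Fin N → ℝ) (A : Finset (Fin N)) : ℝ :=
  (∑ i ∈ A, r i * Real.exp (u i)) / (1 + ∑ j ∈ A, Real.exp (u j))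

/-- MNL choice probabilities `p(· | A, θ)` given the features `x`; `none` is the outside option,
and items which are not offered have probability `0`. -/
def choiceProb {d N : ℕ} (x : Fin N → Feature d) (A : Finset (Fin N)) (θ : Feature d) :
    Option (Fin N) → ℝ
  | none => 1 / (1 + ∑ j ∈ A, Real.exp (inner ℝ (x j) θ))
  | some i =>
      if i ∈ A then
        Real.exp (inner ℝ (x i) θ) / (1 + ∑ j ∈ A, Real.exp (inner ℝ (x j) θ))
      else 0

/-- Expected revenue `R(A, θ) = ∑ i ∈ A, r i * p(i | A, θ)`. -/
def expectedRevenue {d N : ℕ} (x : Fin N → Feature d) (r : Fin N → ℝ) (θ : Feature d)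
    (A : Finset (Fin N)) : ℝ :=
  ∑ i ∈ A, r i * choiceProb x A θ (some i)

/-- Candidate assortments: the sets of at most `K` items. -/
def assortments (N K : ℕ) : Finset (Finset (Fin N)) :=
  Finset.univ.filter fun A => A.card ≤ K

theorem assortments_nonempty (N K : ℕ) : (assortments N K).Nonempty :=
  ⟨∅, by simp [assortments]⟩

/-- Expected revenue of an optimal assortment, `max_{|A| ≤ K} R(A, θ)`. -/
def optimalRevenue {d N : ℕ} (K : ℕ) (x : Fin N → Feature d) (r : Fin N → ℝ)
    (θ : Feature d) : ℝ :=
  (assortments N K).sup' (assortments_nonempty N K) (expectedRevenue x r θ)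

/-- The weighted norm `‖v‖_M = √(vᵀ M v)`. -/
def weightedNorm {d : ℕ} (M : Matrix (Fin d) (Fin d) ℝ) (v : Feature d) : ℝ :=
  Real.sqrt (v.ofLp ⬝ᵥ (M.mulVec v.ofLp))

/-! ### The interaction between agent and user

Rounds are numbered `1, 2, …`; index `0` is not used. -/

/-- The random quantities of an MNL contextual bandit with `N` items and features in `ℝ^d`. -/
structure Interaction (Ω : Type*) (d N : ℕ) where
  /-- `x t i` is the feature vector of item `i` in round `t` -/
  x : ℕ → Fin N → Ω → Feature d
  /-- `r t i` is the revenue of item `i` in round `t` -/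
  r : ℕ → Fin N → Ω → ℝ
  /-- `S t` is the assortment offered in round `t` -/
  S : ℕ → Ω → Finset (Fin N)
  /-- `c t` is the choice of the user in round `t`; `none` is the outside option -/
  c : ℕ → Ω → Option (Fin N)

namespace Interaction

variable {Ω : Type*} {d N : ℕ}

/-- The σ-algebra generated by all feature vectors of round `t`. -/
def contextInfo (I : Interaction Ω d N) (t : ℕ) : MeasurableSpace Ω :=
  MeasurableSpace.comap (fun ω i => I.x t i ω) inferInstance

/-- The σ-algebra generated by all revenues of round `t`. -/
def revenueInfo (I : Interaction Ω d N) (t : ℕ) : MeasurableSpace Ω :=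
  MeasurableSpace.comap (fun ω i => I.r t i ω) inferInstance

/-- The history up to the end of round `t`: features, revenues, assortments and choices of the
rounds `1, …, t`. -/
def history (I : Interaction Ω d N) : ℕ → MeasurableSpace Ω
  | 0 => ⊥
  | t + 1 => I.history t ⊔ I.contextInfo (t + 1) ⊔ I.revenueInfo (t + 1) ⊔
      MeasurableSpace.comap (I.S (t + 1)) ⊤ ⊔ MeasurableSpace.comap (I.c (t + 1)) ⊤

/-- What is known in round `t ≥ 1` before the assortment is selected. -/
def preDecision (I : Interaction Ω d N) (t : ℕ) : MeasurableSpace Ω :=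
  I.history (t - 1) ⊔ I.contextInfo t ⊔ I.revenueInfo t

/-- What is known in round `t ≥ 1` before the user chooses. -/
def preChoice (I : Interaction Ω d N) (t : ℕ) : MeasurableSpace Ω :=
  I.preDecision t ⊔ MeasurableSpace.comap (I.S t) ⊤

/-- The features of round `t`, at the outcome `ω`. -/
def feat (I : Interaction Ω d N) (t : ℕ) (ω : Ω) : Fin N → Feature d := fun i => I.x t i ω

/-- The revenues of round `t`, at the outcome `ω`. -/
def rev (I : Interaction Ω d N) (t : ℕ) (ω : Ω) : Fin N → ℝ := fun i => I.r t i ω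

/-- The response `y_{ti} = 1(c_t = i)`. -/
def response (I : Interaction Ω d N) (t : ℕ) (ω : Ω) (i : Fin N) : ℝ :=
  if I.c t ω = some i then 1 else 0

/-- `V_t = ∑_{s ≤ t} ∑_{i ∈ S_s} x_{si} x_{si}ᵀ`. -/
def gram (I : Interaction Ω d N) (t : ℕ) (ω : Ω) : Matrix (Fin d) (Fin d) ℝ :=
  ∑ s ∈ Finset.Icc 1 t, ∑ i ∈ I.S s ω,
    Matrix.vecMulVec (I.x s i ω).ofLp (I.x s i ω).ofLp

/-- Gradient of the negative log-likelihood of the first `t` rounds,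
`∑_{s ≤ t} ∑_{i ∈ S_s} (p_s(i | S_s, θ) - y_{si}) x_{si}`. -/
def score (I : Interaction Ω d N) (t : ℕ) (ω : Ω) (θ : Feature d) : Feature d :=
  ∑ s ∈ Finset.Icc 1 t, ∑ i ∈ I.S s ω,
    (choiceProb (I.feat s ω) (I.S s ω) θ (some i) - I.response s ω i) • I.x s i ω

/-- Cumulative expected regret over the rounds `1, …, T` against assortments of at most `K`
items. -/
def regret [MeasurableSpace Ω] (I : Interaction Ω d N) (μ : Measure Ω) (K : ℕ)
    (θstar : Feature d) (T : ℕ) : ℝ :=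
  ∫ ω, ∑ t ∈ Finset.Icc 1 T,
    (optimalRevenue K (I.feat t ω) (I.rev t ω) θstar
      - expectedRevenue (I.feat t ω) (I.rev t ω) θstar (I.S t ω)) ∂μ

end Interaction

/-- `I` follows the MNL contextual bandit model with parameter `θstar` in the rounds `1, …, T`:
revenues lie in `[-1, 1]`, and given everything that precedes it (including the offered
assortment) the choice of the user has the MNL distribution. -/
structure IsMNLModel {Ω : Type*} [MeasurableSpace Ω] {d N : ℕ} (μ : Measure Ω)
    (I : Interaction Ω d N) (θstar : Feature d) (T : ℕ) : Prop where
  measurable_x : ∀ t ∈ Finset.Icc 1 T, ∀ i, Measurable (I.x t i)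
  measurable_r : ∀ t ∈ Finset.Icc 1 T, ∀ i, Measurable (I.r t i)
  measurable_S : ∀ t ∈ Finset.Icc 1 T, ∀ A, MeasurableSet (I.S t ⁻¹' {A})
  measurable_c : ∀ t ∈ Finset.Icc 1 T, ∀ j, MeasurableSet (I.c t ⁻¹' {j})
  abs_r_le_one : ∀ t ∈ Finset.Icc 1 T, ∀ i, ∀ᵐ ω ∂μ, |I.r t i ω| ≤ 1
  choice_law : ∀ t ∈ Finset.Icc 1 T, ∀ j : Option (Fin N),
    μ⟦I.c t ⁻¹' {j} | I.preChoice t⟧ =ᵐ[μ]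
      fun ω => choiceProb (I.feat t ω) (I.S t ω) θstar j

/-- The features `x_{ti}`, `1 ≤ t ≤ T`, are drawn i.i.d. (in round `t` independently of the past
of the interaction), are bounded by `1`, and satisfy `E[x xᵀ] ⪰ σ₀ I`. -/
structure IIDContexts {Ω : Type*} [MeasurableSpace Ω] {d N : ℕ} (μ : Measure Ω)
    (I : Interaction Ω d N) (σ₀ : ℝ) (T : ℕ) : Prop where
  indep : iIndepFun (fun (p : Finset.Icc 1 T × Fin N) => I.x p.1 p.2) μ
  fresh : ∀ t ∈ Finset.Icc 1 T, Indep (I.history (t - 1)) (I.contextInfo t) μ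
  identDistrib : ∃ px : Measure (Feature d),
    (∀ t ∈ Finset.Icc 1 T, ∀ i, μ.map (I.x t i) = px) ∧
    (∀ᵐ v ∂px, ‖v‖ ≤ 1) ∧
    (Matrix.of (fun a b => ∫ v, v a * v b ∂px) - σ₀ • (1 : Matrix (Fin d) (Fin d) ℝ)).PosSemidef

/-- `p_t(i | A, θ) p_t(0 | A, θ) ≥ κ` for all rounds `t ≤ T`, all `A` with `|A| ≤ K`, all `i ∈ A`
and all `θ` in the closed unit ball around `θstar`. -/
def ProbLowerBound {Ω : Type*} [MeasurableSpace Ω] {d N : ℕ} (μ : Measure Ω)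
    (I : Interaction Ω d N) (K : ℕ) (θstar : Feature d) (κ : ℝ) (T : ℕ) : Prop :=
  ∀ t ∈ Finset.Icc 1 T, ∀ᵐ ω ∂μ, ∀ A ∈ assortments N K, ∀ i ∈ A, ∀ θ : Feature d,
    ‖θ - θstar‖ ≤ 1 →
      κ ≤ choiceProb (I.feat t ω) A θ (some i) * choiceProb (I.feat t ω) A θ none

/-! ### The algorithm UCB-MNL -/

/-- Confidence width `α_t = (1 / (2κ)) √(2 d log(1 + t/d) + 2 log t)`. -/
def confWidth (d : ℕ) (κ : ℝ) (t : ℕ) : ℝ :=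
  1 / (2 * κ) * Real.sqrt (2 * d * Real.log (1 + (t : ℝ) / d) + 2 * Real.log t)

/-- Optimistic utility `z_{ti} = x_{ti}ᵀ θhat_{t-1} + α_t ‖x_{ti}‖_{V_{t-1}⁻¹}`. -/
def optimisticUtility {Ω : Type*} {d N : ℕ} (I : Interaction Ω d N) (α : ℕ → ℝ)
    (θhat : ℕ → Ω → Feature d) (t : ℕ) (ω : Ω) (i : Fin N) : ℝ :=
  inner ℝ (I.x t i ω) (θhat (t - 1) ω)
    + α t * weightedNorm (I.gram (t - 1) ω)⁻¹ (I.x t i ω)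

/-- In the rounds `1, …, T` the assortments are those of UCB-MNL with initialization length `T₀`,
confidence widths `α` and estimates `θhat`. In the first `T₀` rounds the assortment is uniform among
the sets of exactly `K` items, given everything known at that time. Afterwards it maximizes the
optimistic revenue over the sets of at most `K` items. The estimate `θhat t` solves the likelihood
equation of the first `t` rounds whenever that equation has a solution, and is unconstrained
otherwise. -/
structure IsUCBMNL {Ω : Type*} [MeasurableSpace Ω] {d N : ℕ} (μ : Measure Ω)
    (I : Interaction Ω d N) (K : ℕ) (α : ℕ → ℝ) (θhat : ℕ → Ω → Feature d) (T₀ T : ℕ) :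
    Prop where
  init : ∀ t ∈ Finset.Icc 1 T, t ≤ T₀ → ∀ A : Finset (Fin N), A.card = K →
    μ⟦I.S t ⁻¹' {A} | I.preDecision t⟧ =ᵐ[μ] fun _ => 1 / (N.choose K : ℝ)
  mle : ∀ t, T₀ ≤ t → t < T → ∀ᵐ ω ∂μ,
    (∃ θ, I.score t ω θ = 0) → I.score t ω (θhat t ω) = 0
  offer : ∀ t ∈ Finset.Icc 1 T, T₀ < t → ∀ᵐ ω ∂μ,
    I.S t ω ∈ assortments N K ∧ ∀ A ∈ assortments N K,
      utilityRevenue (I.rev t ω) (optimisticUtility I α θhat t ω) A ≤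
        utilityRevenue (I.rev t ω) (optimisticUtility I α θhat t ω) (I.S t ω)

/-- `I` is a run of UCB-MNL with confidence widths `confWidth d κ` and initialization length `T₀`
over `T` rounds of an MNL contextual bandit which satisfies the assumptions on the features and on
the choice probabilities. -/
structure IsUCBMNLRun {Ω : Type*} [MeasurableSpace Ω] {d N : ℕ} (μ : Measure Ω)
    (I : Interaction Ω d N) (K : ℕ) (θstar : Feature d) (θhat : ℕ → Ω → Feature d)
    (κ σ₀ : ℝ) (T₀ T : ℕ) : Prop where
  model : IsMNLModel μ I θstar T
  contexts : IIDContexts μ I σ₀ T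
  prob : ProbLowerBound μ I K θstar κ T
  algorithm : IsUCBMNL μ I K (confWidth d κ) θhat T₀ T

/-- `max {(d log(T/d) + 4 log T) / (K σ₀ κ²), (d + log T) / σ₀²}`. -/
def initThreshold (d K : ℕ) (κ σ₀ : ℝ) (T : ℕ) : ℝ :=
  max ((d * Real.log ((T : ℝ) / d) + 4 * Real.log T) / (K * σ₀ * κ ^ 2))
    ((d + Real.log T) / σ₀ ^ 2)

/-- `max {κ⁻² (d log(T/d) + 4 log T), K / σ₀²}`. -/
def initOrder (d K : ℕ) (κ σ₀ : ℝ) (T : ℕ) : ℝ :=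
  max ((κ ^ 2)⁻¹ * (d * Real.log ((T : ℝ) / d) + 4 * Real.log T)) (K / σ₀ ^ 2)

/-- `d √(T log(1 + T/d) log(T/d))`. -/
def regretRate (d T : ℕ) : ℝ :=
  d * Real.sqrt (T * Real.log (1 + (T : ℝ) / d) * Real.log ((T : ℝ) / d))

end MNLBandit

end

/-! The regret of an optimistic round reduces to a deterministic fact about logit revenues. Every
item of an optimal assortment earns at least the optimal value, so raising utilities cannot lower
the revenue of that assortment. Hence, if the optimistic utilities dominate the true ones and exceed
them by at most `m` on the offered set, the round costs at most `2 * m`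
(`optimalRevenue_sub_le_of_optimistic`).

The admissible `m` comes from a confidence ellipsoid for the maximum likelihood estimate. The
derivative of the one-round score along a line is the variance of the projected chosen feature. Its
outside-option part already dominates `κ` times the Gram form inside the unit ball around the true
parameter. If the score at the truth has `V⁻¹`-norm at most `β` and the least eigenvalue of `V`
exceeds `(β / κ) ^ 2`, the score points outward on the unit sphere. This forces a root inside the
ball (`exists_score_eq_zero`), and monotonicity excludes roots outside it. Every root is then within
`β / κ` of the truth in the `V`-norm (`weightedNorm_sub_le_of_score_eq_zero`).

At the truth the score is a sum of conditionally centred choice noises. Hoeffding's lemma makes its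
exponential a supermartingale, and mixing over Gaussian directions gives a self-normalized tail
bound (`measure_score_ge_le`). The failure level `e / √t` is the one that matches the prescribed
width `α_t`: the factor `e` pays for removing the regularizer `K • 1`. Such failures cost only
`O(√T)` in total.

During uniform exploration the fresh features make the Gram matrix concentrate around `K T₀` times
the second-moment matrix. A net and a Chernoff bound give least eigenvalue at least `K T₀ σ₀ / 2`
outside an event of probability at most `1 / T` (`measure_not_le_quadForm_gram_le`,
`initThreshold_consequences`).

Finally, the squared weighted feature norms are dominated by increments of the log-determinant,
which telescope to at most `2 d log(T / d)`. Cauchy–Schwarz and the width `α_T` then give the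
leading term (`RegularAt.sum_potentialStep_le`). -/

noncomputable section

namespace MNLBandit

/-! ### Multinomial logit revenue and optimism -/

section Revenue
variable {d N : ℕ}

theorem one_add_sum_exp_pos (u : Fin N → ℝ) (A : Finset (Fin N)) :
    0 < 1 + ∑ j ∈ A, Real.exp (u j) := by
  have : 0 ≤ ∑ j ∈ A, Real.exp (u j) := Finset.sum_nonneg fun _ _ => (Real.exp_pos _).le
  linarith

theorem expectedRevenue_eq_utilityRevenue (x : Fin N → Feature d) (r : Fin N → ℝ)
    (θ : Feature d) (A : Finset (Fin N)) :
    expectedRevenue x r θ A = utilityRevenue r (fun i => inner ℝ (x i) θ) A := by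
  unfold expectedRevenue utilityRevenue
  rw [Finset.sum_div]
  refine Finset.sum_congr rfl fun i hi => ?_
  simp [choiceProb, hi, mul_div_assoc]

theorem abs_utilityRevenue_le_one {r : Fin N → ℝ} (hr : ∀ i, |r i| ≤ 1) (u : Fin N → ℝ)
    (A : Finset (Fin N)) : |utilityRevenue r u A| ≤ 1 := by
  unfold utilityRevenue
  rw [abs_div, abs_of_pos (one_add_sum_exp_pos u A), div_le_one (one_add_sum_exp_pos u A)]
  calc |∑ i ∈ A, r i * Real.exp (u i)| ≤ ∑ i ∈ A, |r i * Real.exp (u i)| :=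
        Finset.abs_sum_le_sum_abs _ _
    _ ≤ ∑ i ∈ A, Real.exp (u i) := Finset.sum_le_sum fun i _ => by
        rw [abs_mul, abs_of_pos (Real.exp_pos _)]
        exact mul_le_of_le_one_left (Real.exp_pos _).le (hr i)
    _ ≤ _ := by linarith

/-- Every item of an optimal assortment has a revenue of at least the optimal value. -/
theorem utilityRevenue_le_revenue_of_optimal {r u : Fin N → ℝ} {K : ℕ} {A : Finset (Fin N)}
    (hA : A ∈ assortments N K)
    (hopt : ∀ B ∈ assortments N K, utilityRevenue r u B ≤ utilityRevenue r u A) {i : Fin N}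
    (hi : i ∈ A) : utilityRevenue r u A ≤ r i := by
  have hB : A.erase i ∈ assortments N K := by
    simp only [assortments, Finset.mem_filter, Finset.mem_univ, true_and] at hA ⊢
    exact (Finset.card_erase_le).trans hA
  -- Deleting `i` lowers the numerator by `r i * exp (u i)` and the denominator by `exp (u i)`;
  -- optimality forbids an increase of the quotient, which forces `R ≤ r i`.
  have h := hopt _ hB
  set R := utilityRevenue r u A with hR
  have hRe : ∑ i ∈ A, r i * Real.exp (u i) = R * (1 + ∑ j ∈ A, Real.exp (u j)) := by
    rw [hR, utilityRevenue, div_mul_cancel₀ _ (one_add_sum_exp_pos u A).ne']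
  rw [utilityRevenue, div_le_iff₀ (one_add_sum_exp_pos u _)] at h
  have h1 := Finset.sum_erase_add A (fun i => r i * Real.exp (u i)) hi
  have h2 := Finset.sum_erase_add A (fun i => Real.exp (u i)) hi
  rw [hRe, ← h2] at h1
  have h3 : R * Real.exp (u i) ≤ r i * Real.exp (u i) := by nlinarith
  exact le_of_mul_le_mul_right h3 (Real.exp_pos _)

/-- Raising the utilities does not decrease the revenue of an optimal assortment. -/
theorem utilityRevenue_mono_of_optimal {r u z : Fin N → ℝ} {K : ℕ} {A : Finset (Fin N)}
    (hA : A ∈ assortments N K)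
    (hopt : ∀ B ∈ assortments N K, utilityRevenue r u B ≤ utilityRevenue r u A)
    (huz : ∀ i ∈ A, u i ≤ z i) : utilityRevenue r u A ≤ utilityRevenue r z A := by
  have hr := fun i (hi : i ∈ A) => utilityRevenue_le_revenue_of_optimal hA hopt hi
  set R := utilityRevenue r u A with hR
  have hRe : ∑ i ∈ A, r i * Real.exp (u i) = R * (1 + ∑ j ∈ A, Real.exp (u j)) := by
    rw [hR, utilityRevenue, div_mul_cancel₀ _ (one_add_sum_exp_pos u A).ne']
  rw [utilityRevenue, le_div_iff₀ (one_add_sum_exp_pos z _)]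
  -- The definition of `R` says that the left-hand sum equals `R`. Its coefficients are nonnegative
  -- by optimality, so it can only grow with the utilities.
  have h : ∑ i ∈ A, (r i - R) * Real.exp (u i) ≤ ∑ i ∈ A, (r i - R) * Real.exp (z i) :=
    Finset.sum_le_sum fun i hi => mul_le_mul_of_nonneg_left (Real.exp_le_exp.2 (huz i hi))
      (sub_nonneg.2 (hr i hi))
  simp only [sub_mul, Finset.sum_sub_distrib, ← Finset.mul_sum] at h
  linarith

/-- Measured against the fixed value `R` of the lower utilities, the difference of revenues is `∑ (r
i - R) (exp (z i) - exp (u i))` over the denominator at `z`. Since `r i - R ≤ 2` and `1 - exp (u i -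
z i) ≤ m`, normalizing by the larger exponentials avoids any factor `exp m`. -/
theorem utilityRevenue_sub_le {r u z : Fin N → ℝ} (hr : ∀ i, |r i| ≤ 1) {A : Finset (Fin N)}
    {m : ℝ} (hm : 0 ≤ m) (h0 : ∀ i ∈ A, u i ≤ z i) (h1 : ∀ i ∈ A, z i ≤ u i + m) :
    utilityRevenue r z A - utilityRevenue r u A ≤ 2 * m := by
  have hRabs := abs_utilityRevenue_le_one hr u A
  set R := utilityRevenue r u A with hR
  have hRe : ∑ i ∈ A, r i * Real.exp (u i) = R * (1 + ∑ j ∈ A, Real.exp (u j)) := by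
    rw [hR, utilityRevenue, div_mul_cancel₀ _ (one_add_sum_exp_pos u A).ne']
  have hterm : ∀ i ∈ A, (r i - R) * Real.exp (z i) - (r i - R) * Real.exp (u i)
      ≤ 2 * m * Real.exp (z i) := by
    intro i hi
    have hz := Real.exp_pos (z i)
    have e1 : Real.exp (u i) ≤ Real.exp (z i) := Real.exp_le_exp.2 (h0 i hi)
    have e2 : (1 - m) * Real.exp (z i) ≤ Real.exp (u i) := by
      have : Real.exp (u i) = Real.exp (u i - z i) * Real.exp (z i) := by
        rw [← Real.exp_add]; ring_nf
      rw [this]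
      refine mul_le_mul_of_nonneg_right ?_ hz.le
      have := Real.add_one_le_exp (u i - z i)
      linarith [h1 i hi]
    have hri := abs_le.1 (hr i)
    have hRR := abs_le.1 hRabs
    have : r i - R ≤ 2 := by linarith
    nlinarith
  have h := Finset.sum_le_sum hterm
  simp only [sub_mul, Finset.sum_sub_distrib, ← Finset.mul_sum] at h
  have hz := one_add_sum_exp_pos z A
  rw [sub_le_iff_le_add, utilityRevenue, div_le_iff₀ hz]
  nlinarith

theorem expectedRevenue_abs_le_one {x : Fin N → Feature d} {r : Fin N → ℝ}
    (hr : ∀ i, |r i| ≤ 1) (θ : Feature d) (A : Finset (Fin N)) :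
    |expectedRevenue x r θ A| ≤ 1 := by
  rw [expectedRevenue_eq_utilityRevenue]; exact abs_utilityRevenue_le_one hr _ _

theorem optimalRevenue_sub_le_two {K : ℕ} {x : Fin N → Feature d} {r : Fin N → ℝ}
    (hr : ∀ i, |r i| ≤ 1) (θ : Feature d) (A : Finset (Fin N)) :
    optimalRevenue K x r θ - expectedRevenue x r θ A ≤ 2 := by
  have h1 : optimalRevenue K x r θ ≤ 1 :=
    Finset.sup'_le _ _ fun B _ => (abs_le.1 (expectedRevenue_abs_le_one hr θ B)).2
  linarith [(abs_le.1 (expectedRevenue_abs_le_one (x := x) hr θ A)).1]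

/-- Regret of an optimistic assortment in one round. -/
theorem optimalRevenue_sub_le_of_optimistic {K : ℕ} {x : Fin N → Feature d} {r z : Fin N → ℝ}
    (hr : ∀ i, |r i| ≤ 1) (θ : Feature d) {A : Finset (Fin N)}
    (hmax : ∀ B ∈ assortments N K, utilityRevenue r z B ≤ utilityRevenue r z A)
    {m : ℝ} (hm : 0 ≤ m) (h0 : ∀ i, inner ℝ (x i) θ ≤ z i)
    (h1 : ∀ i ∈ A, z i ≤ inner ℝ (x i) θ + m) :
    optimalRevenue K x r θ - expectedRevenue x r θ A ≤ 2 * m := by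
  obtain ⟨B, hB, hBe⟩ := Finset.exists_mem_eq_sup' (assortments_nonempty N K)
    (expectedRevenue x r θ)
  have hopt : ∀ B' ∈ assortments N K, utilityRevenue r (fun i => inner ℝ (x i) θ) B' ≤
      utilityRevenue r (fun i => inner ℝ (x i) θ) B := by
    intro B' hB'
    rw [← expectedRevenue_eq_utilityRevenue, ← expectedRevenue_eq_utilityRevenue, ← hBe]
    exact Finset.le_sup' _ hB'
  -- The chain is: true value of `B` ≤ optimistic value of `B` ≤ optimistic value of `A` ≤ true
  -- value of `A` plus `2 * m`.
  have h2 := utilityRevenue_mono_of_optimal hB hopt (z := z) fun i _ => h0 i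
  have h3 := hmax B hB
  have h4 := utilityRevenue_sub_le hr hm (fun i _ => h0 i) h1
  rw [optimalRevenue, hBe, expectedRevenue_eq_utilityRevenue, expectedRevenue_eq_utilityRevenue]
  linarith

end Revenue

/-! ### Choice probabilities: curvature and sub-Gaussian noise -/

section Choice
variable {d N : ℕ}

theorem choiceProb_nonneg (x : Fin N → Feature d) (A : Finset (Fin N)) (θ : Feature d)
    (j : Option (Fin N)) : 0 ≤ choiceProb x A θ j := by
  have h := (one_add_sum_exp_pos (fun j => inner ℝ (x j) θ) A).le
  cases j with
  | none => exact div_nonneg zero_le_one h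
  | some i =>
    simp only [choiceProb]
    split_ifs
    · exact div_nonneg (Real.exp_pos _).le h
    · exact le_rfl

theorem choiceProb_none_add_sum (x : Fin N → Feature d) (A : Finset (Fin N)) (θ : Feature d) :
    choiceProb x A θ none + ∑ i ∈ A, choiceProb x A θ (some i) = 1 := by
  have h := one_add_sum_exp_pos (fun j => inner ℝ (x j) θ) A
  have : ∑ i ∈ A, choiceProb x A θ (some i)
      = (∑ i ∈ A, Real.exp (inner ℝ (x i) θ)) / (1 + ∑ j ∈ A, Real.exp (inner ℝ (x j) θ)) := by
    rw [Finset.sum_div]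
    exact Finset.sum_congr rfl fun i hi => by simp [choiceProb, hi]
  rw [this, choiceProb, ← add_div, div_self h.ne']

theorem sum_choiceProb_mul (x : Fin N → Feature d) (A : Finset (Fin N)) (θ : Feature d)
    (f : Fin N → ℝ) :
    ∑ i, choiceProb x A θ (some i) * f i = ∑ i ∈ A, choiceProb x A θ (some i) * f i := by
  symm
  refine Finset.sum_subset (Finset.subset_univ _) fun i _ hi => ?_
  simp [choiceProb, hi]

theorem sum_choiceProb (x : Fin N → Feature d) (A : Finset (Fin N)) (θ : Feature d) :
    ∑ j, choiceProb x A θ j = 1 := by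
  have := sum_choiceProb_mul x A θ fun _ => 1
  simp only [mul_one] at this
  rw [Fintype.sum_option, this, choiceProb_none_add_sum]

/-- Derivative of the expected projected feature along a line. -/
theorem hasDerivAt_sum_choiceProb_mul (x : Fin N → Feature d) (A : Finset (Fin N))
    (θ v : Feature d) (s : ℝ) :
    HasDerivAt (fun s : ℝ => ∑ i ∈ A, choiceProb x A (θ + s • v) (some i) * inner ℝ (x i) v)
      (∑ i ∈ A, choiceProb x A (θ + s • v) (some i) * (inner ℝ (x i) v) ^ 2
        - (∑ i ∈ A, choiceProb x A (θ + s • v) (some i) * inner ℝ (x i) v) ^ 2) s := by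
  set D : ℝ → ℝ := fun s => 1 + ∑ j ∈ A, Real.exp (inner ℝ (x j) (θ + s • v)) with hD
  have hDpos : ∀ s, 0 < D s := fun s => one_add_sum_exp_pos _ A
  have hexp : ∀ i, HasDerivAt (fun s : ℝ => Real.exp (inner ℝ (x i) (θ + s • v)))
      (Real.exp (inner ℝ (x i) (θ + s • v)) * inner ℝ (x i) v) s := by
    intro i
    have : HasDerivAt (fun s : ℝ => inner ℝ (x i) (θ + s • v)) (inner ℝ (x i) v) s := by
      simp only [inner_add_right, inner_smul_right]
      simpa using ((hasDerivAt_id s).mul_const (inner ℝ (x i) v)).const_add (inner ℝ (x i) θ)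
    exact this.exp
  have hDd : HasDerivAt D (∑ i ∈ A, Real.exp (inner ℝ (x i) (θ + s • v)) * inner ℝ (x i) v) s :=
    (HasDerivAt.fun_sum fun i _ => hexp i).const_add 1
  have hNd : HasDerivAt (fun s : ℝ => ∑ i ∈ A, Real.exp (inner ℝ (x i) (θ + s • v))
      * inner ℝ (x i) v) (∑ i ∈ A, Real.exp (inner ℝ (x i) (θ + s • v)) * inner ℝ (x i) v
      * inner ℝ (x i) v) s := HasDerivAt.fun_sum fun i _ => (hexp i).mul_const _
  have hq := hNd.fun_div hDd (hDpos s).ne'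
  have hform : ∀ (s : ℝ) (f : Fin N → ℝ), ∑ i ∈ A, choiceProb x A (θ + s • v) (some i) * f i =
      (∑ i ∈ A, Real.exp (inner ℝ (x i) (θ + s • v)) * f i) / D s := by
    intro s f
    rw [Finset.sum_div]
    refine Finset.sum_congr rfl fun i hi => ?_
    simp only [choiceProb, hi, if_true, hD]
    ring
  simp only [hform]
  refine hq.congr_deriv ?_
  have hne := (hDpos s).ne'
  have hsq : ∀ i, Real.exp (inner ℝ (x i) (θ + s • v)) * inner ℝ (x i) v * inner ℝ (x i) v =
      Real.exp (inner ℝ (x i) (θ + s • v)) * (inner ℝ (x i) v) ^ 2 := fun i => by ring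
  simp only [hsq]
  rw [eq_comm, div_pow, sub_div, sq (D s), mul_div_mul_right _ _ hne, ← sq (D s), ← sq]

/-- The variance of the projected feature is at least its outside-option part. -/
theorem sum_choiceProb_mul_sq_sub_sq_ge (x : Fin N → Feature d) (A : Finset (Fin N))
    (θ : Feature d) (a : Fin N → ℝ) :
    ∑ i ∈ A, choiceProb x A θ (some i) * choiceProb x A θ none * (a i) ^ 2 ≤
      ∑ i ∈ A, choiceProb x A θ (some i) * (a i) ^ 2
        - (∑ i ∈ A, choiceProb x A θ (some i) * a i) ^ 2 := by
  -- Cauchy–Schwarz under the choice law restricted to `A`, whose total mass is only `1 - p(none)`;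
  -- the missing mass is the gain.
  have hcs : (∑ i ∈ A, choiceProb x A θ (some i) * a i) ^ 2 ≤
      (∑ i ∈ A, choiceProb x A θ (some i)) * ∑ i ∈ A, choiceProb x A θ (some i) * (a i) ^ 2 :=
    Finset.sum_sq_le_sum_mul_sum_of_sq_le_mul _ (fun i _ => choiceProb_nonneg _ _ _ _)
      (fun i _ => mul_nonneg (choiceProb_nonneg _ _ _ _) (sq_nonneg _)) (fun i _ => (by ring : _ = _).le)
  have h1 : ∑ i ∈ A, choiceProb x A θ (some i) = 1 - choiceProb x A θ none := by
    linarith [choiceProb_none_add_sum x A θ]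
  have h2 : ∑ i ∈ A, choiceProb x A θ (some i) * choiceProb x A θ none * (a i) ^ 2 =
      choiceProb x A θ none * ∑ i ∈ A, choiceProb x A θ (some i) * (a i) ^ 2 := by
    rw [Finset.mul_sum]; exact Finset.sum_congr rfl fun i _ => by ring
  rw [h1] at hcs
  rw [h2]
  linarith

/-- The derivative is a variance, hence nonnegative everywhere. Outside the unit ball around the
true parameter, where no lower bound `κ` is available, this is the convexity that remains. -/
theorem monotone_sum_choiceProb_mul (x : Fin N → Feature d) (A : Finset (Fin N))
    (θ v : Feature d) : Monotone
      (fun s : ℝ => ∑ i ∈ A, choiceProb x A (θ + s • v) (some i) * inner ℝ (x i) v) := by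
  refine monotone_of_hasDerivAt_nonneg (fun s => hasDerivAt_sum_choiceProb_mul x A θ v s)
    fun s => ?_
  refine le_trans (Finset.sum_nonneg fun i _ => ?_)
    (sum_choiceProb_mul_sq_sub_sq_ge x A (θ + s • v) fun i => inner ℝ (x i) v)
  exact mul_nonneg (mul_nonneg (choiceProb_nonneg _ _ _ _) (choiceProb_nonneg _ _ _ _))
    (sq_nonneg _)

/-- Strong monotonicity of the one-round score in the unit ball around `θ`. -/
theorem curvature_le_sum_choiceProb_sub {x : Fin N → Feature d} {A : Finset (Fin N)}
    {θ v : Feature d} {κ : ℝ}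
    (hκ : ∀ i ∈ A, ∀ θ' : Feature d, ‖θ' - θ‖ ≤ 1 →
      κ ≤ choiceProb x A θ' (some i) * choiceProb x A θ' none) (hv : ‖v‖ ≤ 1) :
    κ * ∑ i ∈ A, (inner ℝ (x i) v) ^ 2 ≤
      ∑ i ∈ A, (choiceProb x A (θ + v) (some i) - choiceProb x A θ (some i)) * inner ℝ (x i) v := by
  -- Mean value theorem on `[0, 1]`: the intermediate point `θ + s • v` stays in the ball where `hκ`
  -- applies.
  obtain ⟨s, hs, hse⟩ := exists_hasDerivAt_eq_slope
    (fun s : ℝ => ∑ i ∈ A, choiceProb x A (θ + s • v) (some i) * inner ℝ (x i) v) _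
    (zero_lt_one' ℝ)
    (fun s _ => (hasDerivAt_sum_choiceProb_mul x A θ v s).continuousAt.continuousWithinAt)
    fun s _ => hasDerivAt_sum_choiceProb_mul x A θ v s
  simp only [one_smul, zero_smul, add_zero, sub_zero, div_one, ← Finset.sum_sub_distrib,
    ← sub_mul] at hse
  rw [← hse, Finset.mul_sum]
  refine le_trans (Finset.sum_le_sum fun i hi => ?_)
    (sum_choiceProb_mul_sq_sub_sq_ge x A (θ + s • v) fun i => inner ℝ (x i) v)
  refine mul_le_mul_of_nonneg_right (hκ i hi _ ?_) (sq_nonneg _)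
  rw [add_sub_cancel_left, norm_smul, Real.norm_eq_abs, abs_of_pos hs.1]
  exact mul_le_one₀ hs.2.le (norm_nonneg _) hv

/-- Hoeffding's lemma for a law on a finite type. -/
theorem sum_mul_exp_sub_mean_le {ι : Type*} [Fintype ι] {w a : ι → ℝ} (hw : ∀ j, 0 ≤ w j)
    (hw1 : ∑ j, w j = 1) {l h : ℝ} (ha : ∀ j, a j ∈ Set.Icc l h) :
    ∑ j, w j * Real.exp (a j - ∑ i, w i * a i) ≤ Real.exp ((h - l) ^ 2 / 8) := by
  let _ : MeasurableSpace ι := ⊤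
  -- The finite law is realized as a sum of weighted Dirac masses, so that Hoeffding's lemma for
  -- bounded random variables applies.
  let P : Measure ι := ∑ j, ENNReal.ofReal (w j) • Measure.dirac j
  have : IsProbabilityMeasure P := ⟨by
    simp only [P, Measure.coe_finsetSum, Finset.sum_apply, Measure.smul_apply,
      Measure.dirac_apply', MeasurableSet.univ, Set.indicator_univ, Pi.one_apply, smul_eq_mul,
      mul_one]
    rw [← ENNReal.ofReal_sum_of_nonneg fun j _ => hw j, hw1, ENNReal.ofReal_one]⟩
  have hint : ∀ f : ι → ℝ, ∫ j, f j ∂P = ∑ j, w j * f j := by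
    intro f
    have hf : ∀ j, Integrable f (ENNReal.ofReal (w j) • Measure.dirac j) := fun j =>
      (integrable_dirac (by simp)).smul_measure ENNReal.ofReal_ne_top
    simp only [P]
    rw [integral_finsetSum_measure fun j _ => hf j]
    refine Finset.sum_congr rfl fun j _ => ?_
    rw [integral_smul_measure, integral_dirac, ENNReal.toReal_ofReal (hw j), smul_eq_mul]
  have hs := (hasSubgaussianMGF_of_mem_Icc (μ := P) (X := a) (a := l) (b := h)
    (measurable_from_top).aemeasurable (Filter.Eventually.of_forall ha)).mgf_le 1
  rw [mgf, hint, hint] at hs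
  simp only [one_mul] at hs
  refine hs.trans (Real.exp_le_exp.2 (le_of_eq ?_))
  push_cast
  rw [Real.norm_eq_abs, div_pow, sq_abs]
  ring

/-- The projected choice noise is sub-Gaussian. -/
theorem sum_choiceProb_mul_exp_le (x : Fin N → Feature d) (A : Finset (Fin N)) (θ : Feature d)
    (a : Fin N → ℝ) :
    ∑ j, choiceProb x A θ j * Real.exp (∑ i ∈ A,
      (choiceProb x A θ (some i) - if j = some i then 1 else 0) * a i) ≤
      Real.exp (1 / 4 * ∑ i ∈ A, (a i) ^ 2) := by
  classical
  -- `b j` is the random part of the exponent: minus the coefficient of the chosen item, and `0` for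
  -- the outside option or an item not offered. The exponent is `b` minus its mean.
  let b : Option (Fin N) → ℝ := fun j => j.elim 0 fun i => if i ∈ A then - a i else 0
  have hmean : ∑ j, choiceProb x A θ j * b j = - ∑ i ∈ A, choiceProb x A θ (some i) * a i := by
    rw [Fintype.sum_option]
    simp only [b, Option.elim_none, mul_zero, zero_add, Option.elim_some]
    rw [sum_choiceProb_mul, ← Finset.sum_neg_distrib]
    exact Finset.sum_congr rfl fun i hi => by simp [hi]
  have hb : ∀ j, ∑ i ∈ A, (choiceProb x A θ (some i) - if j = some i then 1 else 0) * a i =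
      b j - ∑ j, choiceProb x A θ j * b j := by
    intro j
    rw [hmean]
    simp only [sub_mul, Finset.sum_sub_distrib]
    have : b j = - ∑ i ∈ A, (if j = some i then (1:ℝ) else 0) * a i := by
      cases j with
      | none => simp [b]
      | some k => simp [b, ite_mul]; split_ifs <;> simp
    rw [this]; ring
  obtain ⟨jM, -, hM⟩ := Finset.exists_max_image Finset.univ b Finset.univ_nonempty
  obtain ⟨jm, -, hm⟩ := Finset.exists_min_image Finset.univ b Finset.univ_nonempty
  have h := sum_mul_exp_sub_mean_le (w := choiceProb x A θ) (a := b) (choiceProb_nonneg x A θ)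
    (sum_choiceProb x A θ) (l := b jm) (h := b jM) fun j => ⟨hm j (Finset.mem_univ _),
      hM j (Finset.mem_univ _)⟩
  simp only [hb]
  refine h.trans (Real.exp_le_exp.2 ?_)
  have hsum : ∑ j, (b j) ^ 2 = ∑ i ∈ A, (a i) ^ 2 := by
    rw [Fintype.sum_option]
    simp [b, ite_pow]
  -- The squared range is at most twice the sum of squares, which turns Hoeffding's `1 / 8` into `1
  -- / 4`.
  have hsq : (b jM - b jm) ^ 2 ≤ 2 * ∑ j, (b j) ^ 2 := by
    by_cases hne : jM = jm
    · rw [hne, sub_self]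
      simp only [ne_eq, OfNat.ofNat_ne_zero, not_false_eq_true, zero_pow]
      exact mul_nonneg zero_le_two (Finset.sum_nonneg fun _ _ => sq_nonneg _)
    · have : ∑ j ∈ {jM, jm}, (b j) ^ 2 ≤ ∑ j, (b j) ^ 2 :=
        Finset.sum_le_sum_of_subset_of_nonneg (Finset.subset_univ _) fun _ _ _ => sq_nonneg _
      rw [Finset.sum_pair hne] at this
      nlinarith [sq_nonneg (b jM + b jm)]
  rw [hsum] at hsq
  linarith

end Choice

/-! ### Quadratic forms, dual norms and determinants -/

section LinearAlgebra
variable {d : ℕ}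

/-- The quadratic form `vᵀ M v` on the Euclidean space. -/
def quadForm (M : Matrix (Fin d) (Fin d) ℝ) (v : Feature d) : ℝ := v.ofLp ⬝ᵥ (M.mulVec v.ofLp)

theorem inner_eq_dotProduct (u v : Feature d) : inner ℝ u v = u.ofLp ⬝ᵥ v.ofLp := by
  rw [EuclideanSpace.inner_eq_star_dotProduct, star_trivial, dotProduct_comm]

theorem norm_sq_eq_dotProduct (v : Feature d) : ‖v‖ ^ 2 = v.ofLp ⬝ᵥ v.ofLp := by
  rw [← real_inner_self_eq_norm_sq, inner_eq_dotProduct]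

theorem weightedNorm_eq_sqrt (M : Matrix (Fin d) (Fin d) ℝ) (v : Feature d) :
    weightedNorm M v = Real.sqrt (quadForm M v) := rfl

theorem quadForm_nonneg {M : Matrix (Fin d) (Fin d) ℝ} (hM : M.PosSemidef) (v : Feature d) :
    0 ≤ quadForm M v := by
  simpa [quadForm] using hM.dotProduct_mulVec_nonneg v.ofLp

theorem sq_weightedNorm {M : Matrix (Fin d) (Fin d) ℝ} (hM : M.PosSemidef) (v : Feature d) :
    weightedNorm M v ^ 2 = quadForm M v := Real.sq_sqrt (quadForm_nonneg hM v)

theorem quadForm_add (M M' : Matrix (Fin d) (Fin d) ℝ) (v : Feature d) :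
    quadForm (M + M') v = quadForm M v + quadForm M' v := by
  simp [quadForm, Matrix.add_mulVec, dotProduct_add]

theorem quadForm_smul (c : ℝ) (M : Matrix (Fin d) (Fin d) ℝ) (v : Feature d) :
    quadForm (c • M) v = c * quadForm M v := by
  simp [quadForm, Matrix.smul_mulVec, dotProduct_smul]

theorem quadForm_one (v : Feature d) : quadForm 1 v = ‖v‖ ^ 2 := by
  simp [quadForm, norm_sq_eq_dotProduct]

theorem quadForm_sum {ι : Type*} (s : Finset ι) (M : ι → Matrix (Fin d) (Fin d) ℝ)
    (v : Feature d) : quadForm (∑ i ∈ s, M i) v = ∑ i ∈ s, quadForm (M i) v := by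
  classical
  induction s using Finset.induction_on with
  | empty => simp [quadForm]
  | insert a s ha ih => rw [Finset.sum_insert ha, Finset.sum_insert ha, quadForm_add, ih]

theorem quadForm_vecMulVec (x v : Feature d) :
    quadForm (Matrix.vecMulVec x.ofLp x.ofLp) v = (inner ℝ x v) ^ 2 := by
  rw [quadForm, Matrix.vecMulVec_mulVec, inner_eq_dotProduct, op_smul_eq_smul, dotProduct_smul,
    smul_eq_mul, dotProduct_comm v.ofLp, sq]

theorem posSemidef_vecMulVec_self (x : Feature d) :
    (Matrix.vecMulVec x.ofLp x.ofLp).PosSemidef := by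
  simpa using Matrix.posSemidef_vecMulVec_self_star x.ofLp

theorem posDef_of_le_quadForm {M : Matrix (Fin d) (Fin d) ℝ} (hM : M.PosSemidef) {l : ℝ}
    (hl : 0 < l) (h : ∀ v, l * ‖v‖ ^ 2 ≤ quadForm M v) : M.PosDef := by
  refine Matrix.PosDef.of_dotProduct_mulVec_pos hM.1 fun x hx => ?_
  have h1 := h (WithLp.toLp 2 x)
  have h2 : 0 < ‖(WithLp.toLp 2 x : Feature d)‖ := norm_pos_iff.2 (by simpa using hx)
  have h3 : 0 < quadForm M (WithLp.toLp 2 x) := lt_of_lt_of_le (by positivity) h1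
  simpa [quadForm] using h3

theorem mulVec_inv_mulVec {V : Matrix (Fin d) (Fin d) ℝ} (hV : V.PosDef) (u : Fin d → ℝ) :
    V.mulVec (V⁻¹.mulVec u) = u := by
  rw [Matrix.mulVec_mulVec, Matrix.mul_nonsing_inv _ hV.det_pos.ne'.isUnit, Matrix.one_mulVec]

theorem quadForm_toLp_inv_mulVec {V : Matrix (Fin d) (Fin d) ℝ} (hV : V.PosDef) (u : Feature d) :
    quadForm V (WithLp.toLp 2 (V⁻¹.mulVec u.ofLp)) = quadForm V⁻¹ u := by
  simp only [quadForm]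
  rw [mulVec_inv_mulVec hV, dotProduct_comm]

theorem dotProduct_mulVec_comm {V : Matrix (Fin d) (Fin d) ℝ} (hV : V.IsHermitian)
    (u v : Fin d → ℝ) : u ⬝ᵥ V.mulVec v = v ⬝ᵥ V.mulVec u := by
  have hT : V.transpose = V := by simpa [Matrix.IsHermitian] using hV
  rw [Matrix.dotProduct_mulVec, ← Matrix.mulVec_transpose, hT, dotProduct_comm]

/-- Completing the square. -/
theorem quadForm_sub_smul_inv {V : Matrix (Fin d) (Fin d) ℝ} (hV : V.PosDef) (u v : Feature d)
    (c : ℝ) : quadForm V (v - c • WithLp.toLp 2 (V⁻¹.mulVec u.ofLp)) =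
      quadForm V v - 2 * c * inner ℝ u v + c ^ 2 * quadForm V⁻¹ u := by
  rw [← quadForm_toLp_inv_mulVec hV u, inner_eq_dotProduct]
  simp only [quadForm, WithLp.ofLp_sub, WithLp.ofLp_smul, Matrix.mulVec_sub, Matrix.mulVec_smul,
    mulVec_inv_mulVec hV, sub_dotProduct, dotProduct_sub, smul_dotProduct, dotProduct_smul,
    smul_eq_mul]
  rw [dotProduct_mulVec_comm hV.1 (V⁻¹.mulVec u.ofLp) v.ofLp, mulVec_inv_mulVec hV,
    dotProduct_comm v.ofLp u.ofLp]
  ring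

/-- The form `V` at `v - c V⁻¹ u` is a nonnegative quadratic polynomial in `c`, so its discriminant
is nonpositive. -/
theorem inner_sq_le_quadForm_mul {V : Matrix (Fin d) (Fin d) ℝ} (hV : V.PosDef) (u v : Feature d) :
    (inner ℝ u v) ^ 2 ≤ quadForm V⁻¹ u * quadForm V v := by
  have h : ∀ c : ℝ, 0 ≤ quadForm V⁻¹ u * (c * c) + (-2 * inner ℝ u v) * c + quadForm V v := by
    intro c
    have := quadForm_nonneg hV.posSemidef (v - c • WithLp.toLp 2 (V⁻¹.mulVec u.ofLp))
    rw [quadForm_sub_smul_inv hV] at this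
    linarith
  have := discrim_le_zero h
  rw [discrim] at this
  linarith

theorem abs_inner_le_weightedNorm_mul {V : Matrix (Fin d) (Fin d) ℝ} (hV : V.PosDef)
    (u v : Feature d) : |inner ℝ u v| ≤ weightedNorm V⁻¹ u * weightedNorm V v := by
  rw [weightedNorm_eq_sqrt, weightedNorm_eq_sqrt,
    ← Real.sqrt_mul (quadForm_nonneg hV.inv.posSemidef u)]
  exact Real.abs_le_sqrt (inner_sq_le_quadForm_mul hV u v)

/-- Comparison of inverse forms: if `W ≤ c V` then `V⁻¹ ≤ c W⁻¹`. -/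
theorem quadForm_inv_le_mul {V W : Matrix (Fin d) (Fin d) ℝ} (hV : V.PosDef) (hW : W.PosDef)
    {c : ℝ} (hc : 0 ≤ c) (h : ∀ v, quadForm W v ≤ c * quadForm V v) (u : Feature d) :
    quadForm V⁻¹ u ≤ c * quadForm W⁻¹ u := by
  -- Testing the Cauchy–Schwarz inequality of `W` on `V⁻¹ u` bounds the square of `quadForm V⁻¹ u`;
  -- one factor is then cancelled.
  have h1 := inner_sq_le_quadForm_mul hW u (WithLp.toLp 2 (V⁻¹.mulVec u.ofLp))
  have h2 := h (WithLp.toLp 2 (V⁻¹.mulVec u.ofLp))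
  rw [quadForm_toLp_inv_mulVec hV] at h2
  have h3 : inner ℝ u (WithLp.toLp 2 (V⁻¹.mulVec u.ofLp)) = quadForm V⁻¹ u := by
    rw [inner_eq_dotProduct]; rfl
  rw [h3] at h1
  have h4 := quadForm_nonneg hV.inv.posSemidef u
  have h5 := quadForm_nonneg hW.inv.posSemidef u
  rcases h4.eq_or_lt with h0 | h0
  · rw [← h0]; positivity
  · have : quadForm V⁻¹ u * quadForm V⁻¹ u ≤ (c * quadForm W⁻¹ u) * quadForm V⁻¹ u := by nlinarith
    exact le_of_mul_le_mul_right this h0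

theorem quadForm_inv_le {V : Matrix (Fin d) (Fin d) ℝ} (hV : V.PosDef) {l : ℝ} (hl : 0 < l)
    (h : ∀ v, l * ‖v‖ ^ 2 ≤ quadForm V v) (u : Feature d) :
    quadForm V⁻¹ u ≤ ‖u‖ ^ 2 / l := by
  have := quadForm_inv_le_mul hV (Matrix.PosDef.one (n := Fin d) (R := ℝ)) (inv_nonneg.2 hl.le)
    (fun v => by
      rw [quadForm_one, inv_mul_eq_div, le_div_iff₀ hl, mul_comm]; exact h v) u
  rwa [inv_one, quadForm_one, inv_mul_eq_div] at this

/-- This is the matrix determinant lemma for a symmetric rank-one update. -/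
theorem det_add_vecMulVec {V : Matrix (Fin d) (Fin d) ℝ} (hV : V.PosDef) (x : Feature d) :
    (V + Matrix.vecMulVec x.ofLp x.ofLp).det = V.det * (1 + quadForm V⁻¹ x) := by
  rw [Matrix.vecMulVec_eq Unit, Matrix.det_add_replicateCol_mul_replicateRow
    hV.det_pos.ne'.isUnit, ← Matrix.replicateRow_vecMul, Matrix.replicateRow_mul_replicateCol]
  simp [quadForm, Matrix.dotProduct_mulVec]

theorem det_le_det_add_sum {ι : Type*} (A : Finset ι) (x : ι → Feature d)
    {V : Matrix (Fin d) (Fin d) ℝ} (hV : V.PosDef) :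
    V.det ≤ (V + ∑ i ∈ A, Matrix.vecMulVec (x i).ofLp (x i).ofLp).det := by
  classical
  induction A using Finset.induction_on generalizing V with
  | empty => simp
  | insert a A ha ih =>
    rw [Finset.sum_insert ha, ← add_assoc]
    refine le_trans ?_ (ih (hV.add_posSemidef (posSemidef_vecMulVec_self _)))
    rw [det_add_vecMulVec hV]
    have := quadForm_nonneg hV.inv.posSemidef (x a)
    nlinarith [hV.det_pos]

/-- The update by item `i` is applied alone first; the remaining rank-one updates cannot decrease
the determinant. Thus any single item, and so the worst one of an assortment, is charged to the
whole increment of the round. -/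
theorem det_mul_le_det_add_sum {ι : Type*} {A : Finset ι} (x : ι → Feature d)
    {V : Matrix (Fin d) (Fin d) ℝ} (hV : V.PosDef) {i : ι} (hi : i ∈ A) :
    V.det * (1 + quadForm V⁻¹ (x i)) ≤
      (V + ∑ i ∈ A, Matrix.vecMulVec (x i).ofLp (x i).ofLp).det := by
  classical
  rw [← Finset.add_sum_erase A _ hi, ← add_assoc, ← det_add_vecMulVec hV]
  exact det_le_det_add_sum _ _ (hV.add_posSemidef (posSemidef_vecMulVec_self _))

/-- Arithmetic–geometric mean inequality for the eigenvalues. -/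
theorem det_le_trace_div_pow (hd : 1 ≤ d) {V : Matrix (Fin d) (Fin d) ℝ} (hV : V.PosSemidef) :
    V.det ≤ (V.trace / d) ^ d := by
  have hd0 : (0 : ℝ) < d := by exact_mod_cast hd
  have h0 := hV.eigenvalues_nonneg
  have h := Real.geom_mean_le_arith_mean_weighted Finset.univ (fun _ : Fin d => 1 / (d : ℝ))
    hV.1.eigenvalues (fun _ _ => by positivity) (by simp [hd0.ne']) (fun i _ => h0 i)
  rw [hV.1.det_eq_prod_eigenvalues, hV.1.trace_eq_sum_eigenvalues]
  simp only [RCLike.ofReal_real_eq_id, id_eq]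
  rw [Real.finsetProd_rpow _ _ (fun i _ => h0 i), ← Finset.mul_sum] at h
  have h2 := pow_le_pow_left₀ (Real.rpow_nonneg (Finset.prod_nonneg fun i _ => h0 i) _) h d
  rw [← Real.rpow_natCast, ← Real.rpow_mul (Finset.prod_nonneg fun i _ => h0 i), one_div,
    inv_mul_cancel₀ hd0.ne', Real.rpow_one] at h2
  rwa [inv_mul_eq_div] at h2

/-- Evaluating the form at unit eigenvectors shows that every eigenvalue is at least `l`. -/
theorem pow_le_det {V : Matrix (Fin d) (Fin d) ℝ} (hV : V.PosSemidef) {l : ℝ} (hl : 0 ≤ l)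
    (h : ∀ v, l * ‖v‖ ^ 2 ≤ quadForm V v) : l ^ d ≤ V.det := by
  have hev : ∀ i, l ≤ hV.1.eigenvalues i := by
    intro i
    have h1 := h (hV.1.eigenvectorBasis i)
    have h2 := hV.1.mulVec_eigenvectorBasis i
    rw [quadForm, h2, dotProduct_smul, ← norm_sq_eq_dotProduct,
      hV.1.eigenvectorBasis.orthonormal.1 i] at h1
    simpa using h1
  rw [hV.1.det_eq_prod_eigenvalues]
  simp only [RCLike.ofReal_real_eq_id, id_eq]
  calc l ^ d = ∏ _i : Fin d, l := by simp
    _ ≤ _ := Finset.prod_le_prod (fun _ _ => hl) fun i _ => hev i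

/-- Elliptical potential: increments of the log-determinant dominate the squared weighted norms. -/
theorem quadForm_inv_le_two_mul_log {ι : Type*} {A : Finset ι} (x : ι → Feature d)
    {V : Matrix (Fin d) (Fin d) ℝ} (hV : V.PosDef) {i : ι} (hi : i ∈ A)
    (h1 : quadForm V⁻¹ (x i) ≤ 1) :
    quadForm V⁻¹ (x i) ≤ 2 * (Real.log
      (V + ∑ i ∈ A, Matrix.vecMulVec (x i).ofLp (x i).ofLp).det - Real.log V.det) := by
  have h0 := quadForm_nonneg hV.inv.posSemidef (x i)
  have h2 := Real.log_le_log (mul_pos hV.det_pos (by linarith)) (det_mul_le_det_add_sum x hV hi)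
  rw [Real.log_mul hV.det_pos.ne' (by linarith)] at h2
  -- For `0 ≤ q ≤ 1` one has `q / 2 ≤ q / (1 + q) ≤ log (1 + q)`; this is where `h1` enters.
  have h3 : quadForm V⁻¹ (x i) / 2 ≤ Real.log (1 + quadForm V⁻¹ (x i)) := by
    have h4 := Real.one_sub_inv_le_log_of_pos (x := 1 + quadForm V⁻¹ (x i)) (by linarith)
    refine le_trans ?_ h4
    have : 1 - (1 + quadForm V⁻¹ (x i))⁻¹ = quadForm V⁻¹ (x i) / (1 + quadForm V⁻¹ (x i)) := by
      field_simp; ring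
    rw [this]
    exact div_le_div_of_nonneg_left h0 (by linarith) (by linarith)
  linarith

end LinearAlgebra

/-! ### A half-net of the ball and operator norms -/

section Net
variable {d : ℕ}

/-- The unit ball of `ℝ^d` has a `1/2`-net of at most `5^d` points. -/
theorem exists_half_net (d : ℕ) : ∃ s : Finset (Feature d), s.card ≤ 5 ^ d ∧
    (∀ u ∈ s, ‖u‖ ≤ 1) ∧ ∀ v : Feature d, ‖v‖ ≤ 1 → ∃ u ∈ s, ‖v - u‖ ≤ 1 / 2 := by
  classical
  let P : Finset (Feature d) → Prop := fun s => (∀ u ∈ s, ‖u‖ ≤ 1) ∧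
    ∀ u ∈ s, ∀ w ∈ s, u ≠ w → 1 / 2 ≤ ‖u - w‖
  have hcard : ∀ s, P s → s.card ≤ 5 ^ d := by
    intro s hs
    have hinj : Function.Injective fun u : Feature d => (2 : ℝ) • u :=
      smul_right_injective _ two_ne_zero
    -- The packing bound `5 ^ d` concerns points at mutual distance at least `1` in the ball of
    -- radius `2`, hence the dilation by `2`.
    have h := Besicovitch.card_le_of_separated (s.image fun u : Feature d => (2 : ℝ) • u) ?_ ?_
    · rwa [Finset.card_image_of_injective _ hinj, finrank_euclideanSpace_fin] at h
    · intro c hc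
      obtain ⟨u, hu, rfl⟩ := Finset.mem_image.1 hc
      rw [norm_smul, Real.norm_eq_abs, abs_two]
      linarith [hs.1 u hu]
    · intro c hc e he hce
      obtain ⟨u, hu, rfl⟩ := Finset.mem_image.1 hc
      obtain ⟨w, hw, rfl⟩ := Finset.mem_image.1 he
      rw [← smul_sub, norm_smul, Real.norm_eq_abs, abs_two]
      linarith [hs.2 u hu w hw fun h => hce (by rw [h])]
  let Q : ℕ → Prop := fun n => ∃ s, P s ∧ s.card = n
  have hQ0 : Q 0 := ⟨∅, ⟨by simp, by simp⟩, rfl⟩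
  -- A separated set of maximal cardinality is a net: a point far from all of `s` could be added to
  -- it.
  obtain ⟨s, hs, hsn⟩ := Nat.findGreatest_spec (P := Q) (Nat.zero_le (5 ^ d)) hQ0
  refine ⟨s, hcard s hs, hs.1, fun v hv => ?_⟩
  by_contra! hno
  have hvs : v ∉ s := fun h => by have := hno v h; norm_num at this
  have hins : P (insert v s) := by
    refine ⟨fun u hu => ?_, fun u hu w hw huw => ?_⟩
    · rcases Finset.mem_insert.1 hu with rfl | hu
      exacts [hv, hs.1 u hu]
    · rcases Finset.mem_insert.1 hu with hu' | hu' <;>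
        rcases Finset.mem_insert.1 hw with hw' | hw'
      · exact absurd (hu'.trans hw'.symm) huw
      · rw [hu']; exact (hno w hw').le
      · rw [hw', norm_sub_rev]; exact (hno u hu').le
      · exact hs.2 u hu' w hw' huw
  have hle := Nat.le_findGreatest (P := Q) (hcard _ hins) ⟨_, hins, rfl⟩
  rw [Finset.card_insert_of_notMem hvs] at hle
  omega

/-- A bilinear form which is at most `c` on a `1/2`-net has norm at most `4 c`. -/
theorem opNorm_le_of_half_net {s : Finset (Feature d)}
    (hnet : ∀ v : Feature d, ‖v‖ ≤ 1 → ∃ u ∈ s, ‖v - u‖ ≤ 1 / 2)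
    (L : Feature d →L[ℝ] Feature d) {c : ℝ}
    (hc : ∀ u ∈ s, ∀ v ∈ s, inner ℝ u (L v) ≤ c) : ‖L‖ ≤ 4 * c := by
  have h1 : ∀ v ∈ s, ‖L v‖ ≤ 2 * c := by
    intro v hv
    set w := L v with hw
    -- The normalized vector is `0` when `w = 0`, because `0⁻¹ = 0`, so that case needs no separate
    -- choice of net point. Pairing `w` with its normalization and replacing the latter by a net
    -- point loses at most half of `‖w‖`.
    have hunit : ‖(‖w‖⁻¹ • w)‖ ≤ 1 := by
      rw [norm_smul, norm_inv, norm_norm]; exact inv_mul_le_one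
    obtain ⟨u, hu, huv⟩ := hnet _ hunit
    have e1 : inner ℝ (‖w‖⁻¹ • w) w = ‖w‖ := by
      rw [real_inner_smul_left, real_inner_self_eq_norm_sq, sq]
      rcases eq_or_ne ‖w‖ 0 with h | h
      · simp [h]
      · field_simp
    have e2 : inner ℝ (‖w‖⁻¹ • w - u) w ≤ 1 / 2 * ‖w‖ :=
      (real_inner_le_norm _ _).trans (mul_le_mul_of_nonneg_right huv (norm_nonneg _))
    rw [inner_sub_left, e1] at e2
    linarith [hc u hu v hv]
  obtain ⟨u0, hu0, -⟩ := hnet 0 (by simp)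
  have hc0 : 0 ≤ c := by have := (norm_nonneg _).trans (h1 u0 hu0); linarith
  -- The same absorption in the second argument costs another factor `2`.
  have h2 : ‖L‖ ≤ 2 * c + 1 / 2 * ‖L‖ := by
    refine L.opNorm_le_of_unit_norm (by positivity) fun v hv => ?_
    obtain ⟨u, hu, huv⟩ := hnet v hv.le
    calc ‖L v‖ = ‖L u + L (v - u)‖ := by rw [← map_add, add_sub_cancel]
      _ ≤ ‖L u‖ + ‖L (v - u)‖ := norm_add_le _ _
      _ ≤ 2 * c + ‖L‖ * (1 / 2) := add_le_add (h1 u hu) (L.le_opNorm_of_le huv)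
      _ = _ := by ring
  linarith

/-- Letting both arguments range over the net lets one-sided bounds control the operator norm, for a
matrix that need not be symmetric. -/
theorem quadForm_le_of_half_net {s : Finset (Feature d)}
    (hnet : ∀ v : Feature d, ‖v‖ ≤ 1 → ∃ u ∈ s, ‖v - u‖ ≤ 1 / 2)
    (M : Matrix (Fin d) (Fin d) ℝ) {c : ℝ}
    (hc : ∀ u ∈ s, ∀ v ∈ s, u.ofLp ⬝ᵥ M.mulVec v.ofLp ≤ c) (v : Feature d) :
    quadForm M v ≤ 4 * c * ‖v‖ ^ 2 := by
  have hL : ∀ u v : Feature d, inner ℝ u (Matrix.toEuclideanCLM (𝕜 := ℝ) M v) =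
      u.ofLp ⬝ᵥ M.mulVec v.ofLp := by
    intro u v
    rw [inner_eq_dotProduct, Matrix.ofLp_toEuclideanCLM]
  have h := opNorm_le_of_half_net hnet (Matrix.toEuclideanCLM (𝕜 := ℝ) M) (c := c)
    fun u hu v hv => by rw [hL]; exact hc u hu v hv
  rw [quadForm, ← hL]
  calc inner ℝ v (Matrix.toEuclideanCLM (𝕜 := ℝ) M v) ≤
      ‖v‖ * ‖Matrix.toEuclideanCLM (𝕜 := ℝ) M v‖ := real_inner_le_norm _ _
    _ ≤ ‖v‖ * (4 * c * ‖v‖) := mul_le_mul_of_nonneg_left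
        (((Matrix.toEuclideanCLM (𝕜 := ℝ) M).le_opNorm v).trans
          (mul_le_mul_of_nonneg_right h (norm_nonneg _))) (norm_nonneg _)
    _ = _ := by ring

end Net

/-! ### Gaussian integrals for the method of mixtures -/

section Gaussian
variable {d : ℕ}

theorem continuous_quadForm (M : Matrix (Fin d) (Fin d) ℝ) : Continuous (quadForm M) := by
  unfold quadForm dotProduct Matrix.mulVec dotProduct
  fun_prop

/-- The unnormalized mass of the Gaussian with density `exp (-‖ξ‖² / 4)`. -/
def gaussianMass (d : ℕ) : ENNReal :=
  ∫⁻ ξ : Feature d, ENNReal.ofReal (Real.exp (-(1 / 4) * ‖ξ‖ ^ 2))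

theorem gaussianMass_eq (d : ℕ) : gaussianMass d =
    ENNReal.ofReal ((Real.pi / (1 / 4)) ^ ((Module.finrank ℝ (Feature d) : ℝ) / 2)) := by
  have hpos : 0 < (Real.pi / (1 / 4)) ^ ((Module.finrank ℝ (Feature d) : ℝ) / 2) :=
    Real.rpow_pos_of_pos (by positivity) _
  have h := GaussianFourier.integral_rexp_neg_mul_sq_norm (V := Feature d) (b := 1 / 4)
    (by norm_num)
  have hint : Integrable fun ξ : Feature d => Real.exp (-(1 / 4) * ‖ξ‖ ^ 2) := by
    -- Otherwise the integral would have the default value `0`, whereas the known formula is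
    -- positive.
    by_contra hn
    rw [integral_undef hn] at h
    exact hpos.ne h
  rw [gaussianMass, ← ofReal_integral_eq_lintegral_ofReal hint
    (Filter.Eventually.of_forall fun _ => (Real.exp_pos _).le), h]

theorem gaussianMass_ne_top (d : ℕ) : gaussianMass d ≠ ⊤ := by
  rw [gaussianMass_eq]; exact ENNReal.ofReal_ne_top

theorem gaussianMass_ne_zero (d : ℕ) : gaussianMass d ≠ 0 := by
  rw [gaussianMass_eq]
  exact (ENNReal.ofReal_pos.2 (Real.rpow_pos_of_pos (by positivity) _)).ne'

-- The square root is the linear change of variables that carries the Gaussian of form `W` to the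
-- standard one.
open scoped MatrixOrder in
theorem exists_sqrt_matrix {W : Matrix (Fin d) (Fin d) ℝ} (hW : W.PosDef) :
    ∃ B : Matrix (Fin d) (Fin d) ℝ, B.det = Real.sqrt W.det ∧
      ∀ v : Feature d, quadForm W v = ‖(WithLp.toLp 2 (B.mulVec v.ofLp) : Feature d)‖ ^ 2 := by
  refine ⟨CFC.sqrt W, ?_, fun v => ?_⟩
  · simpa using hW.posSemidef.det_sqrt
  · have h1 : CFC.sqrt W * CFC.sqrt W = W :=
      CFC.sqrt_mul_sqrt_self W (Matrix.nonneg_iff_posSemidef.2 hW.posSemidef)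
    have h2 : (CFC.sqrt W).IsHermitian :=
      (Matrix.nonneg_iff_posSemidef.1 (CFC.sqrt_nonneg W)).1
    rw [norm_sq_eq_dotProduct, quadForm, ← dotProduct_mulVec_comm h2, Matrix.mulVec_mulVec, h1]

/-- Substituting by the square root of `W` produces the determinant factor. The constant
`gaussianMass d` can stay symbolic because it cancels in the deviation bound. -/
theorem lintegral_exp_neg_quadForm {W : Matrix (Fin d) (Fin d) ℝ} (hW : W.PosDef) :
    ∫⁻ ξ : Feature d, ENNReal.ofReal (Real.exp (-(1 / 4) * quadForm W ξ)) =
      ENNReal.ofReal (Real.sqrt W.det)⁻¹ * gaussianMass d := by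
  obtain ⟨B, hB, hq⟩ := exists_sqrt_matrix hW
  have hdet : 0 < B.det := by rw [hB]; exact Real.sqrt_pos.2 hW.det_pos
  let f : Feature d →ₗ[ℝ] Feature d := Matrix.toEuclideanLin B
  have hf : LinearMap.det f = B.det := by
    simp [f, Matrix.toLpLin_eq_toLin, LinearMap.det_toLin]
  have hmap := Measure.map_linearMap_addHaar_eq_smul_addHaar (volume : Measure (Feature d))
    (f := f) (by rw [hf]; exact hdet.ne')
  have hfm : Measurable f := f.continuous_of_finiteDimensional.measurable
  have hval : ∀ ξ, quadForm W ξ = ‖f ξ‖ ^ 2 := fun ξ => hq ξ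
  simp only [hval]
  rw [← lintegral_map (μ := volume) (g := f)
    (f := fun ξ : Feature d => ENNReal.ofReal (Real.exp (-(1 / 4) * ‖ξ‖ ^ 2)))
    (by fun_prop) hfm, hmap, lintegral_smul_measure, hf, hB, abs_of_nonneg (by positivity)]
  rfl

/-- Gaussian mixture of the exponential of a linear form. -/
theorem lintegral_exp_inner_sub_quadForm {W : Matrix (Fin d) (Fin d) ℝ} (hW : W.PosDef)
    (u : Feature d) :
    ∫⁻ ξ : Feature d, ENNReal.ofReal (Real.exp (inner ℝ u ξ - 1 / 4 * quadForm W ξ)) =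
      ENNReal.ofReal (Real.exp (quadForm W⁻¹ u) * (Real.sqrt W.det)⁻¹) * gaussianMass d := by
  -- With the factor `1 / 4` in front of the form, the square is completed by the shift `2 W⁻¹ u`;
  -- translation invariance then removes it.
  have h : ∀ ξ : Feature d, ENNReal.ofReal (Real.exp (inner ℝ u ξ - 1 / 4 * quadForm W ξ)) =
      ENNReal.ofReal (Real.exp (quadForm W⁻¹ u)) * (fun ξ => ENNReal.ofReal (Real.exp
        (-(1 / 4) * quadForm W ξ))) (ξ - (2 : ℝ) • WithLp.toLp 2 (W⁻¹.mulVec u.ofLp)) := by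
    intro ξ
    simp only
    rw [← ENNReal.ofReal_mul (Real.exp_pos _).le, ← Real.exp_add, quadForm_sub_smul_inv hW]
    ring_nf
  simp only [h]
  rw [lintegral_const_mul _ (by
      have := continuous_quadForm W
      fun_prop), lintegral_sub_right_eq_self (fun ξ => ENNReal.ofReal (Real.exp
      (-(1 / 4) * quadForm W ξ))), lintegral_exp_neg_quadForm hW, ← mul_assoc,
    ENNReal.ofReal_mul (Real.exp_pos _).le]

end Gaussian

/-! ### The likelihood equation and the confidence ellipsoid -/

section Likelihood
variable {Ω : Type*} {d N : ℕ} (I : Interaction Ω d N)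

theorem quadForm_gram (t : ℕ) (ω : Ω) (v : Feature d) :
    quadForm (I.gram t ω) v = ∑ s ∈ Finset.Icc 1 t, ∑ i ∈ I.S s ω, (inner ℝ (I.x s i ω) v) ^ 2 := by
  simp only [Interaction.gram, quadForm_sum, quadForm_vecMulVec]

theorem posSemidef_gram (t : ℕ) (ω : Ω) : (I.gram t ω).PosSemidef :=
  Matrix.posSemidef_sum _ fun _ _ => Matrix.posSemidef_sum _ fun _ _ => posSemidef_vecMulVec_self _

theorem gram_succ (t : ℕ) (ω : Ω) : I.gram (t + 1) ω = I.gram t ω +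
    ∑ i ∈ I.S (t + 1) ω, Matrix.vecMulVec (I.x (t + 1) i ω).ofLp (I.x (t + 1) i ω).ofLp :=
  Finset.sum_Icc_succ_top (by omega) _

theorem quadForm_gram_mono {s t : ℕ} (hst : s ≤ t) (ω : Ω) (v : Feature d) :
    quadForm (I.gram s ω) v ≤ quadForm (I.gram t ω) v := by
  rw [quadForm_gram, quadForm_gram]
  exact Finset.sum_le_sum_of_subset_of_nonneg (Finset.Icc_subset_Icc_right hst)
    fun _ _ _ => Finset.sum_nonneg fun _ _ => sq_nonneg _

theorem inner_score (t : ℕ) (ω : Ω) (θ v : Feature d) :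
    inner ℝ (I.score t ω θ) v = ∑ s ∈ Finset.Icc 1 t, ∑ i ∈ I.S s ω,
      (choiceProb (I.feat s ω) (I.S s ω) θ (some i) - I.response s ω i)
        * inner ℝ (I.x s i ω) v := by
  simp only [Interaction.score, sum_inner, real_inner_smul_left]

theorem monotone_inner_score (t : ℕ) (ω : Ω) (θ v : Feature d) :
    Monotone fun s : ℝ => inner ℝ (I.score t ω (θ + s • v)) v := by
  intro a b hab
  simp only [inner_score, sub_mul, Finset.sum_sub_distrib]
  refine sub_le_sub_right (Finset.sum_le_sum fun s _ => ?_) _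
  exact monotone_sum_choiceProb_mul (I.feat s ω) (I.S s ω) θ v hab

/-- The curvature bound on the choice probabilities of the first `t` rounds at the outcome `ω`. -/
def CurvatureBound (κ : ℝ) (θ : Feature d) (t : ℕ) (ω : Ω) : Prop :=
  ∀ s ∈ Finset.Icc 1 t, ∀ i ∈ I.S s ω, ∀ θ' : Feature d, ‖θ' - θ‖ ≤ 1 →
    κ ≤ choiceProb (I.feat s ω) (I.S s ω) θ' (some i) * choiceProb (I.feat s ω) (I.S s ω) θ' none

variable {I}

theorem curvature_le_inner_score_sub {κ : ℝ} {θ v : Feature d} {t : ℕ} {ω : Ω}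
    (hκ : CurvatureBound I κ θ t ω) (hv : ‖v‖ ≤ 1) :
    κ * quadForm (I.gram t ω) v ≤
      inner ℝ (I.score t ω (θ + v)) v - inner ℝ (I.score t ω θ) v := by
  rw [quadForm_gram, inner_score, inner_score, ← Finset.sum_sub_distrib, Finset.mul_sum]
  refine Finset.sum_le_sum fun s hs => ?_
  refine (curvature_le_sum_choiceProb_sub (x := I.feat s ω) (hκ s hs) hv).trans (le_of_eq ?_)
  rw [← Finset.sum_sub_distrib]
  exact Finset.sum_congr rfl fun i _ => by simp only [Interaction.feat]; ring

/-- Curvature contributes `κ ‖v‖_V ^ 2`, and the score at `θ` can cancel at most `β ‖v‖_V` of it by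
duality. -/
theorem le_inner_score {κ β : ℝ} {θ v : Feature d} {t : ℕ} {ω : Ω}
    (hκ : CurvatureBound I κ θ t ω) (hV : (I.gram t ω).PosDef)
    (hβ : weightedNorm (I.gram t ω)⁻¹ (I.score t ω θ) ≤ β) (hv : ‖v‖ ≤ 1) :
    (κ * weightedNorm (I.gram t ω) v - β) * weightedNorm (I.gram t ω) v ≤
      inner ℝ (I.score t ω (θ + v)) v := by
  have h1 := curvature_le_inner_score_sub hκ hv
  have h2 := (abs_le.1 (abs_inner_le_weightedNorm_mul hV (I.score t ω θ) v)).1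
  have h0 : 0 ≤ weightedNorm (I.gram t ω) v := Real.sqrt_nonneg _
  rw [← sq_weightedNorm hV.posSemidef] at h1
  nlinarith [mul_le_mul_of_nonneg_right hβ h0]

/-- On the unit sphere `‖v‖_V ≥ √l`, and `β < κ √l` makes the curvature term win. An
outward-pointing gradient is what confines the roots of the score to the ball. -/
theorem inner_score_pos_of_norm_eq_one {κ β l : ℝ} {θ v : Feature d} {t : ℕ} {ω : Ω}
    (hκ : CurvatureBound I κ θ t ω) (hκ0 : 0 < κ) (hV : (I.gram t ω).PosDef)
    (hβ : weightedNorm (I.gram t ω)⁻¹ (I.score t ω θ) ≤ β) (hl : 0 < l)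
    (hVl : ∀ v, l * ‖v‖ ^ 2 ≤ quadForm (I.gram t ω) v) (hβl : β < κ * Real.sqrt l)
    (hv : ‖v‖ = 1) : 0 < inner ℝ (I.score t ω (θ + v)) v := by
  refine lt_of_lt_of_le ?_ (le_inner_score hκ hV hβ hv.le)
  have h1 : Real.sqrt l ≤ weightedNorm (I.gram t ω) v := by
    have := hVl v
    rw [hv, one_pow, mul_one] at this
    exact Real.sqrt_le_sqrt this
  have h2 : κ * Real.sqrt l ≤ κ * weightedNorm (I.gram t ω) v :=
    mul_le_mul_of_nonneg_left h1 hκ0.le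
  exact mul_pos (by linarith) ((Real.sqrt_pos.2 hl).trans_le h1)

variable (I)

/-- The negative log-likelihood of the first `t` rounds. -/
def negLogLik (t : ℕ) (ω : Ω) (θ : Feature d) : ℝ :=
  ∑ s ∈ Finset.Icc 1 t, (Real.log (1 + ∑ j ∈ I.S s ω, Real.exp (inner ℝ (I.x s j ω) θ))
    - ∑ i ∈ I.S s ω, I.response s ω i * inner ℝ (I.x s i ω) θ)

theorem continuous_negLogLik (t : ℕ) (ω : Ω) : Continuous (negLogLik I t ω) := by
  unfold negLogLik
  refine continuous_finsetSum _ fun s _ => Continuous.sub (Continuous.log (by fun_prop)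
    fun θ => (one_add_sum_exp_pos _ _).ne') (by fun_prop)

theorem hasDerivAt_negLogLik (t : ℕ) (ω : Ω) (θ v : Feature d) (a : ℝ) :
    HasDerivAt (fun a : ℝ => negLogLik I t ω (θ + a • v))
      (inner ℝ (I.score t ω (θ + a • v)) v) a := by
  have hin : ∀ y : Feature d, HasDerivAt (fun a : ℝ => inner ℝ y (θ + a • v)) (inner ℝ y v) a := by
    intro y
    simp only [inner_add_right, inner_smul_right]
    simpa using ((hasDerivAt_id a).mul_const (inner ℝ y v)).const_add (inner ℝ y θ)
  rw [inner_score]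
  unfold negLogLik
  refine HasDerivAt.fun_sum fun s _ => ?_
  have h1 : HasDerivAt (fun a : ℝ => Real.log (1 + ∑ j ∈ I.S s ω,
      Real.exp (inner ℝ (I.x s j ω) (θ + a • v)))) _ a :=
    ((HasDerivAt.fun_sum fun i _ => (hin (I.x s i ω)).exp).const_add 1).log
      (one_add_sum_exp_pos _ _).ne'
  have h2 : HasDerivAt (fun a : ℝ => ∑ i ∈ I.S s ω, I.response s ω i *
      inner ℝ (I.x s i ω) (θ + a • v)) _ a :=
    HasDerivAt.fun_sum fun i _ => (hin (I.x s i ω)).const_mul _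
  refine (h1.sub h2).congr_deriv ?_
  rw [Finset.sum_div, ← Finset.sum_sub_distrib]
  refine Finset.sum_congr rfl fun i hi => ?_
  simp only [choiceProb, hi, if_true, Interaction.feat]
  ring

variable {I}

/-- Existence of a solution of the likelihood equation. -/
theorem exists_score_eq_zero {κ β l : ℝ} {θ : Feature d} {t : ℕ} {ω : Ω}
    (hκ : CurvatureBound I κ θ t ω) (hκ0 : 0 < κ) (hV : (I.gram t ω).PosDef)
    (hβ : weightedNorm (I.gram t ω)⁻¹ (I.score t ω θ) ≤ β) (hl : 0 < l)
    (hVl : ∀ v, l * ‖v‖ ^ 2 ≤ quadForm (I.gram t ω) v) (hβl : β < κ * Real.sqrt l) :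
    ∃ θ', I.score t ω θ' = 0 := by
  -- The negative log-likelihood is minimized over the compact unit ball. The outward gradient keeps
  -- the minimizer off the sphere, so it is a genuine local minimum.
  obtain ⟨θ', hθ', hmin⟩ := (isCompact_closedBall θ 1).exists_isMinOn
    ⟨θ, by simp⟩ (continuous_negLogLik I t ω).continuousOn
  refine ⟨θ', ?_⟩
  set v := θ' - θ with hv
  have hv1 : ‖v‖ ≤ 1 := by simpa [dist_eq_norm] using hθ'
  have hθv : θ + v = θ' := by rw [hv]; abel
  have hlt : ‖v‖ < 1 := by
    refine lt_of_le_of_ne hv1 fun hv1 => ?_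
    have hpos := inner_score_pos_of_norm_eq_one hκ hκ0 hV hβ hl hVl hβl hv1
    have hder := hasDerivAt_negLogLik I t ω θ v 1
    rw [one_smul] at hder
    -- A positive radial derivative at the sphere gives a strictly smaller value slightly inside,
    -- against minimality.
    have h1 := (hasDerivAt_iff_tendsto_slope.1 hder).eventually (lt_mem_nhds hpos)
    have h2 : ∀ᶠ a in nhdsWithin (1 : ℝ) (Set.Iio 1), 0 <
        slope (fun a : ℝ => negLogLik I t ω (θ + a • v)) 1 a :=
      h1.filter_mono (nhdsWithin_mono _ fun a ha => ne_of_lt ha)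
    have h3 : ∀ᶠ a in nhdsWithin (1 : ℝ) (Set.Iio 1), a ∈ Set.Ioo (0 : ℝ) 1 :=
      Ioo_mem_nhdsLT zero_lt_one
    obtain ⟨a, ha1, ha2⟩ := (h2.and h3).exists
    rw [slope_def_field, one_smul] at ha1
    have h4 : negLogLik I t ω (θ + a • v) < negLogLik I t ω (θ + v) := by
      by_contra! hcon
      exact absurd ha1 (not_lt.2 (div_nonpos_of_nonneg_of_nonpos (sub_nonneg.2 hcon)
        (by linarith [ha2.2])))
    have h5 : θ + a • v ∈ Metric.closedBall θ 1 := by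
      rw [Metric.mem_closedBall, dist_eq_norm, add_sub_cancel_left, norm_smul, hv1, mul_one,
        Real.norm_eq_abs, abs_of_pos ha2.1]
      exact ha2.2.le
    have h6 := isMinOn_iff.1 hmin _ h5
    rw [← hθv] at h6
    linarith
  have hloc : IsLocalMin (negLogLik I t ω) θ' := by
    refine hmin.isLocalMin (Filter.mem_of_superset (Metric.ball_mem_nhds θ' (sub_pos.2 hlt))
      fun y hy => ?_)
    rw [Metric.mem_closedBall]
    have h7 : dist θ' θ = ‖v‖ := by rw [dist_eq_norm]
    have h8 := dist_triangle y θ' θ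
    rw [Metric.mem_ball] at hy
    linarith
  -- In the direction of the score itself the derivative is the squared norm of the score, which
  -- must vanish at a local minimum.
  set h := I.score t ω θ'
  have hder := hasDerivAt_negLogLik I t ω θ' h 0
  have hloc0 : IsLocalMin (fun a : ℝ => negLogLik I t ω (θ' + a • h)) 0 := by
    have hc : Filter.Tendsto (fun a : ℝ => θ' + a • h) (nhds 0) (nhds θ') := by
      have : Continuous fun a : ℝ => θ' + a • h := by fun_prop
      simpa using this.tendsto 0
    have := hc.eventually hloc
    simpa [IsLocalMin, IsMinFilter] using this
  have := hloc0.hasDerivAt_eq_zero hder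
  simpa [h] using this

/-- Every solution of the likelihood equation lies in the confidence ellipsoid. -/
theorem weightedNorm_sub_le_of_score_eq_zero {κ β l : ℝ} {θ θ' : Feature d} {t : ℕ} {ω : Ω}
    (hκ : CurvatureBound I κ θ t ω) (hκ0 : 0 < κ) (hV : (I.gram t ω).PosDef)
    (hβ : weightedNorm (I.gram t ω)⁻¹ (I.score t ω θ) ≤ β) (hl : 0 < l)
    (hVl : ∀ v, l * ‖v‖ ^ 2 ≤ quadForm (I.gram t ω) v) (hβl : β < κ * Real.sqrt l)
    (hθ' : I.score t ω θ' = 0) : weightedNorm (I.gram t ω) (θ' - θ) ≤ β / κ := by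
  set v := θ' - θ with hv
  have hθv : θ + v = θ' := by rw [hv]; abel
  have hv1 : ‖v‖ ≤ 1 := by
    -- For a root outside the ball, the radial component of the score is positive at radius `1` and
    -- nondecreasing outward, so it could not be `0` at the root.
    by_contra! hgt
    have hne : ‖v‖ ≠ 0 := by linarith
    have hw : ‖(‖v‖⁻¹ • v)‖ = 1 := by
      rw [norm_smul, norm_inv, norm_norm, inv_mul_cancel₀ hne]
    have hpos := inner_score_pos_of_norm_eq_one hκ hκ0 hV hβ hl hVl hβl hw
    have hmono := monotone_inner_score I t ω θ (‖v‖⁻¹ • v) hgt.le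
    simp only [smul_smul, mul_inv_cancel₀ hne, one_mul, one_smul] at hmono
    rw [hθv, hθ', inner_zero_left] at hmono
    linarith
  have h1 := le_inner_score hκ hV hβ hv1
  rw [hθv, hθ', inner_zero_left] at h1
  rw [le_div_iff₀ hκ0]
  by_contra! hgt
  have h0 : 0 ≤ weightedNorm (I.gram t ω) v := Real.sqrt_nonneg _
  have hβ0 : 0 ≤ β := (Real.sqrt_nonneg _).trans hβ
  have h2 : 0 < weightedNorm (I.gram t ω) v := by
    refine lt_of_le_of_ne h0 fun h => ?_
    rw [← h, zero_mul] at hgt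
    linarith
  nlinarith

/-- The optimistic utilities dominate the true ones, within twice the confidence width. -/
theorem optimisticUtility_mem_Icc {κ β l : ℝ} {θ : Feature d} {θhat : ℕ → Ω → Feature d}
    {α : ℕ → ℝ} {t : ℕ} {ω : Ω}
    (hκ : CurvatureBound I κ θ t ω) (hκ0 : 0 < κ) (hV : (I.gram t ω).PosDef)
    (hβ : weightedNorm (I.gram t ω)⁻¹ (I.score t ω θ) ≤ β) (hl : 0 < l)
    (hVl : ∀ v, l * ‖v‖ ^ 2 ≤ quadForm (I.gram t ω) v) (hβl : β < κ * Real.sqrt l)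
    (hmle : (∃ θ, I.score t ω θ = 0) → I.score t ω (θhat t ω) = 0)
    (hα : β / κ ≤ α (t + 1)) (i : Fin N) :
    optimisticUtility I α θhat (t + 1) ω i ∈ Set.Icc (inner ℝ (I.x (t + 1) i ω) θ)
      (inner ℝ (I.x (t + 1) i ω) θ
        + 2 * α (t + 1) * weightedNorm (I.gram t ω)⁻¹ (I.x (t + 1) i ω)) := by
  have hroot := hmle (exists_score_eq_zero hκ hκ0 hV hβ hl hVl hβl)
  have hell := (weightedNorm_sub_le_of_score_eq_zero hκ hκ0 hV hβ hl hVl hβl hroot).trans hα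
  have h1 := abs_le.1 (abs_inner_le_weightedNorm_mul hV (I.x (t + 1) i ω) (θhat t ω - θ))
  have h0 : 0 ≤ weightedNorm (I.gram t ω)⁻¹ (I.x (t + 1) i ω) := Real.sqrt_nonneg _
  have h2 := mul_le_mul_of_nonneg_left hell h0
  rw [inner_sub_right] at h1
  simp only [optimisticUtility, Nat.add_sub_cancel]
  constructor <;> nlinarith

end Likelihood

/-! ### Conditional probabilities as densities -/

section CondProb

/-- Conditional probabilities as densities for nonnegative integrands. -/
theorem setLIntegral_eq_lintegral_mul_of_condExp {Ω : Type*} {m m0 : MeasurableSpace Ω}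
    {μ : Measure Ω} [IsProbabilityMeasure μ] (hm : m ≤ m0) {B : Set Ω} (hB : MeasurableSet[m0] B)
    {p : Ω → ℝ} (hp : μ⟦B | m⟧ =ᵐ[μ] p) {Z : Ω → ENNReal} (hZ : Measurable[m] Z) :
    ∫⁻ ω in B, Z ω ∂μ = ∫⁻ ω, Z ω * ENNReal.ofReal (p ω) ∂μ := by
  set q : Ω → ℝ := μ⟦B | m⟧ with hq
  have hqm : Measurable[m] q := stronglyMeasurable_condExp.measurable
  have hq0 : 0 ≤ᵐ[μ] q := condExp_nonneg
    (Filter.Eventually.of_forall fun ω => Set.indicator_nonneg (fun _ _ => zero_le_one) ω)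
  have hqm0 : Measurable q := hqm.mono hm le_rfl
  -- On sets of `m` both measures agree by the defining property of conditional expectation. As `Z`
  -- is `m`-measurable, only these traces matter.
  have hmeas : (μ.restrict B).trim hm =
      (μ.withDensity fun ω => ENNReal.ofReal (q ω)).trim hm := by
    refine @Measure.ext Ω m _ _ fun s hs => ?_
    have hs0 := hm s hs
    rw [trim_measurableSet_eq hm hs, trim_measurableSet_eq hm hs, Measure.restrict_apply hs0,
      withDensity_apply _ hs0, ← ofReal_integral_eq_lintegral_ofReal
        integrable_condExp.integrableOn (ae_restrict_of_ae hq0),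
      setIntegral_condExp hm ((integrable_const _).indicator hB) hs,
      integral_indicator_const _ hB, smul_eq_mul, mul_one, measureReal_def,
      ENNReal.ofReal_toReal (measure_ne_top _ _), Measure.restrict_apply hB, Set.inter_comm]
  calc ∫⁻ ω in B, Z ω ∂μ = ∫⁻ ω, Z ω ∂((μ.restrict B).trim hm) := (lintegral_trim hm hZ).symm
    _ = ∫⁻ ω, Z ω ∂(μ.withDensity fun ω => ENNReal.ofReal (q ω)) := by
        rw [hmeas, lintegral_trim hm hZ]
    _ = ∫⁻ ω, Z ω * ENNReal.ofReal (q ω) ∂μ := by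
        rw [lintegral_withDensity_eq_lintegral_mul _ hqm0.ennreal_ofReal (hZ.mono hm le_rfl)]
        simp only [Pi.mul_apply, mul_comm]
    _ = _ := lintegral_congr_ae (hp.mono fun ω h => by simp only; rw [h])

theorem lintegral_eq_sum_setLIntegral_fiber {Ω ι : Type*} [Fintype ι] {m0 : MeasurableSpace Ω}
    (μ : Measure Ω) {c : Ω → ι} (hc : ∀ j, MeasurableSet (c ⁻¹' {j})) (f : Ω → ENNReal) :
    ∫⁻ ω, f ω ∂μ = ∑ j, ∫⁻ ω in c ⁻¹' {j}, f ω ∂μ := by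
  rw [← lintegral_biUnion_finset (s := Finset.univ) (fun i _ j _ hij => by
    refine Set.disjoint_left.2 fun ω h1 h2 => hij ?_
    exact (Set.mem_singleton_iff.1 h1).symm.trans (Set.mem_singleton_iff.1 h2)) fun j _ => hc j]
  have : (⋃ j ∈ Finset.univ, c ⁻¹' {j}) = Set.univ := by ext; simp
  rw [this, setLIntegral_univ]

end CondProb

/-! ### Measurability with respect to the history -/

section Measurability
variable {Ω : Type*} {d N : ℕ}

/-- There are finitely many assortments, so measurable fibres make every event about the assortment
measurable without a σ-algebra on assortments. -/
theorem measurableSet_mem_of_fiber {m : MeasurableSpace Ω} {S : Ω → Finset (Fin N)}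
    (hS : ∀ A, MeasurableSet[m] (S ⁻¹' {A})) (P : Finset (Fin N) → Prop) :
    MeasurableSet[m] {ω | P (S ω)} := by
  classical
  have : {ω | P (S ω)} = ⋃ A ∈ Finset.univ.filter P, S ⁻¹' {A} := by ext; simp
  rw [this]
  exact Finset.measurableSet_biUnion _ fun A _ => hS A

theorem measurable_sum_assortment {E : Type*} [AddCommMonoid E] [MeasurableSpace E]
    [MeasurableAdd₂ E] {m : MeasurableSpace Ω} {S : Ω → Finset (Fin N)}
    (hS : ∀ A, MeasurableSet[m] (S ⁻¹' {A})) {f : Fin N → Ω → E}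
    (hf : ∀ i, Measurable[m] (f i)) : Measurable[m] fun ω => ∑ i ∈ S ω, f i ω := by
  classical
  have : (fun ω => ∑ i ∈ S ω, f i ω) = fun ω => ∑ i, if i ∈ S ω then f i ω else 0 := by
    funext ω; simp
  rw [this]
  exact Finset.measurable_sum _ fun i _ =>
    Measurable.ite (measurableSet_mem_of_fiber hS fun A => i ∈ A) (hf i) measurable_const

theorem measurable_choiceProb {m : MeasurableSpace Ω} {x : Fin N → Ω → Feature d}
    (hx : ∀ i, Measurable[m] (x i)) {S : Ω → Finset (Fin N)}
    (hS : ∀ A, MeasurableSet[m] (S ⁻¹' {A})) (θ : Feature d) (j : Option (Fin N)) :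
    Measurable[m] fun ω => choiceProb (fun i => x i ω) (S ω) θ j := by
  have hin : ∀ i, Measurable[m] fun ω => Real.exp (inner ℝ (x i ω) θ) := fun i =>
    ((hx i).inner measurable_const).exp
  have hD : Measurable[m] fun ω => 1 + ∑ j ∈ S ω, Real.exp (inner ℝ (x j ω) θ) :=
    (measurable_sum_assortment hS hin).const_add 1
  cases j with
  | none => exact measurable_const.div hD
  | some i =>
    exact Measurable.ite (measurableSet_mem_of_fiber hS fun A => i ∈ A)
      ((hin i).div hD) measurable_const

variable {I : Interaction Ω d N}

theorem history_mono : Monotone I.history := monotone_nat_of_le_succ fun t => by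
  change I.history t ≤ I.history t ⊔ _ ⊔ _ ⊔ _ ⊔ _
  exact le_sup_left.trans (le_sup_left.trans (le_sup_left.trans le_sup_left))

theorem history_le_preDecision (t : ℕ) : I.history t ≤ I.preDecision (t + 1) := by
  simp only [Interaction.preDecision, Nat.add_sub_cancel]
  exact le_sup_left.trans le_sup_left

theorem contextInfo_le_preDecision (t : ℕ) : I.contextInfo t ≤ I.preDecision t :=
  le_sup_right.trans le_sup_left

theorem preDecision_le_preChoice (t : ℕ) : I.preDecision t ≤ I.preChoice t := le_sup_left

theorem preChoice_le_history (t : ℕ) : I.preChoice (t + 1) ≤ I.history (t + 1) := by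
  simp only [Interaction.preChoice, Interaction.preDecision, Nat.add_sub_cancel]
  exact le_sup_left

theorem measurable_x_contextInfo (t : ℕ) (i : Fin N) : Measurable[I.contextInfo t] (I.x t i) :=
  (measurable_pi_apply i).comp (comap_measurable (fun ω i => I.x t i ω))

theorem measurable_x_preChoice (t : ℕ) (i : Fin N) : Measurable[I.preChoice t] (I.x t i) :=
  (measurable_x_contextInfo t i).mono
    ((contextInfo_le_preDecision t).trans (preDecision_le_preChoice t)) le_rfl

theorem measurableSet_S_preChoice (t : ℕ) (A : Finset (Fin N)) :
    MeasurableSet[I.preChoice t] (I.S t ⁻¹' {A}) :=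
  (le_sup_right : MeasurableSpace.comap (I.S t) ⊤ ≤ I.preChoice t) _ ⟨{A}, trivial, rfl⟩

theorem measurable_x_history {s t : ℕ} (hs : 1 ≤ s) (hst : s ≤ t) (i : Fin N) :
    Measurable[I.history t] (I.x s i) := by
  obtain ⟨s, rfl⟩ := Nat.exists_eq_add_of_le' hs
  exact (measurable_x_preChoice _ i).mono ((preChoice_le_history s).trans (history_mono hst)) le_rfl

theorem measurableSet_S_history {s t : ℕ} (hs : 1 ≤ s) (hst : s ≤ t) (A : Finset (Fin N)) :
    MeasurableSet[I.history t] (I.S s ⁻¹' {A}) := by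
  obtain ⟨s, rfl⟩ := Nat.exists_eq_add_of_le' hs
  exact ((preChoice_le_history s).trans (history_mono hst)) _ (measurableSet_S_preChoice _ A)

theorem measurableSet_c_history {s t : ℕ} (hs : 1 ≤ s) (hst : s ≤ t) (j : Option (Fin N)) :
    MeasurableSet[I.history t] (I.c s ⁻¹' {j}) := by
  obtain ⟨s, rfl⟩ := Nat.exists_eq_add_of_le' hs
  exact ((le_sup_right : MeasurableSpace.comap (I.c (s + 1)) ⊤ ≤ I.history (s + 1)).trans
    (history_mono hst)) _ ⟨{j}, trivial, rfl⟩

theorem measurable_score {m : MeasurableSpace Ω} {t : ℕ}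
    (hx : ∀ s ∈ Finset.Icc 1 t, ∀ i, Measurable[m] (I.x s i))
    (hS : ∀ s ∈ Finset.Icc 1 t, ∀ A, MeasurableSet[m] (I.S s ⁻¹' {A}))
    (hc : ∀ s ∈ Finset.Icc 1 t, ∀ j, MeasurableSet[m] (I.c s ⁻¹' {j})) (θ : Feature d) :
    Measurable[m] fun ω => I.score t ω θ := by
  unfold Interaction.score
  refine Finset.measurable_sum _ fun s hs => measurable_sum_assortment (hS s hs) fun i => ?_
  refine ((measurable_choiceProb (hx s hs) (hS s hs) θ _).sub ?_).smul (hx s hs i)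
  exact Measurable.ite (hc s hs (some i)) measurable_const measurable_const

/-- The auxiliary map `g` covers the product of `Ω` with the space of directions, which is needed
for joint measurability under the Gaussian mixture. -/
theorem measurable_quadForm_gram {Ω' : Type*} {m : MeasurableSpace Ω'} {t : ℕ} {g : Ω' → Ω}
    {v : Ω' → Feature d} (hv : Measurable[m] v)
    (hx : ∀ s ∈ Finset.Icc 1 t, ∀ i, Measurable[m] fun ω => I.x s i (g ω))
    (hS : ∀ s ∈ Finset.Icc 1 t, ∀ A, MeasurableSet[m] ((fun ω => I.S s (g ω)) ⁻¹' {A})) :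
    Measurable[m] fun ω => quadForm (I.gram t (g ω)) (v ω) := by
  simp only [quadForm_gram]
  exact Finset.measurable_sum _ fun s hs => measurable_sum_assortment (hS s hs) fun i =>
    ((hx s hs i).inner hv).pow_const 2

variable [m0 : MeasurableSpace Ω] {μ : Measure Ω} {θ : Feature d} {T : ℕ}

theorem IsMNLModel.preChoice_le_of_history_le (h : IsMNLModel μ I θ T) {t : ℕ} (ht : t + 1 ≤ T)
    (hle : I.history t ≤ m0) : I.preChoice (t + 1) ≤ m0 := by
  have hmem : t + 1 ∈ Finset.Icc 1 T := Finset.mem_Icc.2 ⟨by omega, ht⟩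
  simp only [Interaction.preChoice, Interaction.preDecision, Nat.add_sub_cancel]
  refine sup_le (sup_le (sup_le hle ?_) ?_) ?_
  · exact (measurable_pi_lambda _ fun i => h.measurable_x _ hmem i).comap_le
  · exact (measurable_pi_lambda _ fun i => h.measurable_r _ hmem i).comap_le
  · rintro _ ⟨s, -, rfl⟩
    exact measurableSet_mem_of_fiber (h.measurable_S _ hmem) fun A => A ∈ s

theorem IsMNLModel.history_le (h : IsMNLModel μ I θ T) {t : ℕ} (ht : t ≤ T) :
    I.history t ≤ m0 := by
  induction t with
  | zero => exact bot_le
  | succ t ih =>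
    have hmem : t + 1 ∈ Finset.Icc 1 T := Finset.mem_Icc.2 ⟨by omega, ht⟩
    have h1 := h.preChoice_le_of_history_le ht (ih (by omega))
    refine sup_le h1 ?_
    rintro _ ⟨s, -, rfl⟩
    classical
    have : I.c (t + 1) ⁻¹' s = ⋃ j ∈ Finset.univ.filter (· ∈ s), I.c (t + 1) ⁻¹' {j} := by
      ext; simp
    rw [this]
    exact Finset.measurableSet_biUnion _ fun j _ => h.measurable_c _ hmem j

theorem IsMNLModel.preChoice_le (h : IsMNLModel μ I θ T) {t : ℕ} (ht : t + 1 ≤ T) :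
    I.preChoice (t + 1) ≤ m0 :=
  h.preChoice_le_of_history_le ht (h.history_le (by omega))

theorem IsMNLModel.preDecision_le (h : IsMNLModel μ I θ T) {t : ℕ} (ht : t ∈ Finset.Icc 1 T) :
    I.preDecision t ≤ m0 := by
  obtain ⟨s, rfl⟩ := Nat.exists_eq_add_of_le' (Finset.mem_Icc.1 ht).1
  exact (preDecision_le_preChoice _).trans (h.preChoice_le (Finset.mem_Icc.1 ht).2)

end Measurability

/-! ### Self-normalized deviation of the score -/

section SelfNormalized
variable {Ω : Type*} {d N : ℕ} {I : Interaction Ω d N}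

/-- The exponential process of the score in direction `ξ`. -/
def expScore (I : Interaction Ω d N) (θ ξ : Feature d) (t : ℕ) (ω : Ω) : ENNReal :=
  ENNReal.ofReal (Real.exp (inner ℝ (I.score t ω θ) ξ - 1 / 4 * quadForm (I.gram t ω) ξ))

theorem measurable_expScore {m : MeasurableSpace Ω} {t : ℕ}
    (hx : ∀ s ∈ Finset.Icc 1 t, ∀ i, Measurable[m] (I.x s i))
    (hS : ∀ s ∈ Finset.Icc 1 t, ∀ A, MeasurableSet[m] (I.S s ⁻¹' {A}))
    (hc : ∀ s ∈ Finset.Icc 1 t, ∀ j, MeasurableSet[m] (I.c s ⁻¹' {j})) (θ : Feature d) :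
    Measurable fun p : Ω × Feature d => expScore I θ p.2 t p.1 := by
  unfold expScore
  refine (Measurable.exp (Measurable.sub ?_ (Measurable.const_mul ?_ _))).ennreal_ofReal
  · exact ((measurable_score hx hS hc θ).comp measurable_fst).inner measurable_snd
  · exact measurable_quadForm_gram measurable_snd (fun s hs i => (hx s hs i).comp measurable_fst)
      fun s hs A => measurable_fst (hS s hs A)

theorem expScore_succ (θ ξ : Feature d) (t : ℕ) (ω : Ω) :
    expScore I θ ξ (t + 1) ω = expScore I θ ξ t ω * ENNReal.ofReal (Real.exp
      (∑ i ∈ I.S (t + 1) ω, (choiceProb (I.feat (t + 1) ω) (I.S (t + 1) ω) θ (some i)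
        - if I.c (t + 1) ω = some i then 1 else 0) * inner ℝ (I.x (t + 1) i ω) ξ
        - 1 / 4 * ∑ i ∈ I.S (t + 1) ω, (inner ℝ (I.x (t + 1) i ω) ξ) ^ 2)) := by
  rw [expScore, expScore, ← ENNReal.ofReal_mul (Real.exp_pos _).le, ← Real.exp_add]
  congr 2
  rw [inner_score, inner_score, quadForm_gram, quadForm_gram,
    Finset.sum_Icc_succ_top (by omega), Finset.sum_Icc_succ_top (by omega)]
  simp only [Interaction.response]
  ring

variable [m0 : MeasurableSpace Ω] {μ : Measure Ω} {θ : Feature d} {T : ℕ}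

theorem IsMNLModel.measurable_expScore (h : IsMNLModel μ I θ T) {t : ℕ} (ht : t ≤ T) :
    Measurable fun p : Ω × Feature d => expScore I θ p.2 t p.1 :=
  MNLBandit.measurable_expScore
    (fun s hs i => h.measurable_x s (Finset.Icc_subset_Icc_right ht hs) i)
    (fun s hs A => h.measurable_S s (Finset.Icc_subset_Icc_right ht hs) A)
    (fun s hs j => h.measurable_c s (Finset.Icc_subset_Icc_right ht hs) j) θ

theorem IsMNLModel.measurable_expScore_right (h : IsMNLModel μ I θ T) {t : ℕ} (ht : t ≤ T)
    (ξ : Feature d) : Measurable (expScore I θ ξ t) := by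
  have hm := (h.measurable_expScore ht).comp (measurable_prodMk_right (y := ξ))
  simpa only [Function.comp_def] using hm

variable [IsProbabilityMeasure μ]

/-- The exponential process is a supermartingale started at `1`. -/
theorem lintegral_expScore_le_one (h : IsMNLModel μ I θ T) (ξ : Feature d) {t : ℕ}
    (ht : t ≤ T) : ∫⁻ ω, expScore I θ ξ t ω ∂μ ≤ 1 := by
  induction t with
  | zero => simp [expScore, inner_score, quadForm_gram]
  | succ t ih =>
    have hmem : t + 1 ∈ Finset.Icc 1 T := Finset.mem_Icc.2 ⟨by omega, ht⟩
    refine le_trans ?_ (ih (by omega))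
    -- Freezing the choice at `j` makes the increment known before the user chooses, so on each
    -- fibre of the choice the conditional law acts as a density.
    set F : Option (Fin N) → Ω → ℝ := fun j ω =>
      (∑ i ∈ I.S (t + 1) ω, (choiceProb (I.feat (t + 1) ω) (I.S (t + 1) ω) θ (some i)
        - if j = some i then 1 else 0) * inner ℝ (I.x (t + 1) i ω) ξ)
        - 1 / 4 * ∑ i ∈ I.S (t + 1) ω, (inner ℝ (I.x (t + 1) i ω) ξ) ^ 2 with hF
    set Z : Option (Fin N) → Ω → ENNReal := fun j ω =>
      expScore I θ ξ t ω * ENNReal.ofReal (Real.exp (F j ω)) with hZ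
    have hxm : ∀ i, Measurable[I.preChoice (t + 1)] (I.x (t + 1) i) :=
      fun i => measurable_x_preChoice (t + 1) i
    have hSm := measurableSet_S_preChoice (I := I) (t + 1)
    have hle : I.history t ≤ I.preChoice (t + 1) :=
      (history_le_preDecision t).trans (preDecision_le_preChoice _)
    have hFm : ∀ j, Measurable[I.preChoice (t + 1)] (F j) := by
      intro j
      refine Measurable.sub (measurable_sum_assortment hSm fun i => ?_)
        (Measurable.const_mul (measurable_sum_assortment hSm fun i => ?_) _)
      · exact ((measurable_choiceProb hxm hSm θ _).sub_const _).mul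
          ((hxm i).inner measurable_const)
      · exact ((hxm i).inner measurable_const).pow_const 2
    have hMm : Measurable[I.preChoice (t + 1)] (expScore I θ ξ t) := by
      have h1 := measurable_expScore (I := I) (m := I.history t) (t := t)
        (fun s hs i => measurable_x_history (Finset.mem_Icc.1 hs).1 (Finset.mem_Icc.1 hs).2 i)
        (fun s hs A => measurableSet_S_history (Finset.mem_Icc.1 hs).1 (Finset.mem_Icc.1 hs).2 A)
        (fun s hs j => measurableSet_c_history (Finset.mem_Icc.1 hs).1 (Finset.mem_Icc.1 hs).2 j)
        θ
      exact (h1.comp (measurable_prodMk_right (y := ξ))).mono hle le_rfl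
    have hZm : ∀ j, Measurable[I.preChoice (t + 1)] (Z j) := fun j =>
      hMm.mul (hFm j).exp.ennreal_ofReal
    have hPC := h.preChoice_le ht
    calc ∫⁻ ω, expScore I θ ξ (t + 1) ω ∂μ
        = ∑ j, ∫⁻ ω in I.c (t + 1) ⁻¹' {j}, expScore I θ ξ (t + 1) ω ∂μ :=
          lintegral_eq_sum_setLIntegral_fiber μ (h.measurable_c _ hmem) _
      _ = ∑ j, ∫⁻ ω in I.c (t + 1) ⁻¹' {j}, Z j ω ∂μ := by
          refine Finset.sum_congr rfl fun j _ =>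
            setLIntegral_congr_fun (h.measurable_c _ hmem j) fun ω hω => ?_
          have hωj : I.c (t + 1) ω = j := hω
          simp only [expScore_succ, hωj, hZ, hF]
      _ = ∑ j, ∫⁻ ω, Z j ω * ENNReal.ofReal
            (choiceProb (I.feat (t + 1) ω) (I.S (t + 1) ω) θ j) ∂μ :=
          Finset.sum_congr rfl fun j _ => setLIntegral_eq_lintegral_mul_of_condExp hPC
            (h.measurable_c _ hmem j) (h.choice_law _ hmem j) (hZm j)
      _ = ∫⁻ ω, ∑ j, Z j ω * ENNReal.ofReal
            (choiceProb (I.feat (t + 1) ω) (I.S (t + 1) ω) θ j) ∂μ :=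
          (lintegral_finsetSum _ fun j _ => ((hZm j).mul
            (measurable_choiceProb hxm hSm θ j).ennreal_ofReal).mono hPC le_rfl).symm
      _ ≤ ∫⁻ ω, expScore I θ ξ t ω ∂μ := by
          refine lintegral_mono fun ω => ?_
          simp only [hZ, mul_assoc, ← Finset.mul_sum]
          refine mul_le_of_le_one_right zero_le ?_
          have hnn : ∀ j, 0 ≤ choiceProb (I.feat (t + 1) ω) (I.S (t + 1) ω) θ j :=
            choiceProb_nonneg _ _ _
          simp only [← ENNReal.ofReal_mul (Real.exp_pos _).le]
          rw [← ENNReal.ofReal_sum_of_nonneg fun j _ => mul_nonneg (Real.exp_pos _).le (hnn j),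
            ENNReal.ofReal_le_one]
          -- The conditional mean of the new factor is at most `1` because the compensator in
          -- `expScore` carries the same constant `1 / 4` as the sub-Gaussian bound.
          have hsub := sum_choiceProb_mul_exp_le (I.feat (t + 1) ω) (I.S (t + 1) ω) θ
            fun i => inner ℝ (I.x (t + 1) i ω) ξ
          simp only [hF, Real.exp_sub, div_mul_eq_mul_div, ← Finset.sum_div]
          rw [div_le_one (Real.exp_pos _)]
          rw [← div_mul_eq_mul_div]
          simpa only [mul_comm] using hsub

/-- Deviation bound for the score in the norm of the regularized Gram matrix (method of
mixtures). -/
theorem measure_score_ge_le (h : IsMNLModel μ I θ T) {t : ℕ} (ht : t ≤ T) {l δ : ℝ} (hl : 0 < l)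
    (hδ : 0 < δ) :
    μ {ω | Real.sqrt ((I.gram t ω + l • 1).det / l ^ d) / δ ≤
      Real.exp (quadForm (I.gram t ω + l • (1 : Matrix (Fin d) (Fin d) ℝ))⁻¹ (I.score t ω θ))} ≤
      ENNReal.ofReal δ := by
  have hG0 := gaussianMass_ne_zero d
  have hGt := gaussianMass_ne_top d
  have hl1 : (l • (1 : Matrix (Fin d) (Fin d) ℝ)).PosDef := Matrix.PosDef.one.smul hl
  have hW : ∀ ω, (I.gram t ω + l • (1 : Matrix (Fin d) (Fin d) ℝ)).PosDef := fun ω =>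
    Matrix.PosDef.posSemidef_add (posSemidef_gram I t ω) hl1
  -- The mixing weight is an unnormalized Gaussian of form `l • 1`. Multiplied into `expScore`, it
  -- replaces the Gram matrix by its regularization.
  let f : Ω × Feature d → ENNReal := fun p => expScore I θ p.2 t p.1 *
    ENNReal.ofReal (Real.exp (-(1 / 4) * quadForm (l • (1 : Matrix (Fin d) (Fin d) ℝ)) p.2))
  have hgm : Measurable fun ξ : Feature d => ENNReal.ofReal
      (Real.exp (-(1 / 4) * quadForm (l • (1 : Matrix (Fin d) (Fin d) ℝ)) ξ)) := by
    have := (continuous_quadForm (l • (1 : Matrix (Fin d) (Fin d) ℝ))).measurable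
    fun_prop
  have hf : Measurable f := (h.measurable_expScore ht).mul (hgm.comp measurable_snd)
  have hmix : ∀ ω, ∫⁻ ξ, f (ω, ξ) = ENNReal.ofReal (Real.exp (quadForm
      (I.gram t ω + l • (1 : Matrix (Fin d) (Fin d) ℝ))⁻¹ (I.score t ω θ)) *
      (Real.sqrt (I.gram t ω + l • 1).det)⁻¹) * gaussianMass d := by
    intro ω
    rw [← lintegral_exp_inner_sub_quadForm (hW ω)]
    refine lintegral_congr fun ξ => ?_
    simp only [f, expScore]
    rw [← ENNReal.ofReal_mul (Real.exp_pos _).le, ← Real.exp_add, quadForm_add]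
    ring_nf
  have htot : ∫⁻ ω, (∫⁻ ξ, f (ω, ξ)) ∂μ ≤
      ENNReal.ofReal (Real.sqrt (l ^ d))⁻¹ * gaussianMass d := by
    rw [lintegral_lintegral_swap hf.aemeasurable]
    have hdet : (l • (1 : Matrix (Fin d) (Fin d) ℝ)).det = l ^ d := by
      simp
    rw [← hdet, ← lintegral_exp_neg_quadForm hl1]
    refine lintegral_mono fun ξ => ?_
    simp only [f]
    rw [lintegral_mul_const _ (h.measurable_expScore_right ht ξ)]
    exact mul_le_of_le_one_left zero_le (lintegral_expScore_le_one h ξ ht)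
  have hlp : 0 < Real.sqrt (l ^ d) := Real.sqrt_pos.2 (pow_pos hl d)
  set ε : ENNReal := ENNReal.ofReal ((Real.sqrt (l ^ d))⁻¹ / δ) * gaussianMass d with hε
  have hεpos : 0 < (Real.sqrt (l ^ d))⁻¹ / δ := by positivity
  have hε0 : ε ≠ 0 := mul_ne_zero (ENNReal.ofReal_pos.2 hεpos).ne' hG0
  have hεt : ε ≠ ⊤ := ENNReal.mul_ne_top ENNReal.ofReal_ne_top hGt
  -- Markov's inequality for the mixture; `ε` is chosen so that the ratio to the bound on its mean
  -- is exactly `δ`.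
  have hmarkov := meas_ge_le_lintegral_div (μ := μ)
    (hf.lintegral_prod_right' (ν := volume)).aemeasurable hε0 hεt
  calc μ {ω | Real.sqrt ((I.gram t ω + l • 1).det / l ^ d) / δ ≤
      Real.exp (quadForm (I.gram t ω + l • (1 : Matrix (Fin d) (Fin d) ℝ))⁻¹ (I.score t ω θ))}
      ≤ μ {ω | ε ≤ ∫⁻ ξ, f (ω, ξ)} := by
        refine measure_mono fun ω hω => ?_
        simp only [Set.mem_ofPred_eq] at hω ⊢
        rw [hmix, hε]
        refine mul_le_mul_left (ENNReal.ofReal_le_ofReal ?_) _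
        have hdp : 0 < Real.sqrt (I.gram t ω + l • 1).det := Real.sqrt_pos.2 (hW ω).det_pos
        rw [Real.sqrt_div' _ (pow_pos hl d).le] at hω
        rw [← div_eq_mul_inv, le_div_iff₀ hdp]
        refine le_trans (le_of_eq ?_) hω
        field_simp
    _ ≤ _ := hmarkov
    _ ≤ ENNReal.ofReal (Real.sqrt (l ^ d))⁻¹ * gaussianMass d / ε :=
        ENNReal.div_le_div_right htot _
    _ = ENNReal.ofReal δ := by
        rw [hε, ENNReal.mul_div_mul_right _ _ hG0 hGt, ← ENNReal.ofReal_div_of_pos hεpos]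
        congr 1
        field_simp

end SelfNormalized

/-! ### The second-moment matrix of the features -/

section Covariance
variable {d : ℕ}

/-- The second-moment form `∫ ⟨u, w⟩ ⟨v, w⟩ dp(w)`. -/
def covForm (p : Measure (Feature d)) (u v : Feature d) : ℝ := ∫ w, inner ℝ u w * inner ℝ v w ∂p

/-- The second-moment matrix of a law on `ℝ^d`. -/
def covMatrix (p : Measure (Feature d)) : Matrix (Fin d) (Fin d) ℝ :=
  Matrix.of fun a b => ∫ v, v a * v b ∂p

theorem abs_inner_mul_inner_le_one {u v w : Feature d} (hu : ‖u‖ ≤ 1) (hv : ‖v‖ ≤ 1)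
    (hw : ‖w‖ ≤ 1) : |inner ℝ u w * inner ℝ v w| ≤ 1 := by
  rw [abs_mul]
  have h1 : |inner ℝ u w| ≤ 1 :=
    (abs_real_inner_le_norm u w).trans (mul_le_one₀ hu (norm_nonneg _) hw)
  have h2 : |inner ℝ v w| ≤ 1 :=
    (abs_real_inner_le_norm v w).trans (mul_le_one₀ hv (norm_nonneg _) hw)
  exact mul_le_one₀ h1 (abs_nonneg _) h2

variable {p : Measure (Feature d)}

theorem le_quadForm_covMatrix {σ : ℝ}
    (hσ : (covMatrix p - σ • (1 : Matrix (Fin d) (Fin d) ℝ)).PosSemidef) (v : Feature d) :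
    σ * ‖v‖ ^ 2 ≤ quadForm (covMatrix p) v := by
  have h := quadForm_add (covMatrix p - σ • (1 : Matrix (Fin d) (Fin d) ℝ)) (σ • 1) v
  rw [sub_add_cancel, quadForm_smul, quadForm_one] at h
  linarith [quadForm_nonneg hσ v]

variable [IsProbabilityMeasure p]

theorem abs_coord_le_norm (v : Feature d) (a : Fin d) : |v a| ≤ ‖v‖ := by
  simpa using PiLp.norm_apply_le v a

theorem integrable_coord_mul (hp : ∀ᵐ v ∂p, ‖v‖ ≤ 1) (a b : Fin d) :
    Integrable (fun v : Feature d => v a * v b) p := by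
  refine Integrable.of_bound (by fun_prop) 1 (hp.mono fun v hv => ?_)
  rw [Real.norm_eq_abs, abs_mul]
  exact mul_le_one₀ ((abs_coord_le_norm v a).trans hv) (abs_nonneg _)
    ((abs_coord_le_norm v b).trans hv)

theorem covForm_eq_dotProduct (hp : ∀ᵐ v ∂p, ‖v‖ ≤ 1) (u v : Feature d) :
    covForm p u v = u.ofLp ⬝ᵥ (covMatrix p).mulVec v.ofLp := by
  have h : ∀ w : Feature d, inner ℝ u w * inner ℝ v w = ∑ a, ∑ b, u a * v b * (w a * w b) := by
    intro w
    rw [inner_eq_dotProduct, inner_eq_dotProduct, dotProduct, dotProduct, Finset.sum_mul_sum]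
    exact Finset.sum_congr rfl fun a _ => Finset.sum_congr rfl fun b _ => by ring
  simp only [covForm, h]
  rw [integral_finsetSum _ fun a _ => integrable_finsetSum _ fun b _ =>
    (integrable_coord_mul hp a b).const_mul _]
  simp only [dotProduct, Matrix.mulVec, covMatrix, Matrix.of_apply, Finset.mul_sum]
  refine Finset.sum_congr rfl fun a _ => ?_
  rw [integral_finsetSum _ fun b _ => (integrable_coord_mul hp a b).const_mul _]
  refine Finset.sum_congr rfl fun b _ => ?_
  rw [integral_const_mul]
  ring

/-- The smallest eigenvalue of the second-moment matrix of a law on the unit ball is at most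
`1 / d`. -/
theorem natCast_mul_le_one_of_posSemidef {σ : ℝ} (hp : ∀ᵐ v ∂p, ‖v‖ ≤ 1)
    (hσ : (covMatrix p - σ • (1 : Matrix (Fin d) (Fin d) ℝ)).PosSemidef) : d * σ ≤ 1 := by
  -- Comparing traces suffices: the trace of the second-moment matrix is the mean of `‖v‖ ^ 2`.
  have h1 := hσ.trace_nonneg
  rw [Matrix.trace_sub, Matrix.trace_smul, Matrix.trace_one, Fintype.card_fin, smul_eq_mul] at h1
  have h2 : (covMatrix p).trace = ∫ v : Feature d, ‖v‖ ^ 2 ∂p := by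
    simp only [Matrix.trace, Matrix.diag, covMatrix, Matrix.of_apply]
    rw [← integral_finsetSum _ fun a _ => integrable_coord_mul hp a a]
    refine integral_congr_ae (Filter.Eventually.of_forall fun v => ?_)
    simp only [norm_sq_eq_dotProduct, dotProduct]
  have h3 : ∫ v : Feature d, ‖v‖ ^ 2 ∂p ≤ ∫ _v : Feature d, (1 : ℝ) ∂p :=
    integral_mono_of_nonneg (Filter.Eventually.of_forall fun v => by positivity)
      (integrable_const _) (hp.mono fun v hv => pow_le_one₀ (norm_nonneg _) hv)
  rw [integral_const, probReal_univ, one_smul] at h3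
  linarith

end Covariance

/-! ### Concentration of the Gram matrix under uniform exploration -/

section Concentration
variable {Ω : Type*} {d N : ℕ} {I : Interaction Ω d N}

/-- The deviation of the bilinear form of the Gram matrix from its compensator. -/
def bilinDeviation (I : Interaction Ω d N) (p : Measure (Feature d)) (u v : Feature d) (t : ℕ)
    (ω : Ω) : ℝ :=
  ∑ s ∈ Finset.Icc 1 t, ∑ i ∈ I.S s ω,
    (covForm p u v - inner ℝ u (I.x s i ω) * inner ℝ v (I.x s i ω))

theorem measurable_bilinDeviation (p : Measure (Feature d)) (u v : Feature d) (t : ℕ) :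
    Measurable[I.history t] (bilinDeviation I p u v t) := by
  refine Finset.measurable_sum _ fun s hs => ?_
  have hs' := Finset.mem_Icc.1 hs
  refine measurable_sum_assortment (measurableSet_S_history hs'.1 hs'.2) fun i => ?_
  have hxm := measurable_x_history (I := I) hs'.1 hs'.2 i
  exact ((measurable_const.inner hxm).mul (measurable_const.inner hxm)).const_sub _

theorem dotProduct_gram_mulVec (t : ℕ) (ω : Ω) (u v : Feature d) :
    u.ofLp ⬝ᵥ (I.gram t ω).mulVec v.ofLp = ∑ s ∈ Finset.Icc 1 t, ∑ i ∈ I.S s ω,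
      inner ℝ u (I.x s i ω) * inner ℝ v (I.x s i ω) := by
  simp only [Interaction.gram, Matrix.sum_mulVec, dotProduct_sum]
  refine Finset.sum_congr rfl fun s _ => Finset.sum_congr rfl fun i _ => ?_
  rw [Matrix.vecMulVec_mulVec, inner_eq_dotProduct, inner_eq_dotProduct, op_smul_eq_smul,
    dotProduct_smul, smul_eq_mul, dotProduct_comm v.ofLp, mul_comm]

variable [m0 : MeasurableSpace Ω] {μ : Measure Ω}
  [IsProbabilityMeasure μ] {p : Measure (Feature d)}

/-- Moment generating function of the centered bilinear form of `K` feature vectors. -/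
theorem lintegral_exp_covForm_sub_le (hp : ∀ᵐ v ∂p, ‖v‖ ≤ 1) {x : Fin N → Ω → Feature d}
    (hx : ∀ i, Measurable (x i)) (hmap : ∀ i, μ.map (x i) = p) {u v : Feature d} (hu : ‖u‖ ≤ 1)
    (hv : ‖v‖ ≤ 1) (A : Finset (Fin N)) (η : ℝ) :
    ∫⁻ ω, ENNReal.ofReal (Real.exp (η * ∑ i ∈ A,
      (covForm p u v - inner ℝ u (x i ω) * inner ℝ v (x i ω)))) ∂μ ≤
      ENNReal.ofReal (Real.exp (η ^ 2 * (A.card : ℝ) ^ 2 / 2)) := by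
  set b := covForm p u v
  have hxb : ∀ i, ∀ᵐ ω ∂μ, ‖x i ω‖ ≤ 1 := fun i => by
    rw [← hmap i] at hp
    exact ae_of_ae_map (hx i).aemeasurable hp
  have hym : ∀ i, Measurable fun ω => inner ℝ u (x i ω) * inner ℝ v (x i ω) := fun i =>
    (measurable_const.inner (hx i)).mul (measurable_const.inner (hx i))
  have hyb : ∀ i, ∀ᵐ ω ∂μ, |inner ℝ u (x i ω) * inner ℝ v (x i ω)| ≤ 1 := fun i =>
    (hxb i).mono fun ω h => abs_inner_mul_inner_le_one hu hv h
  have hyi : ∀ i, Integrable (fun ω => inner ℝ u (x i ω) * inner ℝ v (x i ω)) μ := fun i =>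
    Integrable.of_bound (hym i).aestronglyMeasurable 1 ((hyb i).mono fun ω h => h)
  have hmean : ∀ i, ∫ ω, inner ℝ u (x i ω) * inner ℝ v (x i ω) ∂μ = b := fun i => by
    simp only [b, covForm, ← hmap i]
    rw [integral_map (hx i).aemeasurable (by fun_prop)]
  let X : Ω → ℝ := fun ω => ∑ i ∈ A, (b - inner ℝ u (x i ω) * inner ℝ v (x i ω))
  -- The whole sum is treated as one bounded variable in an interval of length `2 * A.card`;
  -- Hoeffding's lemma then gives the exponent `η ^ 2 * A.card ^ 2 / 2`.
  have hX : ∀ᵐ ω ∂μ, X ω ∈ Set.Icc (A.card * b - A.card) (A.card * b + A.card) := by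
    filter_upwards [ae_all_iff.2 hyb] with ω hω
    have h1 : |∑ i ∈ A, inner ℝ u (x i ω) * inner ℝ v (x i ω)| ≤ A.card := by
      refine (Finset.abs_sum_le_sum_abs _ _).trans ((Finset.sum_le_sum fun i _ => hω i).trans ?_)
      simp
    simp only [X, Finset.sum_sub_distrib, Finset.sum_const, nsmul_eq_mul]
    have := abs_le.1 h1
    constructor <;> linarith
  have hX0 : ∫ ω, X ω ∂μ = 0 := by
    simp only [X]
    rw [integral_finsetSum A (f := fun i ω => b - inner ℝ u (x i ω) * inner ℝ v (x i ω))
      fun i _ => (integrable_const b).sub (hyi i)]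
    refine Finset.sum_eq_zero fun i _ => ?_
    rw [integral_sub (integrable_const b) (hyi i), hmean i]
    simp
  have hs := hasSubgaussianMGF_of_mem_Icc_of_integral_eq_zero
    (Finset.measurable_sum A fun i _ => (hym i).const_sub b).aemeasurable hX hX0
  have hle := hs.mgf_le η
  rw [← ofReal_integral_eq_lintegral_ofReal (hs.integrable_exp_mul η)
    (Filter.Eventually.of_forall fun _ => (Real.exp_pos _).le)]
  refine ENNReal.ofReal_le_ofReal (hle.trans (Real.exp_le_exp.2 (le_of_eq ?_)))
  push_cast
  rw [Real.norm_eq_abs, div_pow, sq_abs]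
  ring

variable {θ : Feature d} {T K T₀ : ℕ}

/-- In the rounds `t ≤ T₀` the assortment is uniform among the sets of `K` items. -/
def UniformInit (μ : Measure Ω) (I : Interaction Ω d N) (K T₀ T : ℕ) : Prop :=
  ∀ t ∈ Finset.Icc 1 T, t ≤ T₀ → ∀ A : Finset (Fin N), A.card = K →
    μ⟦I.S t ⁻¹' {A} | I.preDecision t⟧ =ᵐ[μ] fun _ => 1 / (N.choose K : ℝ)

/-- The conditional law of the assortment is constant, so its fibres are independent of everything
known beforehand. -/
theorem setLIntegral_fiber_of_uniformInit (h : IsMNLModel μ I θ T) (hinit : UniformInit μ I K T₀ T)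
    {t : ℕ} (ht : t ∈ Finset.Icc 1 T) (htT : t ≤ T₀) {A : Finset (Fin N)} (hA : A.card = K)
    {Z : Ω → ENNReal} (hZ : Measurable[I.preDecision t] Z) :
    ∫⁻ ω in I.S t ⁻¹' {A}, Z ω ∂μ = (∫⁻ ω, Z ω ∂μ) * ENNReal.ofReal (1 / (N.choose K : ℝ)) := by
  rw [setLIntegral_eq_lintegral_mul_of_condExp (h.preDecision_le ht) (h.measurable_S t ht A)
    (hinit t ht htT A hA) hZ, lintegral_mul_const _ (hZ.mono (h.preDecision_le ht) le_rfl)]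

theorem natCast_choose_mul_ofReal (hK : K ≤ N) :
    (N.choose K : ENNReal) * ENNReal.ofReal (1 / (N.choose K : ℝ)) = 1 := by
  have hpos : (0 : ℝ) < N.choose K := by exact_mod_cast Nat.choose_pos hK
  rw [← ENNReal.ofReal_natCast, ← ENNReal.ofReal_mul hpos.le, mul_one_div_cancel hpos.ne',
    ENNReal.ofReal_one]

theorem card_filter_card_eq (N K : ℕ) :
    (Finset.univ.filter fun A : Finset (Fin N) => A.card = K).card = N.choose K := by
  rw [← Finset.powerset_univ, ← Finset.powersetCard_eq_filter, Finset.card_powersetCard,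
    Finset.card_univ, Fintype.card_fin]

/-- The fibres of the `N.choose K` sets of `K` items each have mass `1 / N.choose K` and thus
exhaust the probability; no other assortment is offered. -/
theorem ae_card_eq_of_uniformInit (h : IsMNLModel μ I θ T) (hinit : UniformInit μ I K T₀ T)
    (hK : K ≤ N) {t : ℕ} (ht : t ∈ Finset.Icc 1 T) (htT : t ≤ T₀) :
    ∀ᵐ ω ∂μ, (I.S t ω).card = K := by
  have hm : ∀ A, MeasurableSet (I.S t ⁻¹' {A}) := h.measurable_S t ht
  refine (mem_ae_iff_prob_eq_one (measurableSet_mem_of_fiber hm fun A => A.card = K)).2 ?_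
  have hU : {ω | (I.S t ω).card = K} =
      ⋃ A ∈ Finset.univ.filter fun A : Finset (Fin N) => A.card = K, I.S t ⁻¹' {A} := by
    ext; simp
  have hA : ∀ A ∈ Finset.univ.filter fun A : Finset (Fin N) => A.card = K,
      μ (I.S t ⁻¹' {A}) = ENNReal.ofReal (1 / (N.choose K : ℝ)) := by
    intro A hA
    have := setLIntegral_fiber_of_uniformInit h hinit ht htT (Finset.mem_filter.1 hA).2
      (Z := fun _ => 1) measurable_const
    simpa using this
  rw [hU, measure_biUnion_finset (f := fun A => I.S t ⁻¹' {A}) (fun A _ B _ hAB => Set.disjoint_left.2 fun ω h1 h2 => hAB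
      ((Set.mem_singleton_iff.1 h1).symm.trans (Set.mem_singleton_iff.1 h2))) fun A _ => hm A,
    Finset.sum_congr rfl hA, Finset.sum_const, card_filter_card_eq, nsmul_eq_mul,
    natCast_choose_mul_ofReal hK]

/-- Exponential moments of the deviation of the Gram matrix during the initialization. -/
theorem lintegral_exp_bilinDeviation_le (h : IsMNLModel μ I θ T)
    (hinit : UniformInit μ I K T₀ T) (hK : K ≤ N)
    (hfresh : ∀ t ∈ Finset.Icc 1 T, Indep (I.history (t - 1)) (I.contextInfo t) μ)
    (hp : ∀ᵐ v ∂p, ‖v‖ ≤ 1) (hmap : ∀ t ∈ Finset.Icc 1 T, ∀ i, μ.map (I.x t i) = p)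
    {u v : Feature d} (hu : ‖u‖ ≤ 1) (hv : ‖v‖ ≤ 1) (η : ℝ) {t : ℕ} (htT : t ≤ T) (ht : t ≤ T₀) :
    ∫⁻ ω, ENNReal.ofReal (Real.exp (η * bilinDeviation I p u v t ω)) ∂μ ≤
      ENNReal.ofReal (Real.exp (t * (η ^ 2 * (K : ℝ) ^ 2 / 2))) := by
  induction t with
  | zero => simp [bilinDeviation]
  | succ t ih =>
    have hmem : t + 1 ∈ Finset.Icc 1 T := Finset.mem_Icc.2 ⟨by omega, htT⟩
    have hcard := ae_card_eq_of_uniformInit h hinit hK hmem ht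
    set Z : Ω → ENNReal := fun ω => ENNReal.ofReal (Real.exp (η * bilinDeviation I p u v t ω))
      with hZ
    set G : Finset (Fin N) → Ω → ENNReal := fun A ω => ENNReal.ofReal (Real.exp (η * ∑ i ∈ A,
      (covForm p u v - inner ℝ u (I.x (t + 1) i ω) * inner ℝ v (I.x (t + 1) i ω)))) with hG
    set E : ENNReal := ENNReal.ofReal (Real.exp (η ^ 2 * (K : ℝ) ^ 2 / 2)) with hE
    have hsucc : ∀ ω, ENNReal.ofReal (Real.exp (η * bilinDeviation I p u v (t + 1) ω)) =
        Z ω * G (I.S (t + 1) ω) ω := by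
      intro ω
      simp only [hZ, hG]
      rw [← ENNReal.ofReal_mul (Real.exp_pos _).le, ← Real.exp_add, bilinDeviation,
        Finset.sum_Icc_succ_top (by omega), mul_add]
      rfl
    have hZm : Measurable[I.history t] Z :=
      ((measurable_bilinDeviation p u v t).const_mul η).exp.ennreal_ofReal
    have hGm : ∀ A, Measurable[I.contextInfo (t + 1)] (G A) := by
      intro A
      refine Measurable.ennreal_ofReal (Measurable.exp (Measurable.const_mul
        (Finset.measurable_sum _ fun i _ => ?_) η))
      have hxm := measurable_x_contextInfo (I := I) (t + 1) i
      exact ((measurable_const.inner hxm).mul (measurable_const.inner hxm)).const_sub _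
    have hctx : I.contextInfo (t + 1) ≤ m0 :=
      (contextInfo_le_preDecision _).trans (h.preDecision_le hmem)
    -- A fibre of the wrong cardinality is null. On the others, uniformity first decouples the
    -- assortment from the features, and freshness then decouples the features from the past.
    have hterm : ∀ A : Finset (Fin N), ∫⁻ ω in I.S (t + 1) ⁻¹' {A}, Z ω * G A ω ∂μ ≤
        if A.card = K then (∫⁻ ω, Z ω ∂μ) * E * ENNReal.ofReal (1 / (N.choose K : ℝ)) else 0 := by
      intro A
      split_ifs with hA
      · change ∫⁻ ω in I.S (t + 1) ⁻¹' {A}, (Z * G A) ω ∂μ ≤ _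
        rw [setLIntegral_fiber_of_uniformInit h hinit hmem ht hA
          ((hZm.mono (history_le_preDecision t) le_rfl).mul
            ((hGm A).mono (contextInfo_le_preDecision _) le_rfl))]
        refine mul_le_mul_left ?_ _
        simp only [Pi.mul_apply]
        have hind : Indep (I.history t) (I.contextInfo (t + 1)) μ := hfresh _ hmem
        rw [lintegral_mul_eq_lintegral_mul_lintegral_of_independent_measurableSpace
          (h.history_le (by omega)) hctx hind hZm (hGm A)]
        refine mul_le_mul_right ?_ _
        have := lintegral_exp_covForm_sub_le hp (h.measurable_x _ hmem) (hmap _ hmem) hu hv A η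
        rwa [hA] at this
      · refine le_of_eq (setLIntegral_measure_zero _ _ ?_)
        refine measure_mono_null (fun ω hω => ?_) (ae_iff.1 hcard)
        have : I.S (t + 1) ω = A := hω
        simpa [this] using hA
    calc ∫⁻ ω, ENNReal.ofReal (Real.exp (η * bilinDeviation I p u v (t + 1) ω)) ∂μ
        = ∑ A, ∫⁻ ω in I.S (t + 1) ⁻¹' {A}, Z ω * G (I.S (t + 1) ω) ω ∂μ := by
          simp only [hsucc]
          exact lintegral_eq_sum_setLIntegral_fiber μ (h.measurable_S _ hmem) _
      _ = ∑ A, ∫⁻ ω in I.S (t + 1) ⁻¹' {A}, Z ω * G A ω ∂μ := by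
          refine Finset.sum_congr rfl fun A _ =>
            setLIntegral_congr_fun (h.measurable_S _ hmem A) fun ω hω => ?_
          have hωA : I.S (t + 1) ω = A := hω
          simp only [hωA]
      _ ≤ ∑ A : Finset (Fin N), if A.card = K then
            (∫⁻ ω, Z ω ∂μ) * E * ENNReal.ofReal (1 / (N.choose K : ℝ)) else 0 :=
          Finset.sum_le_sum fun A _ => hterm A
      _ = (∫⁻ ω, Z ω ∂μ) * E := by
          rw [← Finset.sum_filter, Finset.sum_const, card_filter_card_eq, nsmul_eq_mul,
            mul_comm (_ * E), ← mul_assoc, natCast_choose_mul_ofReal hK, one_mul]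
      _ ≤ ENNReal.ofReal (Real.exp (t * (η ^ 2 * (K : ℝ) ^ 2 / 2))) * E :=
          mul_le_mul_left (ih (by omega) (by omega)) _
      _ = _ := by
          rw [hE, ← ENNReal.ofReal_mul (Real.exp_pos _).le, ← Real.exp_add]
          push_cast
          ring_nf

/-- Chernoff bound for the deviation of the Gram matrix during the initialization. -/
theorem measure_bilinDeviation_ge_le (h : IsMNLModel μ I θ T)
    (hinit : UniformInit μ I K T₀ T) (hK : K ≤ N) (hK1 : 1 ≤ K)
    (hfresh : ∀ t ∈ Finset.Icc 1 T, Indep (I.history (t - 1)) (I.contextInfo t) μ)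
    (hp : ∀ᵐ v ∂p, ‖v‖ ≤ 1) (hmap : ∀ t ∈ Finset.Icc 1 T, ∀ i, μ.map (I.x t i) = p)
    {u v : Feature d} (hu : ‖u‖ ≤ 1) (hv : ‖v‖ ≤ 1) {σ : ℝ} (hσ : 0 < σ) (hT : T₀ ≤ T) :
    μ {ω | K * T₀ * σ / 8 ≤ bilinDeviation I p u v T₀ ω} ≤
      ENNReal.ofReal (Real.exp (-(T₀ * σ ^ 2 / 128))) := by
  have hK0 : (0 : ℝ) < K := by exact_mod_cast hK1
  -- This minimizes `T₀ η² K² / 2 - η K T₀ σ / 8`, with minimum `-T₀ σ² / 128`.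
  set η : ℝ := σ / (8 * K) with hη
  have hη0 : 0 < η := by positivity
  have hmeas : Measurable fun ω => ENNReal.ofReal (Real.exp (η * bilinDeviation I p u v T₀ ω)) :=
    (((measurable_bilinDeviation p u v T₀).mono (h.history_le hT) le_rfl).const_mul
      η).exp.ennreal_ofReal
  have hpos := Real.exp_pos (η * (K * T₀ * σ / 8))
  calc μ {ω | K * T₀ * σ / 8 ≤ bilinDeviation I p u v T₀ ω}
      ≤ μ {ω | ENNReal.ofReal (Real.exp (η * (K * T₀ * σ / 8))) ≤
          ENNReal.ofReal (Real.exp (η * bilinDeviation I p u v T₀ ω))} :=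
        measure_mono fun ω hω => ENNReal.ofReal_le_ofReal (Real.exp_le_exp.2
          (mul_le_mul_of_nonneg_left hω hη0.le))
    _ ≤ (∫⁻ ω, ENNReal.ofReal (Real.exp (η * bilinDeviation I p u v T₀ ω)) ∂μ) /
          ENNReal.ofReal (Real.exp (η * (K * T₀ * σ / 8))) :=
        meas_ge_le_lintegral_div hmeas.aemeasurable (ENNReal.ofReal_pos.2 hpos).ne'
          ENNReal.ofReal_ne_top
    _ ≤ ENNReal.ofReal (Real.exp (T₀ * (η ^ 2 * (K : ℝ) ^ 2 / 2))) /
          ENNReal.ofReal (Real.exp (η * (K * T₀ * σ / 8))) :=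
        ENNReal.div_le_div_right
          (lintegral_exp_bilinDeviation_le h hinit hK hfresh hp hmap hu hv η hT le_rfl) _
    _ = _ := by
        rw [← ENNReal.ofReal_div_of_pos hpos, ← Real.exp_sub]
        congr 2
        rw [hη]
        field_simp
        ring

/-- After the initialization the Gram matrix is well conditioned with high probability. -/
theorem measure_not_le_quadForm_gram_le [IsProbabilityMeasure p] (h : IsMNLModel μ I θ T)
    (hinit : UniformInit μ I K T₀ T) (hK : K ≤ N) (hK1 : 1 ≤ K)
    (hfresh : ∀ t ∈ Finset.Icc 1 T, Indep (I.history (t - 1)) (I.contextInfo t) μ)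
    (hp : ∀ᵐ v ∂p, ‖v‖ ≤ 1) (hmap : ∀ t ∈ Finset.Icc 1 T, ∀ i, μ.map (I.x t i) = p)
    {σ : ℝ} (hσ : 0 < σ) (hcov : (covMatrix p - σ • (1 : Matrix (Fin d) (Fin d) ℝ)).PosSemidef)
    (hT : T₀ ≤ T) :
    μ {ω | ¬ ∀ v, K * T₀ * σ / 2 * ‖v‖ ^ 2 ≤ quadForm (I.gram T₀ ω) v} ≤
      ENNReal.ofReal (25 ^ d * Real.exp (-(T₀ * σ ^ 2 / 128))) := by
  obtain ⟨s, hs, hs1, hnet⟩ := exists_half_net d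
  have hcard : ∀ᵐ ω ∂μ, ∀ t ∈ Finset.Icc 1 T₀, (I.S t ω).card = K := by
    refine (Filter.eventually_all_finset _).2 fun t ht => ?_
    exact ae_card_eq_of_uniformInit h hinit hK (Finset.Icc_subset_Icc_right hT ht)
      (Finset.mem_Icc.1 ht).2
  have hdev : ∀ ω, (∀ t ∈ Finset.Icc 1 T₀, (I.S t ω).card = K) → ∀ u v : Feature d,
      u.ofLp ⬝ᵥ ((T₀ * K : ℝ) • covMatrix p - I.gram T₀ ω).mulVec v.ofLp =
        bilinDeviation I p u v T₀ ω := by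
    intro ω hω u v
    rw [Matrix.sub_mulVec, Matrix.smul_mulVec, dotProduct_sub, dotProduct_smul,
      ← covForm_eq_dotProduct hp, dotProduct_gram_mulVec, bilinDeviation]
    simp only [Finset.sum_sub_distrib, Finset.sum_const, nsmul_eq_mul, smul_eq_mul]
    have hsum : ∑ t ∈ Finset.Icc 1 T₀, ((I.S t ω).card : ℝ) * covForm p u v =
        ∑ t ∈ Finset.Icc 1 T₀, (K : ℝ) * covForm p u v :=
      Finset.sum_congr rfl fun t ht => by rw [hω t ht]
    rw [hsum, Finset.sum_const, Nat.card_Icc, nsmul_eq_mul, Nat.add_sub_cancel]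
    ring
  have hsub : {ω | ¬ ∀ v, K * T₀ * σ / 2 * ‖v‖ ^ 2 ≤ quadForm (I.gram T₀ ω) v} ≤ᵐ[μ]
      ⋃ u ∈ s, ⋃ v ∈ s, {ω | K * T₀ * σ / 8 ≤ bilinDeviation I p u v T₀ ω} := by
    filter_upwards [hcard] with ω hω hbad
    by_contra hno
    have hno' : ∀ u ∈ s, ∀ v ∈ s, bilinDeviation I p u v T₀ ω < K * T₀ * σ / 8 := by
      intro u hu v hv
      by_contra! hge
      exact hno (Set.mem_biUnion hu (Set.mem_biUnion hv hge))
    refine hbad fun v => ?_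
    -- The net loses a factor `4`, so deviations below `K T₀ σ / 8` on pairs of net points keep half
    -- of the mean curvature `K T₀ σ`. There are at most `25 ^ d` such pairs.
    have h1 := quadForm_le_of_half_net hnet ((T₀ * K : ℝ) • covMatrix p - I.gram T₀ ω)
      (c := K * T₀ * σ / 8) (fun u hu v hv => by rw [hdev ω hω]; exact (hno' u hu v hv).le) v
    have h2 := quadForm_add ((T₀ * K : ℝ) • covMatrix p - I.gram T₀ ω) (I.gram T₀ ω) v
    rw [sub_add_cancel, quadForm_smul] at h2
    have h3 := mul_le_mul_of_nonneg_left (le_quadForm_covMatrix hcov v)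
      (by positivity : (0 : ℝ) ≤ T₀ * K)
    linarith
  refine (measure_mono_ae hsub).trans ((measure_biUnion_finset_le _ _).trans ?_)
  calc ∑ u ∈ s, μ (⋃ v ∈ s, {ω | K * T₀ * σ / 8 ≤ bilinDeviation I p u v T₀ ω})
      ≤ ∑ u ∈ s, ∑ v ∈ s, ENNReal.ofReal (Real.exp (-(T₀ * σ ^ 2 / 128))) := by
        refine Finset.sum_le_sum fun u hu => (measure_biUnion_finset_le _ _).trans
          (Finset.sum_le_sum fun v hv => ?_)
        exact measure_bilinDeviation_ge_le h hinit hK hK1 hfresh hp hmap (hs1 u hu) (hs1 v hv) hσ hT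
    _ = ((s.card * s.card : ℕ) : ENNReal) * ENNReal.ofReal (Real.exp (-(T₀ * σ ^ 2 / 128))) := by
        simp only [Finset.sum_const, nsmul_eq_mul]
        push_cast
        ring
    _ ≤ ((25 ^ d : ℕ) : ENNReal) * ENNReal.ofReal (Real.exp (-(T₀ * σ ^ 2 / 128))) := by
        refine mul_le_mul_left (Nat.cast_le.2 ?_) _
        calc s.card * s.card ≤ 5 ^ d * 5 ^ d := Nat.mul_le_mul hs hs
          _ = 25 ^ d := by rw [← mul_pow]; norm_num
    _ = _ := by
        rw [← ENNReal.ofReal_natCast, ← ENNReal.ofReal_mul (Nat.cast_nonneg _)]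
        push_cast
        rfl

end Concentration

/-! ### Regret along one regular outcome -/

section Pathwise
variable {Ω : Type*} {d N : ℕ} {I : Interaction Ω d N} {K T₀ T : ℕ} {θ : Feature d}
  {θhat : ℕ → Ω → Feature d} {κ : ℝ} {ω : Ω}

/-- The almost sure properties of a run of UCB-MNL, at the outcome `ω`. -/
structure RegularAt (I : Interaction Ω d N) (K : ℕ) (θ : Feature d) (θhat : ℕ → Ω → Feature d)
    (κ : ℝ) (T₀ T : ℕ) (ω : Ω) : Prop where
  norm_x_le : ∀ t ∈ Finset.Icc 1 T, ∀ i, ‖I.x t i ω‖ ≤ 1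
  card_le : ∀ t ∈ Finset.Icc 1 T, (I.S t ω).card ≤ K
  abs_r_le : ∀ t ∈ Finset.Icc 1 T, ∀ i, |I.r t i ω| ≤ 1
  curvature : CurvatureBound I κ θ T ω
  mle : ∀ t, T₀ ≤ t → t < T → (∃ θ, I.score t ω θ = 0) → I.score t ω (θhat t ω) = 0
  offer : ∀ t ∈ Finset.Icc 1 T, T₀ < t → ∀ A ∈ assortments N K,
    utilityRevenue (I.rev t ω) (optimisticUtility I (confWidth d κ) θhat t ω) A ≤
      utilityRevenue (I.rev t ω) (optimisticUtility I (confWidth d κ) θhat t ω) (I.S t ω)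

theorem trace_gram_le {t : ℕ} (hx : ∀ s ∈ Finset.Icc 1 t, ∀ i, ‖I.x s i ω‖ ≤ 1)
    (hS : ∀ s ∈ Finset.Icc 1 t, (I.S s ω).card ≤ K) : (I.gram t ω).trace ≤ t * K := by
  simp only [Interaction.gram, Matrix.trace_sum, Matrix.trace_vecMulVec, ← norm_sq_eq_dotProduct]
  calc ∑ s ∈ Finset.Icc 1 t, ∑ i ∈ I.S s ω, ‖I.x s i ω‖ ^ 2
      ≤ ∑ s ∈ Finset.Icc 1 t, (K : ℝ) := by
        refine Finset.sum_le_sum fun s hs => ?_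
        calc ∑ i ∈ I.S s ω, ‖I.x s i ω‖ ^ 2 ≤ ∑ i ∈ I.S s ω, (1 : ℝ) :=
              Finset.sum_le_sum fun i _ => pow_le_one₀ (norm_nonneg _) (hx s hs i)
          _ = (I.S s ω).card := by simp
          _ ≤ K := by exact_mod_cast hS s hs
    _ = t * K := by simp

/-- Square of the confidence radius of the score after `t` rounds. -/
def radiusSq (d t : ℕ) : ℝ := 1 / 2 * (d * Real.log (1 + (t : ℝ) / d)) + 1 / 2 * Real.log t

/-- The determinant is bounded through the trace, which is at most `t K + K d`. Choosing the
regularizer equal to `K` makes `K` cancel, leaving `1 + t / d`. -/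
theorem log_det_gram_add_le (hd : 1 ≤ d) (hK : 1 ≤ K) {t : ℕ}
    (hx : ∀ s ∈ Finset.Icc 1 t, ∀ i, ‖I.x s i ω‖ ≤ 1)
    (hS : ∀ s ∈ Finset.Icc 1 t, (I.S s ω).card ≤ K) :
    Real.log ((I.gram t ω + (K : ℝ) • 1).det / (K : ℝ) ^ d) ≤
      d * Real.log (1 + (t : ℝ) / d) := by
  have hd0 : (0 : ℝ) < d := by exact_mod_cast hd
  have hK0 : (0 : ℝ) < K := by exact_mod_cast hK
  have hpd : (I.gram t ω + (K : ℝ) • (1 : Matrix (Fin d) (Fin d) ℝ)).PosDef :=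
    Matrix.PosDef.posSemidef_add (posSemidef_gram I t ω) (Matrix.PosDef.one.smul hK0)
  rw [← Real.log_pow]
  refine Real.log_le_log (div_pos hpd.det_pos (by positivity)) ?_
  rw [div_le_iff₀ (by positivity), ← mul_pow]
  refine (det_le_trace_div_pow hd hpd.posSemidef).trans (pow_le_pow_left₀
    (div_nonneg hpd.posSemidef.trace_nonneg hd0.le) ?_ d)
  rw [Matrix.trace_add, Matrix.trace_smul, Matrix.trace_one, Fintype.card_fin, smul_eq_mul,
    div_le_iff₀ hd0]
  have := trace_gram_le hx hS
  have h2 : (1 + (t : ℝ) / d) * K * d = t * K + K * d := by field_simp; ring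
  linarith

/-- The confidence bound for the score in the unregularized norm. -/
theorem weightedNorm_score_le (hd : 1 ≤ d) (hK : 1 ≤ K) {t : ℕ} (ht : 1 ≤ t)
    (hx : ∀ s ∈ Finset.Icc 1 t, ∀ i, ‖I.x s i ω‖ ≤ 1)
    (hS : ∀ s ∈ Finset.Icc 1 t, (I.S s ω).card ≤ K) {l : ℝ} (hl : 0 < l)
    (hVl : ∀ v, l * ‖v‖ ^ 2 ≤ quadForm (I.gram t ω) v) (hlK : K / l * radiusSq d t ≤ 1)
    (hdev : Real.exp (quadForm (I.gram t ω + (K : ℝ) • (1 : Matrix (Fin d) (Fin d) ℝ))⁻¹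
      (I.score t ω θ)) < Real.sqrt ((I.gram t ω + (K : ℝ) • 1).det / (K : ℝ) ^ d) /
        (Real.exp 1 / Real.sqrt t)) :
    weightedNorm (I.gram t ω)⁻¹ (I.score t ω θ) ≤ Real.sqrt (radiusSq d t) := by
  have hK0 : (0 : ℝ) < K := by exact_mod_cast hK
  have ht0 : (0 : ℝ) < t := by exact_mod_cast ht
  have hV := posDef_of_le_quadForm (posSemidef_gram I t ω) hl hVl
  have hW : (I.gram t ω + (K : ℝ) • (1 : Matrix (Fin d) (Fin d) ℝ)).PosDef :=
    hV.add (Matrix.PosDef.one.smul hK0)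
  refine Real.sqrt_le_sqrt ?_
  -- Since `l` bounds the Gram form from below, `V + K` is at most `(1 + K / l) V`, so dropping the
  -- regularizer inflates the dual form by `1 + K / l`.
  have h1 := quadForm_inv_le_mul hV hW (c := 1 + K / l) (by positivity) (fun v => by
    rw [quadForm_add, quadForm_smul, quadForm_one, add_mul, one_mul]
    have := mul_le_mul_of_nonneg_left (hVl v) (by positivity : (0 : ℝ) ≤ K / l)
    rw [← mul_assoc, div_mul_cancel₀ _ hl.ne'] at this
    linarith) (I.score t ω θ)
  have hD : 0 < (I.gram t ω + (K : ℝ) • 1).det / (K : ℝ) ^ d := div_pos hW.det_pos (by positivity)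
  -- The factor `e` in the failure level `e / √t` provides the `- 1`. It compensates the inflation,
  -- because `K / l` times the squared radius is at most `1`.
  have h2 : quadForm (I.gram t ω + (K : ℝ) • (1 : Matrix (Fin d) (Fin d) ℝ))⁻¹
      (I.score t ω θ) ≤ radiusSq d t - 1 := by
    have h3 := (Real.lt_log_iff_exp_lt (by positivity)).2 hdev
    rw [Real.log_div (by positivity) (by positivity), Real.log_div (by positivity) (by positivity),
      Real.log_sqrt hD.le, Real.log_sqrt ht0.le, Real.log_exp] at h3
    have h4 := log_det_gram_add_le hd hK hx hS
    rw [radiusSq]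
    linarith
  have h5 : (0 : ℝ) ≤ K / l := by positivity
  have h6 := mul_le_mul_of_nonneg_left h2 (by positivity : (0 : ℝ) ≤ 1 + K / l)
  calc quadForm (I.gram t ω)⁻¹ (I.score t ω θ) ≤ (1 + K / l) * (radiusSq d t - 1) := h1.trans h6
    _ ≤ radiusSq d t := by nlinarith

/-- The width of the algorithm is exactly the score radius divided by the curvature, with no slack
in the constants. For `κ = 0` both sides vanish by the convention for division. -/
theorem confWidth_eq (t : ℕ) : confWidth d κ t = Real.sqrt (radiusSq d t) / κ := by
  have h : (2 * d * Real.log (1 + (t : ℝ) / d) + 2 * Real.log t) = 2 ^ 2 * radiusSq d t := by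
    rw [radiusSq]; ring
  rw [confWidth, h, Real.sqrt_mul (by positivity), Real.sqrt_sq (by positivity)]
  rcases eq_or_ne κ 0 with rfl | hκ
  · simp
  · field_simp

theorem radiusSq_mono {s t : ℕ} (hs : 1 ≤ s) (hst : s ≤ t) : radiusSq d s ≤ radiusSq d t := by
  have hs0 : (0 : ℝ) < s := by exact_mod_cast hs
  have hst' : (s : ℝ) ≤ t := by exact_mod_cast hst
  unfold radiusSq
  gcongr

theorem confWidth_mono (hκ : 0 < κ) {s t : ℕ} (hs : 1 ≤ s) (hst : s ≤ t) :
    confWidth d κ s ≤ confWidth d κ t := by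
  rw [confWidth_eq, confWidth_eq]
  exact div_le_div_of_nonneg_right (Real.sqrt_le_sqrt (radiusSq_mono hs hst)) hκ.le

/-- Upper bound of the weighted feature norms of round `t + 1`. -/
def potentialStep (I : Interaction Ω d N) (ω : Ω) (t : ℕ) : ℝ :=
  Real.sqrt (2 * (Real.log (I.gram (t + 1) ω).det - Real.log (I.gram t ω).det))

/-- With least eigenvalue at least `1` and features in the unit ball, all dual norms are at most
`1`, as the logarithmic inequality requires. -/
theorem RegularAt.weightedNorm_le_potentialStep (hreg : RegularAt I K θ θhat κ T₀ T ω) {t : ℕ}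
    (htT : t < T) {l : ℝ} (hl : 1 ≤ l) (hVl : ∀ v, l * ‖v‖ ^ 2 ≤ quadForm (I.gram t ω) v)
    {i : Fin N} (hi : i ∈ I.S (t + 1) ω) :
    weightedNorm (I.gram t ω)⁻¹ (I.x (t + 1) i ω) ≤ potentialStep I ω t := by
  have hl0 : 0 < l := by linarith
  have hV := posDef_of_le_quadForm (posSemidef_gram I t ω) hl0 hVl
  refine Real.sqrt_le_sqrt ?_
  rw [gram_succ]
  refine quadForm_inv_le_two_mul_log (fun i => I.x (t + 1) i ω) hV hi ?_
  refine (quadForm_inv_le hV hl0 hVl _).trans ((div_le_one hl0).2 (le_trans ?_ hl))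
  exact pow_le_one₀ (norm_nonneg _)
    (hreg.norm_x_le _ (Finset.mem_Icc.2 ⟨by omega, by omega⟩) i)

/-- Regret of one optimistic round on the confidence event. -/
theorem RegularAt.regret_round_le (hreg : RegularAt I K θ θhat κ T₀ T ω) (hd : 1 ≤ d) (hK : 1 ≤ K)
    (hκ : 0 < κ) {t : ℕ} (ht : 1 ≤ t) (htT₀ : T₀ ≤ t) (htT : t < T) {l : ℝ} (hl : 1 ≤ l)
    (hVl : ∀ v, l * ‖v‖ ^ 2 ≤ quadForm (I.gram t ω) v) (hlK : K / l * radiusSq d t ≤ 1)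
    (hβl : radiusSq d t < κ ^ 2 * l)
    (hdev : Real.exp (quadForm (I.gram t ω + (K : ℝ) • (1 : Matrix (Fin d) (Fin d) ℝ))⁻¹
      (I.score t ω θ)) < Real.sqrt ((I.gram t ω + (K : ℝ) • 1).det / (K : ℝ) ^ d) /
        (Real.exp 1 / Real.sqrt t)) :
    optimalRevenue K (I.feat (t + 1) ω) (I.rev (t + 1) ω) θ
      - expectedRevenue (I.feat (t + 1) ω) (I.rev (t + 1) ω) θ (I.S (t + 1) ω) ≤
      4 * confWidth d κ T * potentialStep I ω t := by
  have hl0 : 0 < l := by linarith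
  have hmem : t + 1 ∈ Finset.Icc 1 T := Finset.mem_Icc.2 ⟨by omega, by omega⟩
  have hV := posDef_of_le_quadForm (posSemidef_gram I t ω) hl0 hVl
  have hβ := weightedNorm_score_le (θ := θ) hd hK ht
    (fun s hs => hreg.norm_x_le s (Finset.Icc_subset_Icc_right htT.le hs))
    (fun s hs => hreg.card_le s (Finset.Icc_subset_Icc_right htT.le hs)) hl0 hVl hlK hdev
  have hcurv : CurvatureBound I κ θ t ω := fun s hs =>
    hreg.curvature s (Finset.Icc_subset_Icc_right htT.le hs)
  have hβl' : Real.sqrt (radiusSq d t) < κ * Real.sqrt l := by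
    rw [← Real.sqrt_sq hκ.le, ← Real.sqrt_mul (sq_nonneg _)]
    exact Real.sqrt_lt_sqrt_iff_of_pos (by positivity) |>.2 hβl
  have hutil := optimisticUtility_mem_Icc (θhat := θhat) (α := confWidth d κ) hcurv hκ hV hβ hl0
    hVl hβl' (hreg.mle t htT₀ htT) (by
      rw [confWidth_eq]
      exact div_le_div_of_nonneg_right (Real.sqrt_le_sqrt (radiusSq_mono ht (by omega))) hκ.le)
  have hα0 : 0 ≤ confWidth d κ (t + 1) := by rw [confWidth_eq]; positivity
  have hα : confWidth d κ (t + 1) ≤ confWidth d κ T := confWidth_mono hκ (by omega) (by omega)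
  have hp0 : 0 ≤ potentialStep I ω t := Real.sqrt_nonneg _
  -- One factor `2` in `m` is the two-sided width of the optimistic utility; the other comes from
  -- the sensitivity of the revenue. Together they give the `4`.
  have hround := optimalRevenue_sub_le_of_optimistic (x := I.feat (t + 1) ω)
    (r := I.rev (t + 1) ω) (hreg.abs_r_le _ hmem) θ (hreg.offer _ hmem (by omega))
    (m := 2 * confWidth d κ (t + 1) * potentialStep I ω t) (by positivity)
    (fun i => (hutil i).1) fun i hi => (hutil i).2.trans (by
      have := hreg.weightedNorm_le_potentialStep htT hl hVl hi
      exact add_le_add_right (mul_le_mul_of_nonneg_left this (by positivity)) _)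
  refine hround.trans ?_
  have := mul_le_mul_of_nonneg_right hα hp0
  linarith

/-- The squares telescope to a difference of log-determinants. The initial one is at least `d log K`
and the final one at most `d log (T K / d)`, so `K` cancels; Cauchy–Schwarz over the rounds
finishes. -/
theorem RegularAt.sum_potentialStep_le (hreg : RegularAt I K θ θhat κ T₀ T ω) (hd : 1 ≤ d)
    (hK : 1 ≤ K) (hT : T₀ ≤ T)
    (hVl : ∀ v, (K : ℝ) * ‖v‖ ^ 2 ≤ quadForm (I.gram T₀ ω) v) :
    ∑ t ∈ Finset.Ico T₀ T, potentialStep I ω t ≤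
      Real.sqrt (2 * T * (d * Real.log ((T : ℝ) / d))) := by
  have hd0 : (0 : ℝ) < d := by exact_mod_cast hd
  have hK0 : (0 : ℝ) < K := by exact_mod_cast hK
  have hVt : ∀ t, T₀ ≤ t → ∀ v, (K : ℝ) * ‖v‖ ^ 2 ≤ quadForm (I.gram t ω) v := fun t ht v =>
    (hVl v).trans (quadForm_gram_mono I ht ω v)
  have hpd : ∀ t, T₀ ≤ t → (I.gram t ω).PosDef := fun t ht =>
    posDef_of_le_quadForm (posSemidef_gram I t ω) hK0 (hVt t ht)
  have hstep : ∀ t ∈ Finset.Ico T₀ T, potentialStep I ω t ^ 2 =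
      2 * (Real.log (I.gram (t + 1) ω).det - Real.log (I.gram t ω).det) := by
    intro t ht
    refine Real.sq_sqrt (mul_nonneg zero_le_two (sub_nonneg.2 (Real.log_le_log
      (hpd t (Finset.mem_Ico.1 ht).1).det_pos ?_)))
    rw [gram_succ]
    exact det_le_det_add_sum _ (fun i => I.x (t + 1) i ω) (hpd t (Finset.mem_Ico.1 ht).1)
  have hsum : ∑ t ∈ Finset.Ico T₀ T, potentialStep I ω t ^ 2 ≤
      2 * (d * Real.log ((T : ℝ) / d)) := by
    rw [Finset.sum_congr rfl hstep, ← Finset.mul_sum,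
      Finset.sum_Ico_sub (fun t => Real.log (I.gram t ω).det) hT]
    refine mul_le_mul_of_nonneg_left ?_ zero_le_two
    have h1 : Real.log ((K : ℝ) ^ d) ≤ Real.log (I.gram T₀ ω).det :=
      Real.log_le_log (by positivity) (pow_le_det (posSemidef_gram I _ ω) hK0.le hVl)
    have h2 : (I.gram T ω).det ≤ ((T : ℝ) / d * K) ^ d := by
      refine (det_le_trace_div_pow hd (posSemidef_gram I T ω)).trans (pow_le_pow_left₀
        (div_nonneg (posSemidef_gram I T ω).trace_nonneg hd0.le) ?_ d)
      rw [div_le_iff₀ hd0]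
      refine (trace_gram_le hreg.norm_x_le hreg.card_le).trans (le_of_eq ?_)
      field_simp
    have h3 := Real.log_le_log (hpd T hT).det_pos h2
    have hpos : 0 < (T : ℝ) / d * K := by
      by_contra! hneg
      have h0 := (hpd T hT).det_pos.trans_le h2
      have h4 : (T : ℝ) / d * K = 0 := le_antisymm hneg (by positivity)
      rw [h4, zero_pow (by omega)] at h0
      exact lt_irrefl _ h0
    have hTd : (T : ℝ) / d ≠ 0 := fun h => by rw [h, zero_mul] at hpos; exact lt_irrefl _ hpos
    rw [Real.log_pow, Real.log_mul hTd hK0.ne'] at h3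
    rw [Real.log_pow] at h1
    linarith
  refine Real.le_sqrt_of_sq_le ?_
  refine (sq_sum_le_card_mul_sum_sq (s := Finset.Ico T₀ T) (f := potentialStep I ω)).trans ?_
  rw [Nat.card_Ico]
  have hcard : ((T - T₀ : ℕ) : ℝ) ≤ T := by exact_mod_cast Nat.sub_le _ _
  calc ((T - T₀ : ℕ) : ℝ) * ∑ t ∈ Finset.Ico T₀ T, potentialStep I ω t ^ 2
      ≤ T * (2 * (d * Real.log ((T : ℝ) / d))) :=
        mul_le_mul hcard hsum (Finset.sum_nonneg fun _ _ => sq_nonneg _) (Nat.cast_nonneg _)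
    _ = _ := by ring

/-- The regret of one outcome: forced exploration, failure of the confidence events, and
optimistic rounds. -/
theorem RegularAt.sum_regret_le (hreg : RegularAt I K θ θhat κ T₀ T ω) (hd : 1 ≤ d) (hK : 1 ≤ K)
    (hκ : 0 < κ) (hT₀ : 1 ≤ T₀) (hT : T₀ ≤ T) {l : ℝ} (hKl : K ≤ l)
    (hlK : K / l * radiusSq d T ≤ 1) (hβl : radiusSq d T < κ ^ 2 * l) (bad : Set Ω)
    (badt : ℕ → Set Ω) (hbad : {ω | ¬ ∀ v, l * ‖v‖ ^ 2 ≤ quadForm (I.gram T₀ ω) v} ⊆ bad)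
    (hbadt : ∀ t ∈ Finset.Ico T₀ T, {ω | Real.sqrt ((I.gram t ω + (K : ℝ) • 1).det / (K : ℝ) ^ d) /
        (Real.exp 1 / Real.sqrt t) ≤ Real.exp (quadForm
          (I.gram t ω + (K : ℝ) • (1 : Matrix (Fin d) (Fin d) ℝ))⁻¹ (I.score t ω θ))} ⊆ badt t) :
    ∑ t ∈ Finset.Icc 1 T, (optimalRevenue K (I.feat t ω) (I.rev t ω) θ
      - expectedRevenue (I.feat t ω) (I.rev t ω) θ (I.S t ω)) ≤
      2 * T₀ + 4 * confWidth d κ T * Real.sqrt (2 * T * (d * Real.log ((T : ℝ) / d)))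
        + 2 * T * bad.indicator 1 ω + ∑ t ∈ Finset.Ico T₀ T, 2 * (badt t).indicator 1 ω := by
  set ρ : ℕ → ℝ := fun t => optimalRevenue K (I.feat t ω) (I.rev t ω) θ
      - expectedRevenue (I.feat t ω) (I.rev t ω) θ (I.S t ω) with hρ
  have hρ2 : ∀ t ∈ Finset.Icc 1 T, ρ t ≤ 2 := fun t ht =>
    optimalRevenue_sub_le_two (hreg.abs_r_le t ht) θ _
  have hα0 : 0 ≤ confWidth d κ T := by rw [confWidth_eq]; positivity
  have hind : ∀ (s : Set Ω), (0 : ℝ) ≤ s.indicator 1 ω := fun s =>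
    Set.indicator_nonneg (fun _ _ => zero_le_one) ω
  have hindt : 0 ≤ ∑ t ∈ Finset.Ico T₀ T, 2 * (badt t).indicator (1 : Ω → ℝ) ω :=
    Finset.sum_nonneg fun t _ => mul_nonneg zero_le_two (hind _)
  have hKpos : (1 : ℝ) ≤ K := by exact_mod_cast hK
  by_cases hω : ω ∈ bad
  · rw [Set.indicator_of_mem hω]
    have : ∑ t ∈ Finset.Icc 1 T, ρ t ≤ T * 2 := by
      refine (Finset.sum_le_sum hρ2).trans ?_
      simp
    have h2 : 0 ≤ 4 * confWidth d κ T * Real.sqrt (2 * T * (d * Real.log ((T : ℝ) / d))) := by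
      positivity
    have h3 : (0 : ℝ) ≤ T₀ := Nat.cast_nonneg _
    simp only [Pi.one_apply]
    linarith
  have hV : ∀ v, l * ‖v‖ ^ 2 ≤ quadForm (I.gram T₀ ω) v := by
    by_contra hno
    exact hω (hbad hno)
  have hVt : ∀ t, T₀ ≤ t → ∀ v, l * ‖v‖ ^ 2 ≤ quadForm (I.gram t ω) v := fun t ht v =>
    (hV v).trans (quadForm_gram_mono I ht ω v)
  have hround : ∀ t ∈ Finset.Ico T₀ T, ρ (t + 1) ≤
      4 * confWidth d κ T * potentialStep I ω t + 2 * (badt t).indicator (1 : Ω → ℝ) ω := by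
    intro t ht
    have ht' := Finset.mem_Ico.1 ht
    have hp0 : 0 ≤ potentialStep I ω t := Real.sqrt_nonneg _
    by_cases hωt : ω ∈ badt t
    · rw [Set.indicator_of_mem hωt]
      have := hρ2 (t + 1) (Finset.mem_Icc.2 ⟨by omega, by omega⟩)
      simp only [Pi.one_apply]
      nlinarith [mul_nonneg hα0 hp0]
    · rw [Set.indicator_of_notMem hωt, mul_zero, add_zero]
      have hmono : radiusSq d t ≤ radiusSq d T := radiusSq_mono (by omega) ht'.2.le
      refine hreg.regret_round_le hd hK hκ (by omega) ht'.1 ht'.2 (hKpos.trans hKl) (hVt t ht'.1)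
        ((mul_le_mul_of_nonneg_left hmono (div_nonneg (by linarith) (by linarith))).trans hlK)
        (hmono.trans_lt hβl) ?_
      by_contra! hge
      exact hωt (hbadt t ht hge)
  -- Round `t + 1` relies on the data of the first `t` rounds, so the optimistic rounds are indexed
  -- by their predecessors in `Ico T₀ T`.
  have hsplit : ∑ t ∈ Finset.Icc 1 T, ρ t =
      ∑ t ∈ Finset.Icc 1 T₀, ρ t + ∑ t ∈ Finset.Ico T₀ T, ρ (t + 1) := by
    have e1 : ∀ n, ∑ t ∈ Finset.Icc 1 n, ρ t = ∑ t ∈ Finset.Ico 0 n, ρ (t + 1) := fun n => by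
      rw [Finset.sum_Ico_add' ρ 0 n 1]; rfl
    rw [e1, e1, Finset.sum_Ico_consecutive _ (Nat.zero_le _) hT]
  have hfirst : ∑ t ∈ Finset.Icc 1 T₀, ρ t ≤ 2 * T₀ := by
    refine (Finset.sum_le_sum fun t ht => hρ2 t (Finset.Icc_subset_Icc_right hT ht)).trans ?_
    simp [mul_comm]
  have hsecond := Finset.sum_le_sum hround
  rw [Finset.sum_add_distrib, ← Finset.mul_sum] at hsecond
  have hpot := mul_le_mul_of_nonneg_left (hreg.sum_potentialStep_le hd hK hT fun v =>
    (mul_le_mul_of_nonneg_right hKl (sq_nonneg _)).trans (hV v))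
    (by positivity : 0 ≤ 4 * confWidth d κ T)
  rw [Set.indicator_of_notMem hω, hsplit]
  linarith

end Pathwise

/-! ### Numerical estimates and constants -/

section Numeric
variable {d K T₀ T : ℕ} {κ σ₀ : ℝ}

theorem regretRate_nonneg (d T : ℕ) : 0 ≤ regretRate d T := by unfold regretRate; positivity

theorem one_le_log_div (hd : 1 ≤ d) (hT : 3 * d ≤ T) : 1 ≤ Real.log ((T : ℝ) / d) := by
  have hd0 : (0 : ℝ) < d := by exact_mod_cast hd
  have h3 : (3 : ℝ) * d ≤ T := by exact_mod_cast hT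
  rw [Real.le_log_iff_exp_le (div_pos (by linarith) hd0)]
  exact (Real.exp_one_lt_d9.le.trans (by norm_num)).trans ((le_div_iff₀ hd0).2 h3)

/-- Both logarithms are at least `1` once `T ≥ 3 d`, so all terms of order `√T` are absorbed in the
rate. -/
theorem sqrt_le_regretRate (hd : 1 ≤ d) (hT : 3 * d ≤ T) : Real.sqrt T ≤ regretRate d T := by
  have hd1 : (1 : ℝ) ≤ d := by exact_mod_cast hd
  have h2 := one_le_log_div hd hT
  have hpos : 0 < (T : ℝ) / d :=
    div_pos (by exact_mod_cast (by omega : 0 < T)) (by linarith)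
  have h1 : 1 ≤ Real.log (1 + (T : ℝ) / d) :=
    h2.trans (Real.log_le_log hpos (by linarith))
  calc Real.sqrt T ≤ Real.sqrt (T * Real.log (1 + (T : ℝ) / d) * Real.log ((T : ℝ) / d)) := by
        refine Real.sqrt_le_sqrt ?_
        rw [mul_assoc]
        exact le_mul_of_one_le_right (Nat.cast_nonneg _) (one_le_mul_of_one_le_of_one_le h1 h2)
    _ ≤ regretRate d T := le_mul_of_one_le_left (Real.sqrt_nonneg _) hd1

/-- Bernoulli's inequality gives `T ≤ (1 + T / d) ^ d`; the term `2 log T` of the width is therefore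
no larger than the dimensional one. -/
theorem log_le_mul_log_one_add_div (hd : 1 ≤ d) (hT : 1 ≤ T) :
    Real.log T ≤ d * Real.log (1 + (T : ℝ) / d) := by
  have hd0 : (0 : ℝ) < d := by exact_mod_cast hd
  have hT0 : (0 : ℝ) < T := by exact_mod_cast hT
  rw [← Real.log_pow]
  refine Real.log_le_log hT0 ?_
  have h := one_add_mul_le_pow (a := (T : ℝ) / d) (by
    have : 0 ≤ (T : ℝ) / d := by positivity
    linarith) d
  have e : (d : ℝ) * ((T : ℝ) / d) = T := by field_simp
  linarith

theorem four_mul_confWidth_mul_sqrt_le (hd : 1 ≤ d) (hT : 3 * d ≤ T) (hκ : 0 < κ) :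
    4 * confWidth d κ T * Real.sqrt (2 * T * (d * Real.log ((T : ℝ) / d))) ≤
      6 / κ * regretRate d T := by
  have hd0 : (0 : ℝ) < d := by exact_mod_cast hd
  have hlog := log_le_mul_log_one_add_div hd (by omega : 1 ≤ T)
  have hL2 := one_le_log_div hd hT
  set L1 := Real.log (1 + (T : ℝ) / d)
  set L2 := Real.log ((T : ℝ) / d)
  have hL1 : 0 ≤ L1 := Real.log_nonneg (by
    have : 0 ≤ (T : ℝ) / d := by positivity
    linarith)
  have h1 : Real.sqrt (2 * d * L1 + 2 * Real.log T) ≤ Real.sqrt (4 * d * L1) :=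
    Real.sqrt_le_sqrt (by linarith)
  -- The product of the roots is `√8` times the rate, and `√8 ≤ 3`.
  have h2 : Real.sqrt (4 * d * L1) * Real.sqrt (2 * T * (d * L2)) ≤ 3 * regretRate d T := by
    rw [← Real.sqrt_mul (by positivity), regretRate]
    refine Real.sqrt_le_iff.2 ⟨by positivity, ?_⟩
    rw [mul_pow, mul_pow, Real.sq_sqrt (by positivity)]
    have : 0 ≤ (d : ℝ) ^ 2 * (T * L1 * L2) := by positivity
    nlinarith
  rw [confWidth]
  calc 4 * (1 / (2 * κ) * Real.sqrt (2 * d * L1 + 2 * Real.log T)) *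
        Real.sqrt (2 * T * (d * L2))
      = 2 / κ * (Real.sqrt (2 * d * L1 + 2 * Real.log T) * Real.sqrt (2 * T * (d * L2))) := by
        field_simp; ring
    _ ≤ 2 / κ * (3 * regretRate d T) := by
        refine mul_le_mul_of_nonneg_left (le_trans ?_ h2) (by positivity)
        exact mul_le_mul_of_nonneg_right h1 (Real.sqrt_nonneg _)
    _ = _ := by ring

/-- Each term is at most the increment `2 √t - 2 √(t - 1)`, and the increments telescope. -/
theorem sum_inv_sqrt_le (a T : ℕ) (ha : 1 ≤ a) :
    ∑ t ∈ Finset.Ico a T, 1 / Real.sqrt t ≤ 2 * Real.sqrt T := by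
  have hstep : ∀ t ∈ Finset.Ico a T, 1 / Real.sqrt t ≤
      2 * Real.sqrt t - 2 * Real.sqrt (t - 1 : ℕ) := by
    intro t ht
    have ht1 : 1 ≤ t := ha.trans (Finset.mem_Ico.1 ht).1
    have ht0 : (0 : ℝ) < t := by exact_mod_cast ht1
    have hs := Real.sqrt_pos.2 ht0
    rw [div_le_iff₀ hs, Nat.cast_sub ht1, Nat.cast_one]
    have e1 := Real.sq_sqrt ht0.le
    have e2 := Real.sq_sqrt (sub_nonneg.2 (by exact_mod_cast ht1 : (1 : ℝ) ≤ t))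
    nlinarith [sq_nonneg (Real.sqrt t - Real.sqrt (t - 1))]
  rcases le_total T a with h | h
  · rw [Finset.Ico_eq_empty_of_le h, Finset.sum_empty]; positivity
  · refine (Finset.sum_le_sum hstep).trans ?_
    have := Finset.sum_Ico_sub (fun t : ℕ => 2 * Real.sqrt ((t - 1 : ℕ) : ℝ)) h
    simp only [Nat.add_sub_cancel] at this
    rw [this]
    have h1 : Real.sqrt ((T - 1 : ℕ) : ℝ) ≤ Real.sqrt T :=
      Real.sqrt_le_sqrt (by exact_mod_cast Nat.sub_le _ _)
    have h2 := Real.sqrt_nonneg ((a - 1 : ℕ) : ℝ)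
    linarith

/-- Consequences of the lower bound on the initialization length. -/
theorem initThreshold_consequences (hd : 1 ≤ d) (hK : 1 ≤ K) (hκ : 0 < κ) (hσ : 0 < σ₀)
    (hσd : d * σ₀ ≤ 1) (hT : T₀ < T) (hT₀ : 512 * initThreshold d K κ σ₀ T ≤ T₀) :
    3 * d ≤ T ∧ 1 ≤ T₀ ∧ (K : ℝ) ≤ K * T₀ * σ₀ / 2 ∧
      K / (K * T₀ * σ₀ / 2) * radiusSq d T ≤ 1 ∧ radiusSq d T < κ ^ 2 * (K * T₀ * σ₀ / 2) ∧
      T * (25 ^ d * Real.exp (-(T₀ * σ₀ ^ 2 / 128))) ≤ 1 := by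
  have hd1 : (1 : ℝ) ≤ d := by exact_mod_cast hd
  have hK1 : (1 : ℝ) ≤ K := by exact_mod_cast hK
  have hT1 : (1 : ℝ) ≤ T := by exact_mod_cast (by omega : 1 ≤ T)
  have hTr : (T₀ : ℝ) < T := by exact_mod_cast hT
  have hlogT : 0 ≤ Real.log T := Real.log_nonneg hT1
  have hσ1 : σ₀ ≤ 1 := by nlinarith
  have hsq : σ₀ ^ 2 ≤ 1 := pow_le_one₀ hσ.le hσ1
  have h1 : 512 * (d * Real.log ((T : ℝ) / d) + 4 * Real.log T) ≤ T₀ * (K * σ₀ * κ ^ 2) := by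
    have := (mul_le_mul_of_nonneg_left (le_max_left _ _) (by norm_num : (0 : ℝ) ≤ 512)).trans hT₀
    rwa [← mul_div_assoc, div_le_iff₀ (by positivity)] at this
  have h2 : 512 * (d + Real.log T) ≤ T₀ * σ₀ ^ 2 := by
    have := (mul_le_mul_of_nonneg_left (le_max_right _ _) (by norm_num : (0 : ℝ) ≤ 512)).trans hT₀
    rwa [← mul_div_assoc, div_le_iff₀ (by positivity)] at this
  have hT₀0 : (0 : ℝ) ≤ T₀ := Nat.cast_nonneg _
  have h3 : 512 * (d + Real.log T) ≤ T₀ := h2.trans (mul_le_of_le_one_right hT₀0 hsq)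
  have hdT : 3 * d ≤ T := by
    have : (3 : ℝ) * d ≤ T := by linarith
    exact_mod_cast this
  have hT₀1 : (1 : ℝ) ≤ T₀ := by linarith
  -- The bound `d * σ₀ ≤ 1` trades one factor `σ₀` for a factor `d`, which is what comparing `T₀ σ₀`
  -- with the squared radius requires.
  have h4 : 512 * (d * (d + Real.log T)) ≤ T₀ * σ₀ := by
    have : 512 * (d + Real.log T) * d ≤ T₀ * σ₀ ^ 2 * d :=
      mul_le_mul_of_nonneg_right h2 (by linarith)
    have e : T₀ * σ₀ ^ 2 * d ≤ T₀ * σ₀ := by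
      calc T₀ * σ₀ ^ 2 * d = T₀ * σ₀ * (d * σ₀) := by ring
        _ ≤ T₀ * σ₀ := mul_le_of_le_one_right (by positivity) hσd
    linarith
  have hL2 := one_le_log_div hd hdT
  have hrad : radiusSq d T ≤ d * (d + Real.log T) := by
    have e1 : Real.log (1 + (T : ℝ) / d) ≤ 1 + Real.log T := by
      have : 1 + (T : ℝ) / d ≤ 2 * T := by
        have : (T : ℝ) / d ≤ T := div_le_self (by linarith) hd1
        linarith
      have h5 := Real.log_le_log (by positivity) this
      rw [Real.log_mul two_ne_zero (by linarith)] at h5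
      have := Real.log_two_lt_d9
      linarith
    have e2 := mul_le_mul_of_nonneg_left e1 (by linarith : (0 : ℝ) ≤ d)
    rw [radiusSq]
    nlinarith
  have hrad2 : radiusSq d T ≤ d * Real.log ((T : ℝ) / d) + Real.log T := by
    have hTd : 1 ≤ (T : ℝ) / d := by
      rw [le_div_iff₀ (by linarith)]
      have : (d : ℝ) ≤ T := by exact_mod_cast (by omega : d ≤ T)
      linarith
    have e1 : Real.log (1 + (T : ℝ) / d) ≤ 2 * Real.log ((T : ℝ) / d) := by
      have h5 := Real.log_le_log (by positivity) (by linarith : 1 + (T : ℝ) / d ≤ 2 * (T / d))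
      rw [Real.log_mul two_ne_zero (by positivity)] at h5
      have := Real.log_two_lt_d9
      linarith
    have e2 := mul_le_mul_of_nonneg_left e1 (by linarith : (0 : ℝ) ≤ d)
    rw [radiusSq]
    linarith
  have hTσ : 512 ≤ T₀ * σ₀ := by nlinarith
  refine ⟨hdT, by exact_mod_cast hT₀1, ?_, ?_, ?_, ?_⟩
  · nlinarith
  · have hpos : (0 : ℝ) < K * T₀ * σ₀ / 2 := by positivity
    rw [div_mul_eq_mul_div, div_le_one hpos]
    have : radiusSq d T ≤ T₀ * σ₀ / 2 := by nlinarith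
    calc K * radiusSq d T ≤ K * (T₀ * σ₀ / 2) := mul_le_mul_of_nonneg_left this (by linarith)
      _ = _ := by ring
  · have e : κ ^ 2 * (K * T₀ * σ₀ / 2) = T₀ * (K * σ₀ * κ ^ 2) / 2 := by ring
    have hdL : 1 ≤ d * Real.log ((T : ℝ) / d) := one_le_mul_of_one_le_of_one_le hd1 hL2
    rw [e]
    linarith
  · have e25 : (25 : ℝ) ^ d ≤ Real.exp (4 * d) := by
      have h5 : (25 : ℝ) ≤ Real.exp 4 := by
        have e3 : Real.exp 4 = Real.exp 1 ^ 4 := by rw [← Real.exp_nat_mul]; norm_num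
        have e4 : (2.7 : ℝ) ^ 4 ≤ Real.exp 1 ^ 4 :=
          pow_le_pow_left₀ (by norm_num) (by linarith [Real.exp_one_gt_d9]) 4
        rw [e3]
        exact le_trans (by norm_num) e4
      calc (25 : ℝ) ^ d ≤ Real.exp 4 ^ d := pow_le_pow_left₀ (by norm_num) h5 d
        _ = _ := by rw [← Real.exp_nat_mul]; ring_nf
    calc T * (25 ^ d * Real.exp (-(T₀ * σ₀ ^ 2 / 128)))
        ≤ Real.exp (Real.log T) * (Real.exp (4 * d) * Real.exp (-(T₀ * σ₀ ^ 2 / 128))) := by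
          rw [Real.exp_log (by linarith)]
          gcongr
      _ = Real.exp (Real.log T + 4 * d - T₀ * σ₀ ^ 2 / 128) := by
          rw [← Real.exp_add, ← Real.exp_add]; ring_nf
      _ ≤ 1 := Real.exp_le_one_iff.2 (by linarith)

/-- An initialization of the stated order is negligible compared with the regret rate. -/
theorem eventually_initOrder_le (d K : ℕ) (κ σ₀ C₁ : ℝ) (hd : 1 ≤ d) (hκ : 0 < κ) :
    ∃ Tmin : ℕ, ∀ T : ℕ, Tmin ≤ T → d ≤ T ∧
      2 * (C₁ * initOrder d K κ σ₀ T) ≤ 1 / κ * regretRate d T := by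
  have hd1 : (1 : ℝ) ≤ d := by exact_mod_cast hd
  have hlog : (fun x : ℝ => (κ ^ 2)⁻¹ * ((d + 4) * Real.log x) + K / σ₀ ^ 2) =o[Filter.atTop]
      fun x : ℝ => Real.sqrt x := by
    have h1 : (fun x : ℝ => Real.log x) =o[Filter.atTop] fun x : ℝ => Real.sqrt x := by
      simpa only [Real.sqrt_eq_rpow] using isLittleO_log_rpow_atTop (r := 1 / 2) (by norm_num)
    refine ((h1.const_mul_left _).const_mul_left _).add ?_
    refine Asymptotics.isLittleO_const_left.2 (Or.inr ?_)
    exact tendsto_norm_atTop_atTop.comp Real.tendsto_sqrt_atTop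
  -- Using `|C₁| + 1` gives a positive constant whatever the sign of `C₁`.
  have hc : 0 < 1 / (2 * κ * (|C₁| + 1)) := by positivity
  have hev := (hlog.def hc).natCast_atTop
  obtain ⟨T1, hT1⟩ := Filter.eventually_atTop.1 hev
  refine ⟨max T1 (3 * d), fun T hT => ?_⟩
  have hT3 : 3 * d ≤ T := (le_max_right _ _).trans hT
  have hb := hT1 T ((le_max_left _ _).trans hT)
  have hT1' : (1 : ℝ) ≤ T := by exact_mod_cast (by omega : 1 ≤ T)
  have hlogT : 0 ≤ Real.log T := Real.log_nonneg hT1'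
  have hlogd : Real.log ((T : ℝ) / d) ≤ Real.log T :=
    Real.log_le_log (by positivity) (div_le_self (by linarith) hd1)
  have hlogd0 : 0 ≤ Real.log ((T : ℝ) / d) := by linarith [one_le_log_div hd hT3]
  rw [Real.norm_of_nonneg (by positivity), Real.norm_of_nonneg (Real.sqrt_nonneg _)] at hb
  have hord0 : 0 ≤ initOrder d K κ σ₀ T := le_max_of_le_right (by positivity)
  have hord : initOrder d K κ σ₀ T ≤ (κ ^ 2)⁻¹ * ((d + 4) * Real.log T) + K / σ₀ ^ 2 := by
    refine max_le ?_ (le_add_of_nonneg_left (by positivity))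
    refine le_trans (mul_le_mul_of_nonneg_left ?_ (by positivity))
      (le_add_of_nonneg_right (by positivity))
    nlinarith
  refine ⟨by omega, ?_⟩
  have hrate := sqrt_le_regretRate hd hT3
  calc 2 * (C₁ * initOrder d K κ σ₀ T) ≤ 2 * ((|C₁| + 1) * initOrder d K κ σ₀ T) := by
        have : C₁ ≤ |C₁| + 1 := by linarith [le_abs_self C₁]
        exact mul_le_mul_of_nonneg_left (mul_le_mul_of_nonneg_right this hord0) zero_le_two
    _ ≤ 2 * ((|C₁| + 1) * (1 / (2 * κ * (|C₁| + 1)) * Real.sqrt T)) := by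
        have := hord.trans hb
        gcongr
    _ = 1 / κ * Real.sqrt T := by field_simp
    _ ≤ 1 / κ * regretRate d T := mul_le_mul_of_nonneg_left hrate (by positivity)

end Numeric

/-! ### Expected regret of a run -/

section Regret
variable {Ω : Type*} [MeasurableSpace Ω] {μ : Measure Ω} [IsProbabilityMeasure μ] {d N K : ℕ}
  {I : Interaction Ω d N} {θ : Feature d} {θhat : ℕ → Ω → Feature d} {κ σ₀ : ℝ} {T₀ T : ℕ}

theorem IsUCBMNLRun.ae_regularAt (h : IsUCBMNLRun μ I K θ θhat κ σ₀ T₀ T) (hK : K ≤ N) :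
    ∀ᵐ ω ∂μ, RegularAt I K θ θhat κ T₀ T ω := by
  obtain ⟨p, hmap, hp, -⟩ := h.contexts.identDistrib
  have hx : ∀ᵐ ω ∂μ, ∀ t ∈ Finset.Icc 1 T, ∀ i, ‖I.x t i ω‖ ≤ 1 := by
    refine (Filter.eventually_all_finset _).2 fun t ht => ae_all_iff.2 fun i => ?_
    have hp' := hp
    rw [← hmap t ht i] at hp'
    exact ae_of_ae_map (h.model.measurable_x t ht i).aemeasurable hp'
  have hS : ∀ᵐ ω ∂μ, ∀ t ∈ Finset.Icc 1 T, I.S t ω ∈ assortments N K := by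
    refine (Filter.eventually_all_finset _).2 fun t ht => ?_
    rcases le_or_gt t T₀ with h1 | h1
    · filter_upwards [ae_card_eq_of_uniformInit h.model h.algorithm.init hK ht h1] with ω hω
      simp [assortments, hω]
    · exact (h.algorithm.offer t ht h1).mono fun ω hω => hω.1
  have hr : ∀ᵐ ω ∂μ, ∀ t ∈ Finset.Icc 1 T, ∀ i, |I.r t i ω| ≤ 1 :=
    (Filter.eventually_all_finset _).2 fun t ht =>
      ae_all_iff.2 fun i => h.model.abs_r_le_one t ht i
  have hcurv := (Filter.eventually_all_finset (l := ae μ) (Finset.Icc 1 T)).2 fun t ht =>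
    h.prob t ht
  have hmle := ae_all_iff.2 fun t => Filter.eventually_imp_distrib_left.2 fun ht => Filter.eventually_imp_distrib_left.2 fun htT =>
    h.algorithm.mle t ht htT
  have hoffer := (Filter.eventually_all_finset (l := ae μ) (Finset.Icc 1 T)).2 fun t ht =>
    Filter.eventually_imp_distrib_left.2 fun htT => h.algorithm.offer t ht htT
  filter_upwards [hx, hS, hr, hcurv, hmle, hoffer] with ω h1 h2 h3 h4 h5 h6
  exact
    { norm_x_le := h1
      card_le := fun t ht => by simpa [assortments] using h2 t ht
      abs_r_le := h3
      curvature := fun s hs i hi θ' hθ' => h4 s hs _ (h2 s hs) i hi θ' hθ'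
      mle := h5
      offer := fun t ht htT => (h6 t ht htT).2 }

/-- A product of two probabilities is at most `1`. This lets terms without `1 / κ` be absorbed in
the bound. -/
theorem IsUCBMNLRun.kappa_le_one (h : IsUCBMNLRun μ I K θ θhat κ σ₀ T₀ T) (hK1 : 1 ≤ K)
    (hK : K ≤ N) (hT : 1 ≤ T) : κ ≤ 1 := by
  obtain ⟨ω, hω⟩ := (h.prob 1 (Finset.mem_Icc.2 ⟨le_rfl, hT⟩)).exists
  let i : Fin N := ⟨0, by omega⟩
  have hle : ∀ j, choiceProb (I.feat 1 ω) {i} θ j ≤ 1 := fun j => by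
    rw [← sum_choiceProb (I.feat 1 ω) {i} θ]
    exact Finset.single_le_sum (fun j _ => choiceProb_nonneg _ _ _ j) (Finset.mem_univ j)
  exact (hω {i} (by simpa [assortments] using hK1) i (Finset.mem_singleton_self i) θ
    (by simp)).trans (mul_le_one₀ (hle _) (choiceProb_nonneg _ _ _ _) (hle _))

theorem measurable_expectedRevenue {x : Fin N → Ω → Feature d} (hx : ∀ i, Measurable (x i))
    {r : Fin N → Ω → ℝ} (hr : ∀ i, Measurable (r i)) {S : Ω → Finset (Fin N)}
    (hS : ∀ A, MeasurableSet (S ⁻¹' {A})) (θ : Feature d) :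
    Measurable fun ω => expectedRevenue (fun i => x i ω) (fun i => r i ω) θ (S ω) :=
  measurable_sum_assortment hS fun i => (hr i).mul (measurable_choiceProb hx hS θ (some i))

theorem measurable_optimalRevenue (K : ℕ) {x : Fin N → Ω → Feature d}
    (hx : ∀ i, Measurable (x i)) {r : Fin N → Ω → ℝ} (hr : ∀ i, Measurable (r i))
    (θ : Feature d) :
    Measurable fun ω => optimalRevenue K (fun i => x i ω) (fun i => r i ω) θ := by
  have h := Finset.measurable_sup' (assortments_nonempty N K)
    (f := fun A ω => expectedRevenue (fun i => x i ω) (fun i => r i ω) θ A)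
    fun A _ => measurable_expectedRevenue hx hr (S := fun _ => A)
      (fun _ => MeasurableSet.const _) θ
  convert h using 2 with ω
  rw [optimalRevenue, Finset.sup'_apply]

theorem IsUCBMNLRun.integrable_regret (h : IsUCBMNLRun μ I K θ θhat κ σ₀ T₀ T) :
    Integrable (fun ω => ∑ t ∈ Finset.Icc 1 T, (optimalRevenue K (I.feat t ω) (I.rev t ω) θ
      - expectedRevenue (I.feat t ω) (I.rev t ω) θ (I.S t ω))) μ := by
  refine integrable_finsetSum _ fun t ht => ?_
  have hx := h.model.measurable_x t ht
  have hr := h.model.measurable_r t ht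
  refine Integrable.of_bound ((measurable_optimalRevenue K hx hr θ).sub
    (measurable_expectedRevenue hx hr (h.model.measurable_S t ht) θ)).aestronglyMeasurable 2 ?_
  filter_upwards [ae_all_iff.2 fun i => h.model.abs_r_le_one t ht i] with ω hω
  have hω' : ∀ i, |I.rev t ω i| ≤ 1 := hω
  rw [Real.norm_eq_abs, abs_le]
  refine ⟨?_, optimalRevenue_sub_le_two hω' θ _⟩
  have h1 := (abs_le.1 (expectedRevenue_abs_le_one (x := I.feat t ω) hω' θ ∅)).1
  have h2 : expectedRevenue (I.feat t ω) (I.rev t ω) θ ∅ ≤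
      optimalRevenue K (I.feat t ω) (I.rev t ω) θ :=
    Finset.le_sup' (expectedRevenue (I.feat t ω) (I.rev t ω) θ) (by simp [assortments])
  have h3 := (abs_le.1 (expectedRevenue_abs_le_one (x := I.feat t ω) hω' θ (I.S t ω))).2
  linarith

/-- The pathwise bound is integrated: the bad initialization event contributes a constant, the
failures of the confidence bounds contribute `O(√T)`, and the optimistic rounds give the rate. -/
theorem IsUCBMNLRun.regret_le (h : IsUCBMNLRun μ I K θ θhat κ σ₀ T₀ T) (hd : 1 ≤ d)
    (hK1 : 1 ≤ K) (hK : K ≤ N) (hκ : 0 < κ) (hσ : 0 < σ₀) (hdT : d ≤ T)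
    (hT₀ : 512 * initThreshold d K κ σ₀ T ≤ T₀) :
    I.regret μ K θ T ≤ 2 * T₀ + 20 / κ * regretRate d T := by
  have hreg := h.ae_regularAt hK
  have hrate0 := regretRate_nonneg d T
  suffices hg : ∃ g : Ω → ℝ, Integrable g μ ∧
      ∫ ω, g ω ∂μ ≤ 2 * T₀ + 20 / κ * regretRate d T ∧
      ∀ᵐ ω ∂μ, ∑ t ∈ Finset.Icc 1 T, (optimalRevenue K (I.feat t ω) (I.rev t ω) θ
        - expectedRevenue (I.feat t ω) (I.rev t ω) θ (I.S t ω)) ≤ g ω by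
    obtain ⟨g, hgi, hgle, hfg⟩ := hg
    exact (integral_mono_ae h.integrable_regret hgi hfg).trans hgle
  -- If exploration fills the horizon, the trivial loss of `2` per round is already covered by `2 *
  -- T₀`.
  rcases le_or_gt T T₀ with hTT | hTT
  · refine ⟨fun _ => 2 * T, integrable_const _, ?_, ?_⟩
    · rw [integral_const, probReal_univ, one_smul]
      have : (T : ℝ) ≤ T₀ := by exact_mod_cast hTT
      have h0 : 0 ≤ 20 / κ * regretRate d T := by positivity
      linarith
    · filter_upwards [hreg] with ω hω
      refine (Finset.sum_le_sum fun t ht =>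
        optimalRevenue_sub_le_two (hω.abs_r_le t ht) θ _).trans ?_
      simp [mul_comm]
  obtain ⟨p, hmap, hp, hcov⟩ := h.contexts.identDistrib
  have hT1 : 1 ≤ T := hd.trans hdT
  have hprob : IsProbabilityMeasure p := by
    have h1 : 1 ∈ Finset.Icc 1 T := Finset.mem_Icc.2 ⟨le_rfl, hT1⟩
    rw [← hmap 1 h1 ⟨0, by omega⟩]
    exact Measure.isProbabilityMeasure_map (h.model.measurable_x 1 h1 _).aemeasurable
  have hσd := natCast_mul_le_one_of_posSemidef hp hcov
  obtain ⟨h3d, hT₀1, hKl, hlK, hβl, hexp⟩ :=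
    initThreshold_consequences hd hK1 hκ hσ hσd hTT hT₀
  set l : ℝ := K * T₀ * σ₀ / 2
  set bad₀ : Set Ω := {ω | ¬ ∀ v, l * ‖v‖ ^ 2 ≤ quadForm (I.gram T₀ ω) v} with hbad₀
  set badt₀ : ℕ → Set Ω := fun t => {ω | Real.sqrt ((I.gram t ω + (K : ℝ) • 1).det / (K : ℝ) ^ d) /
        (Real.exp 1 / Real.sqrt t) ≤ Real.exp (quadForm
          (I.gram t ω + (K : ℝ) • (1 : Matrix (Fin d) (Fin d) ℝ))⁻¹ (I.score t ω θ))} with hbadt₀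
  -- Measurable hulls replace the exceptional sets without changing their measure, so no
  -- measurability of the events has to be checked.
  have hPbad : μ.real (toMeasurable μ bad₀) ≤ 25 ^ d * Real.exp (-(T₀ * σ₀ ^ 2 / 128)) := by
    rw [measureReal_def, measure_toMeasurable]
    exact ENNReal.toReal_le_of_le_ofReal (by positivity) (measure_not_le_quadForm_gram_le h.model
      h.algorithm.init hK hK1 h.contexts.fresh hp hmap hσ hcov hTT.le)
  have hPbadt : ∀ t ∈ Finset.Ico T₀ T,
      μ.real (toMeasurable μ (badt₀ t)) ≤ Real.exp 1 / Real.sqrt t := by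
    intro t ht
    have ht' := Finset.mem_Ico.1 ht
    have ht0 : (0 : ℝ) < t := by exact_mod_cast (by omega : 0 < t)
    rw [measureReal_def, measure_toMeasurable]
    exact ENNReal.toReal_le_of_le_ofReal (by positivity) (measure_score_ge_le h.model ht'.2.le
      (by exact_mod_cast hK1) (by positivity))
  set B : ℝ := 2 * T₀ + 4 * confWidth d κ T * Real.sqrt (2 * T * (d * Real.log ((T : ℝ) / d)))
    with hB
  have hi : ∀ s : Set Ω, Integrable ((toMeasurable μ s).indicator (1 : Ω → ℝ)) μ := fun s =>
    (integrable_const (1 : ℝ)).indicator (measurableSet_toMeasurable μ s)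
  have hI : ∀ s : Set Ω, ∫ ω, (toMeasurable μ s).indicator (1 : Ω → ℝ) ω ∂μ =
      μ.real (toMeasurable μ s) := fun s => integral_indicator_one (measurableSet_toMeasurable μ s)
  have hi1 : Integrable (fun ω => B + 2 * T * (toMeasurable μ bad₀).indicator 1 ω) μ :=
    (integrable_const B).add ((hi bad₀).const_mul _)
  have hi2 : Integrable (fun ω => ∑ t ∈ Finset.Ico T₀ T,
      2 * (toMeasurable μ (badt₀ t)).indicator (1 : Ω → ℝ) ω) μ :=
    integrable_finsetSum _ fun t _ => (hi (badt₀ t)).const_mul 2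
  refine ⟨fun ω => B + 2 * T * (toMeasurable μ bad₀).indicator 1 ω +
    ∑ t ∈ Finset.Ico T₀ T, 2 * (toMeasurable μ (badt₀ t)).indicator 1 ω, hi1.add hi2, ?_, ?_⟩
  · rw [integral_add hi1 hi2, integral_add (integrable_const B) ((hi bad₀).const_mul _),
      integral_const, probReal_univ, one_smul, integral_const_mul, hI,
      integral_finsetSum _ fun t _ => (hi (badt₀ t)).const_mul 2]
    simp only [integral_const_mul, hI]
    have e1 : 2 * T * μ.real (toMeasurable μ bad₀) ≤ 2 := by
      have := mul_le_mul_of_nonneg_left hPbad (Nat.cast_nonneg (α := ℝ) T)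
      linarith
    have e2 : ∑ t ∈ Finset.Ico T₀ T, 2 * μ.real (toMeasurable μ (badt₀ t)) ≤
        12 * Real.sqrt T := by
      calc ∑ t ∈ Finset.Ico T₀ T, 2 * μ.real (toMeasurable μ (badt₀ t))
          ≤ ∑ t ∈ Finset.Ico T₀ T, 2 * Real.exp 1 * (1 / Real.sqrt t) :=
            Finset.sum_le_sum fun t ht => by
              have := hPbadt t ht
              rw [mul_assoc, mul_one_div]
              linarith
        _ = 2 * Real.exp 1 * ∑ t ∈ Finset.Ico T₀ T, 1 / Real.sqrt t := by rw [Finset.mul_sum]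
        _ ≤ 2 * 3 * (2 * Real.sqrt T) := by
            have h3 : Real.exp 1 ≤ 3 := by linarith [Real.exp_one_lt_d9]
            refine mul_le_mul (by linarith) (sum_inv_sqrt_le T₀ T hT₀1)
              (Finset.sum_nonneg fun _ _ => by positivity) (by norm_num)
        _ = _ := by ring
    have e3 := four_mul_confWidth_mul_sqrt_le hd h3d hκ
    have e4 := sqrt_le_regretRate hd h3d
    have e5 : 1 ≤ Real.sqrt T := Real.one_le_sqrt.2 (by exact_mod_cast hT1)
    have e6 : regretRate d T ≤ 1 / κ * regretRate d T :=
      le_mul_of_one_le_left hrate0 ((one_le_div hκ).2 (h.kappa_le_one hK1 hK hT1))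
    have e7 : 6 / κ * regretRate d T = 6 * (1 / κ * regretRate d T) := by ring
    have e8 : 20 / κ * regretRate d T = 20 * (1 / κ * regretRate d T) := by ring
    -- The `20` collects `6` from the optimistic rounds, `2` from a badly conditioned Gram matrix
    -- and `12` from the failing confidence bounds.
    rw [hB, e8]
    linarith
  · filter_upwards [hreg] with ω hω
    exact hω.sum_regret_le hd hK1 hκ hT₀1 hTT.le hKl hlK hβl (toMeasurable μ bad₀)
      (fun t => toMeasurable μ (badt₀ t)) (subset_toMeasurable μ bad₀)
      fun t _ => subset_toMeasurable μ (badt₀ t)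

end Regret

end MNLBandit

end

/-! ### The theorem with explicit constants -/

theorem mainTheorem4 :
    ∃ C₀ C : ℝ, 0 < C₀ ∧ 0 < C ∧
      -- non-asymptotic bound, for every sufficiently long initialization
      (∀ (d N K : ℕ) (κ σ₀ : ℝ) (T T₀ : ℕ), 1 ≤ d → 1 ≤ K → K ≤ N → 0 < κ → 0 < σ₀ → d ≤ T →
        ∀ (Ω : Type u) [MeasurableSpace Ω] (μ : Measure Ω) [IsProbabilityMeasure μ]
          (I : MNLBandit.Interaction Ω d N) (θstar : MNLBandit.Feature d)
          (θhat : ℕ → Ω → MNLBandit.Feature d),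
          MNLBandit.IsUCBMNLRun μ I K θstar θhat κ σ₀ T₀ T →
          C₀ * MNLBandit.initThreshold d K κ σ₀ T ≤ T₀ →
          I.regret μ K θstar T ≤ 2 * T₀ + C / κ * MNLBandit.regretRate d T) ∧
      -- hence the stated order of the regret when the initialization has the stated order
      (∀ (d K : ℕ) (κ σ₀ C₁ : ℝ), 1 ≤ d → 1 ≤ K → 0 < κ → 0 < σ₀ → ∃ Tmin : ℕ,
        ∀ (N T T₀ : ℕ), K ≤ N → Tmin ≤ T →
        ∀ (Ω : Type u) [MeasurableSpace Ω] (μ : Measure Ω) [IsProbabilityMeasure μ]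
          (I : MNLBandit.Interaction Ω d N) (θstar : MNLBandit.Feature d)
          (θhat : ℕ → Ω → MNLBandit.Feature d),
          MNLBandit.IsUCBMNLRun μ I K θstar θhat κ σ₀ T₀ T →
          C₀ * MNLBandit.initThreshold d K κ σ₀ T ≤ T₀ →
          T₀ ≤ C₁ * MNLBandit.initOrder d K κ σ₀ T →
          I.regret μ K θstar T ≤ C / κ * MNLBandit.regretRate d T) := by
  -- The non-asymptotic bound holds with `20`; the additional unit absorbs `2 * T₀` for large `T` in
  -- the second claim.
  refine ⟨512, 21, by norm_num, by norm_num, ?_, ?_⟩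
  · intro d N K κ σ₀ T T₀ hd hK1 hK hκ hσ hdT Ω _ μ _ I θstar θhat hrun hT₀
    refine (hrun.regret_le hd hK1 hK hκ hσ hdT hT₀).trans ?_
    have := MNLBandit.regretRate_nonneg d T
    gcongr
    norm_num
  · intro d K κ σ₀ C₁ hd hK1 hκ hσ
    obtain ⟨Tmin, hTmin⟩ := MNLBandit.eventually_initOrder_le d K κ σ₀ C₁ hd hκ
    refine ⟨Tmin, fun N T T₀ hK hT Ω _ μ _ I θstar θhat hrun hT₀ hT₁ => ?_⟩
    obtain ⟨hdT, hord⟩ := hTmin T hT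
    have h := hrun.regret_le hd hK1 hK hκ hσ hdT hT₀
    have e : 21 / κ * MNLBandit.regretRate d T =
        20 / κ * MNLBandit.regretRate d T + 1 / κ * MNLBandit.regretRate d T := by ring
    linarith
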